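/- Let $k$ be a commutative unital ring and let dg modules be lower $\mathbb{Z}$-graded chain complexes of $k$-modules, with their usual tensor product and Koszul signs. A $\Sigma_*$-module is a functor from the groupoid of finite sets and bijections to dg modules. Let $\mathcal{P}$ be a (symmetric, unital) operad in dg modules which is cofibrant in dg modules, i.e. in each arity its underlying dg module is cofibrant: $0\to\mathcal P(E)$ has the left lifting property with respect to all degreewise surjective quasi-isomorphisms. A right $\mathcal{P}$-module is a $\Sigma_*$-module $M$ with an associative, unital, equivariant right action of $\mathcal{P}$ by partial compositions $\circ_e\colon M(E)\otimes\mathcal{P}(F)\to M((E\setminus\{e\})\sqcup F)$, $e\in E$. Right $\mathcal{P}$-modules carry the tensor product $(M\otimes N)(E)=\bigoplus_{E=A\sqcup B}M(A)\otimes N(B)$; a dg module $C$ is regarded as a right $\mathcal P$-module concentrated in arity $\emptyset$, so that $(C\otimes N)(E)=C\otimes N(E)$. For a $\Sigma_*$-module $K$ let $K\circ\mathcal{P}$ be the free right $\mathcal{P}$-module generated by $K$. For $r\ge 0$ let $F_r$ be the $\Sigma_*$-module with $F_r(r)=k[\Sigma_r]$ in degree $0$ and $F_r(l)=0$ for $l\ne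 r$. For $d\in\mathbb Z$ let $S^{d-1}$ be $k$ in degree $d-1$, let $D^d$ be $k$ in degrees $d$ and $d-1$ with differential $\mathrm{id}_k$, and let $S^{d-1}\to D^d$ be the map which is the identity in degree $d-1$. Let $U$ be an associative unital algebra in right $\mathcal{P}$-modules (with respect to $\otimes$), let $U\mathrm{-Mod}_{\mathcal P}$ be the category of left $U$-modules in right $\mathcal{P}$-modules, and for a right $\mathcal P$-module $N$ let $U\otimes N$ be the left $U$-module with action given by the multiplication of $U$. Theorem. The category $U\mathrm{-Mod}_{\mathcal P}$ is complete and cocomplete and carries a model structure in which a morphism is - a weak equivalence if and only if the underlying morphism of right $\mathcal{P}$-modules is a weak equivalence, i.e. a quasi-isomorphism in every arity; - a fibration if and only if the underlying morphism of right $\mathcal{P}$-modules is a fibration, i.e. surjective in every arity and degree. This model structure is cofibrantly generated, with generating cofibrations $$FI=\{\,U\otimes(S^{d-1}\otimes(F_r\circ\mathcal{P}))\to U\otimes(D^d\otimes(F_r\circ\mathcal{P}))\;:\; d\in\mathbb{Z},\ r\ge 0\,\}$$ and generating acyclic cofibrations $$FJ=\{\,U\otimes(0\otimes(F_r\circ\mathcal{P}))\to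 U\otimes(D^d\otimes(F_r\circ\mathcal{P}))\;:\; d\in\mathbb{Z},\ r\ge 0\,\},$$ all induced by the maps $S^{d-1}\to D^d$ and $0\to D^d$: both sets permit the small object argument, the acyclic fibrations are exactly the morphisms with the right lifting property with respect to $FI$, and the fibrations are exactly the morphisms with the right lifting property with respect to $FJ$. -/

import Mathlib

open CategoryTheory Limits HomotopicalAlgebra
open scoped TensorProduct

universe u

namespace DGOperad

noncomputable section

/-- The groupoid of finite sets and bijections. It is represented by its small full subgroupoid
on the finite subsets of `ℕ`, to which every finite set is isomorphic (and any two finite sets have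
disjoint copies in it). -/
def Bij : Type := Finset ℕ

/-- A finite subset of `ℕ` as an object of the groupoid. -/
abbrev Bij.of (E : Finset ℕ) : Bij := E

/-- The underlying finite set of an object of the groupoid. -/
abbrev Bij.set (E : Bij) : Finset ℕ := E

instance : Category.{0} Bij where
  Hom A B := A.set ≃ B.set
  id A := Equiv.refl _
  comp f g := f.trans g

/-- Differential graded `k`-modules: lower `ℤ`-graded, the differential lowers degrees. -/
abbrev DGMod (k : Type u) [CommRing k] : Type (u + 1) := ChainComplex (ModuleCat.{u} k) ℤ

/-- `Σ_*`-modules (symmetric sequences) in dg modules, as functors on the groupoid of finite sets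
and bijections. Contravariant functors on a groupoid are identified with covariant ones through
`σ ↦ σ⁻¹`. -/
abbrev SMod (k : Type u) [CommRing k] : Type (u + 1) := Bij ⥤ DGMod k

variable {k : Type u} [CommRing k]

/-- The `k`-module `M(E)_n` of elements of arity `E` and degree `n`. -/
abbrev El (M : SMod k) (E : Finset ℕ) (n : ℤ) : Type u := ((M.obj (Bij.of E)).X n : ModuleCat.{u} k)

/-- The differential `M(E)_n → M(E)_{n'}` (zero unless `n' + 1 = n`). -/
def dl (M : SMod k) (E : Finset ℕ) (n n' : ℤ) : El M E n →ₗ[k] El M E n' :=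
  ((M.obj (Bij.of E)).d n n').hom

/-- Relabelling along a bijection of finite sets. -/
def rl (M : SMod k) {E E' : Finset ℕ} (σ : E ≃ E') (n : ℤ) : El M E n →ₗ[k] El M E' n :=
  ((M.map (X := (Bij.of E)) (Y := (Bij.of E')) σ).f n).hom

/-- The components of a morphism of `Σ_*`-modules. -/
def hl {M N : SMod k} (f : M ⟶ N) (E : Finset ℕ) (n : ℤ) : El M E n →ₗ[k] El N E n :=
  ((f.app (Bij.of E)).f n).hom

section basic

variable (M : SMod k)

lemma dl_shape (E : Finset ℕ) {n n' : ℤ} (h : ¬ n' + 1 = n) : dl M E n n' = 0 := by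
  have : (M.obj (Bij.of E)).d n n' = 0 := (M.obj _).shape _ _ h
  rw [dl, this]; rfl

lemma dl_dl (E : Finset ℕ) (n n' n'' : ℤ) (x : El M E n) : dl M E n' n'' (dl M E n n' x) = 0 := by
  have := (M.obj (Bij.of E)).d_comp_d n n' n''
  exact congrArg (fun f => f.hom x) this

lemma rl_refl (E : Finset ℕ) (n : ℤ) (x : El M E n) : rl M (Equiv.refl E) n x = x := by
  have := M.map_id (Bij.of E)
  exact congrArg (fun f => (f.f n).hom x) this

lemma rl_trans {E E' E'' : Finset ℕ} (σ : E ≃ E') (τ : E' ≃ E'') (n : ℤ) (x : El M E n) :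
    rl M (σ.trans τ) n x = rl M τ n (rl M σ n x) := by
  have := M.map_comp (X := (Bij.of E)) (Y := (Bij.of E'))
    (Z := (Bij.of E'')) σ τ
  exact congrArg (fun f => (f.f n).hom x) this

lemma dl_rl {E E' : Finset ℕ} (σ : E ≃ E') (n n' : ℤ) (x : El M E n) :
    dl M E' n n' (rl M σ n x) = rl M σ n' (dl M E n n' x) := by
  have := (M.map (X := (Bij.of E)) (Y := (Bij.of E')) σ).comm n n'
  exact congrArg (fun f => f.hom x) this

variable {M} {N L : SMod k}

lemma hl_dl (f : M ⟶ N) (E : Finset ℕ) (n n' : ℤ) (x : El M E n) :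
    hl f E n' (dl M E n n' x) = dl N E n n' (hl f E n x) := by
  have := (f.app (Bij.of E)).comm n n'
  exact congrArg (fun f => f.hom x) this.symm

lemma hl_rl (f : M ⟶ N) {E E' : Finset ℕ} (σ : E ≃ E') (n : ℤ) (x : El M E n) :
    hl f E' n (rl M σ n x) = rl N σ n (hl f E n x) := by
  have := f.naturality (X := (Bij.of E)) (Y := (Bij.of E')) σ
  exact congrArg (fun f => (f.f n).hom x) this

lemma hl_id (E : Finset ℕ) (n : ℤ) (x : El M E n) : hl (𝟙 M) E n x = x := rfl

lemma hl_comp (f : M ⟶ N) (g : N ⟶ L) (E : Finset ℕ) (n : ℤ) (x : El M E n) :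
    hl (f ≫ g) E n x = hl g E n (hl f E n x) := rfl

lemma hom_ext {f g : M ⟶ N} (h : ∀ E n x, hl f E n x = hl g E n x) : f = g := by
  ext E n x
  exact h E n x

end basic

section mk

variable (X : Finset ℕ → ℤ → Type u) [∀ E n, AddCommGroup (X E n)] [∀ E n, Module k (X E n)]
  (d : ∀ E n n', X E n →ₗ[k] X E n') (r : ∀ {E E' : Finset ℕ}, (E ≃ E') → ∀ n, X E n →ₗ[k] X E' n)
  (shape : ∀ E n n', ¬ n' + 1 = n → d E n n' = 0)
  (dd : ∀ E n n' n'' x, n' + 1 = n → n'' + 1 = n' → d E n' n'' (d E n n' x) = 0)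
  (r_refl : ∀ (E : Finset ℕ) n x, r (E := E) (E' := E) (Equiv.refl _) n x = x)
  (r_trans : ∀ {E E' E'' : Finset ℕ} (σ : E ≃ E') (τ : E' ≃ E'') n x,
    r (σ.trans τ) n x = r τ n (r σ n x))
  (d_r : ∀ {E E' : Finset ℕ} (σ : E ≃ E') n n' x, n' + 1 = n →
    d E' n n' (r σ n x) = r σ n' (d E n n' x))

/-- A `Σ_*`-module from its modules of elements, differentials and relabellings. -/
def mkSMod : SMod k where
  obj E :=
    { X := fun n => ModuleCat.of k (X E.set n)
      d := fun n n' => ModuleCat.ofHom (d E.set n n')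
      shape := fun n n' h => by rw [shape E.set n n' h]; rfl
      d_comp_d' := fun n n' n'' h h' => by
        ext x
        exact dd E.set n n' n'' x h h' }
  map {E E'} σ :=
    { f := fun n => ModuleCat.ofHom (r (E := E.set) (E' := E'.set) σ n)
      comm' := fun n n' h => by
        ext x
        exact d_r (E := E.set) (E' := E'.set) σ n n' x h }
  map_id E := by
    ext n x
    exact r_refl E.set n x
  map_comp {E E' E''} σ τ := by
    ext n x
    exact r_trans (E := E.set) (E' := E'.set) (E'' := E''.set) σ τ n x

/-- A morphism of `Σ_*`-modules from its components. -/
def mkHom {M N : SMod k} (f : ∀ E n, El M E n →ₗ[k] El N E n)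
    (f_d : ∀ E n n' x, n' + 1 = n → f E n' (dl M E n n' x) = dl N E n n' (f E n x))
    (f_r : ∀ {E E' : Finset ℕ} (σ : E ≃ E') n x, f E' n (rl M σ n x) = rl N σ n (f E n x)) :
    M ⟶ N where
  app E :=
    { f := fun n => ModuleCat.ofHom (f E.set n)
      comm' := fun n n' h => by
        ext x
        exact (f_d E.set n n' x h).symm }
  naturality E E' σ := by
    ext n x
    exact f_r (E := E.set) (E' := E'.set) σ n x

lemma hl_mkHom {M N : SMod k} (f : ∀ E n, El M E n →ₗ[k] El N E n)
    (f_d : ∀ E n n' x, n' + 1 = n → f E n' (dl M E n n' x) = dl N E n n' (f E n x))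
    (f_r : ∀ {E E' : Finset ℕ} (σ : E ≃ E') n x, f E' n (rl M σ n x) = rl N σ n (f E n x))
    (E : Finset ℕ) (n : ℤ) : hl (mkHom f f_d f_r) E n = f E n := rfl

end mk


/-! ### Operads and right modules -/

/-- The Koszul sign `(-1)^i`. -/
def sg (i : ℤ) : ℤ := (i.negOnePow : ℤˣ)

/-- `Subst E e F G` says that the finite set `G` is `(E ∖ {e}) ⊔ F`, with `e ∈ E`. -/
def Subst (E : Finset ℕ) (e : ℕ) (F G : Finset ℕ) : Prop :=
  e ∈ E ∧ Disjoint (E.erase e) F ∧ E.erase e ∪ F = G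

/-- `ρ` restricts to `σ`. -/
def Extends {A A' E E' : Finset ℕ} (σ : A ≃ A') (ρ : E ≃ E') : Prop :=
  ∀ (x : ℕ) (hx : x ∈ A) (hx' : x ∈ E), (ρ ⟨x, hx'⟩ : ℕ) = σ ⟨x, hx⟩

/-- For `G = (E ∖ {e}) ⊔ F` and `G' = (E' ∖ {e'}) ⊔ F'`: the bijection `ρ : G ≃ G'` is the one
which `σ : E ≃ E'` and `τ : F ≃ F'` induce. -/
def Glues {E E' F F' G G' : Finset ℕ} (e : ℕ) (σ : E ≃ E') (τ : F ≃ F') (ρ : G ≃ G') : Prop :=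
  (∀ (x : ℕ) (hx : x ∈ E) (hx' : x ∈ G), x ≠ e → (ρ ⟨x, hx'⟩ : ℕ) = σ ⟨x, hx⟩) ∧ Extends τ ρ

/-- Bilinear partial composition operations `∘_e : M(E)_i × P(F)_j → M((E ∖ {e}) ⊔ F)_{i+j}`. -/
structure PartialComp (M P : SMod k) where
  /-- `act h hn m p` is `m ∘_e p`. -/
  act : ∀ {E F G : Finset ℕ} {e : ℕ}, Subst E e F G → ∀ {i j n : ℤ}, i + j = n →
    (El M E i →ₗ[k] El P F j →ₗ[k] El M G n)

variable (k) in
/-- The data of an operad in dg modules: partial compositions and a unit in every singleton. -/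
structure PreOperad where
  /-- the underlying symmetric sequence -/
  S : SMod k
  /-- the partial compositions -/
  comp : PartialComp S S
  /-- the operadic unit -/
  one : ∀ x : ℕ, El S {x} 0

/-- The axioms of a right action of an operad on a `Σ_*`-module through partial compositions. -/
structure IsRightAction (P : PreOperad k) (M : SMod k) (α : PartialComp M P.S) : Prop where
  leibniz : ∀ {E F G : Finset ℕ} {e : ℕ} (h : Subst E e F G) {i i' j j' n n' : ℤ}
    (hi : i' + 1 = i) (hj : j' + 1 = j) (_ : n' + 1 = n) (hn : i + j = n)
    (m : El M E i) (p : El P.S F j),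
    dl M G n n' (α.act h hn m p) =
      α.act h (by omega) (dl M E i i' m) p + sg i • α.act h (by omega) m (dl P.S F j j' p)
  equivariant : ∀ {E F G E' F' G' : Finset ℕ} {e e' : ℕ} (h : Subst E e F G)
    (h' : Subst E' e' F' G') (σ : E ≃ E') (τ : F ≃ F') (ρ : G ≃ G'),
    (σ ⟨e, h.1⟩ : ℕ) = e' → Glues e σ τ ρ →
    ∀ {i j n : ℤ} (hn : i + j = n) (m : El M E i) (p : El P.S F j),
    rl M ρ n (α.act h hn m p) = α.act h' hn (rl M σ i m) (rl P.S τ j p)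
  assoc_seq : ∀ {E F H G F' L : Finset ℕ} {e f : ℕ} (h₁ : Subst E e F H) (_ : f ∈ F)
    (h₂ : Subst H f G L) (h₃ : Subst F f G F') (h₄ : Subst E e F' L)
    {i j l s t n : ℤ} (hs : i + j = s) (hn : s + l = n) (ht : j + l = t) (hn' : i + t = n)
    (m : El M E i) (p : El P.S F j) (q : El P.S G l),
    α.act h₂ hn (α.act h₁ hs m p) q = α.act h₄ hn' m (P.comp.act h₃ ht p q)
  assoc_par : ∀ {E F G H H' L : Finset ℕ} {e f : ℕ} (_ : e ≠ f) (_ : e ∈ E) (_ : f ∈ E)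
    (h₁ : Subst E e F H) (h₂ : Subst H f G L) (h₃ : Subst E f G H') (h₄ : Subst H' e F L)
    {i j l s t n : ℤ} (hs : i + j = s) (hn : s + l = n) (ht : i + l = t) (hn' : t + j = n)
    (m : El M E i) (p : El P.S F j) (q : El P.S G l),
    α.act h₂ hn (α.act h₁ hs m p) q = sg (j * l) • α.act h₄ hn' (α.act h₃ ht m q) p
  act_one : ∀ {E : Finset ℕ} {e : ℕ} (h : Subst E e {e} E) {i : ℤ} (hi : i + 0 = i)
    (m : El M E i), α.act h hi m (P.one e) = m

variable (k) in
/-- Symmetric operads in dg `k`-modules. -/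
structure Operad extends PreOperad k where
  isRightAction : IsRightAction toPreOperad S comp
  one_comp : ∀ {F : Finset ℕ} {x : ℕ} (h : Subst {x} x F F) {j : ℤ} (hj : 0 + j = j)
    (p : El S F j), comp.act h hj (one x) p = p
  d_one : ∀ (x : ℕ) (n : ℤ), dl S {x} 0 n (one x) = 0
  one_equivariant : ∀ (x y : ℕ) (σ : ({x} : Finset ℕ) ≃ ({y} : Finset ℕ)),
    rl S σ 0 (one x) = one y

/-- Right modules over the operad `P`. -/
structure RMod (P : Operad k) where
  /-- the underlying `Σ_*`-module -/
  S : SMod k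
  /-- the right action of `P` -/
  α : PartialComp S P.S
  isRightAction : IsRightAction P.toPreOperad S α

/-- Morphisms of right `P`-modules. -/
@[ext]
structure RMod.Hom {P : Operad k} (M N : RMod P) where
  /-- the underlying morphism of `Σ_*`-modules -/
  hom : M.S ⟶ N.S
  map_act : ∀ {E F G : Finset ℕ} {e : ℕ} (h : Subst E e F G) {i j n : ℤ} (hn : i + j = n)
    (m : El M.S E i) (p : El P.S F j),
    hl hom G n (M.α.act h hn m p) = N.α.act h hn (hl hom E i m) p

instance (P : Operad k) : Category (RMod P) where
  Hom := RMod.Hom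
  id M := ⟨𝟙 M.S, fun _ _ _ _ _ _ _ => rfl⟩
  comp f g := ⟨f.hom ≫ g.hom, fun h _ _ _ hn m p => by
    rw [hl_comp, f.map_act, g.map_act, hl_comp]⟩

section RModBasic

variable {P : Operad k}

@[ext]
lemma RMod.hom_ext {M N : RMod P} {f g : M ⟶ N} (h : f.hom = g.hom) : f = g := RMod.Hom.ext h

@[simp] lemma RMod.id_hom (M : RMod P) : RMod.Hom.hom (𝟙 M) = 𝟙 M.S := rfl
@[simp] lemma RMod.comp_hom {M N L : RMod P} (f : M ⟶ N) (g : N ⟶ L) :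
    (f ≫ g).hom = f.hom ≫ g.hom := rfl
lemma RMod.hl_comp {M N L : RMod P} (f : M ⟶ N) (g : N ⟶ L) (E : Finset ℕ) (n : ℤ)
    (x : El M.S E n) : hl (f ≫ g).hom E n x = hl g.hom E n (hl f.hom E n x) := rfl

end RModBasic

/-! ### The tensor product of right modules -/

lemma sg_add (i j : ℤ) : sg (i + j) = sg i * sg j := by
  simp [sg, Int.negOnePow_add]

lemma sg_mul_self (i : ℤ) : sg i * sg i = 1 := by
  rw [← sg_add, sg, Int.negOnePow_even _ ⟨i, rfl⟩]; rfl

lemma sg_pred {i i' : ℤ} (h : i' + 1 = i) : sg i = - sg i' := by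
  subst h; rw [sg_add]; simp [sg]

/-- `E = A ⊔ B`. -/
def Split (A B E : Finset ℕ) : Prop := Disjoint A B ∧ A ∪ B = E

/-- The indices of the summands `M(A)_i ⊗ N(B)_j` of `(M ⊗ N)(E)_n`. -/
structure SplitIdx (E : Finset ℕ) (n : ℤ) where
  /-- the first part -/
  A : Finset ℕ
  /-- the second part -/
  B : Finset ℕ
  /-- the first degree -/
  i : ℤ
  /-- the second degree -/
  j : ℤ
  split : Split A B E
  deg : i + j = n

/-- `(M ⊗ N)(E)_n = ⨁ M(A)_i ⊗ N(B)_j`, the sum over `E = A ⊔ B` and `i + j = n`. -/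
abbrev TX (M N : SMod k) (E : Finset ℕ) (n : ℤ) : Type u :=
  DirectSum (SplitIdx E n) fun x => El M x.A x.i ⊗[k] El N x.B x.j

section TX

variable {M N : SMod k} {E : Finset ℕ} {n : ℤ} {Z : Type u} [AddCommGroup Z] [Module k Z]

open scoped Classical in
/-- The homogeneous pure tensors of `M ⊗ N`. -/
def pt {A B : Finset ℕ} (h : Split A B E) {i j : ℤ} (hn : i + j = n) :
    El M A i →ₗ[k] El N B j →ₗ[k] TX M N E n :=
  (TensorProduct.mk k (El M A i) (El N B j)).compr₂
    (DirectSum.lof k (SplitIdx E n) (fun x => El M x.A x.i ⊗[k] El N x.B x.j) ⟨A, B, i, j, h, hn⟩)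

open scoped Classical in
/-- Linear maps out of `(M ⊗ N)(E)_n` from families of bilinear maps. -/
def TX.lift (b : ∀ (A B : Finset ℕ) (i j : ℤ), Split A B E → i + j = n →
    (El M A i →ₗ[k] El N B j →ₗ[k] Z)) : TX M N E n →ₗ[k] Z :=
  DirectSum.toModule k (SplitIdx E n) Z
    (fun x => TensorProduct.lift (b x.A x.B x.i x.j x.split x.deg))

lemma TX.lift_pt (b : ∀ (A B : Finset ℕ) (i j : ℤ), Split A B E → i + j = n →
    (El M A i →ₗ[k] El N B j →ₗ[k] Z)) {A B : Finset ℕ} (h : Split A B E) {i j : ℤ}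
    (hn : i + j = n) (x : El M A i) (y : El N B j) :
    TX.lift b (pt h hn x y) = b A B i j h hn x y := by
  classical
  simp only [TX.lift, pt, LinearMap.compr₂_apply, TensorProduct.mk_apply]
  erw [DirectSum.toModule_lof]
  simp

lemma TX.ind {p : TX M N E n → Prop} (h0 : p 0) (hadd : ∀ x y, p x → p y → p (x + y))
    (hpt : ∀ {A B : Finset ℕ} (h : Split A B E) {i j : ℤ} (hn : i + j = n) (x : El M A i)
      (y : El N B j), p (pt h hn x y)) (x : TX M N E n) : p x := by
  classical
  induction x using DirectSum.induction_on with
  | zero => exact h0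
  | add x y hx hy => exact hadd x y hx hy
  | of s t =>
    induction t using TensorProduct.induction_on with
    | zero => simpa using h0
    | add x y hx hy => rw [map_add]; exact hadd _ _ hx hy
    | tmul x y => exact hpt s.split s.deg x y

lemma TX.ext {f g : TX M N E n →ₗ[k] Z}
    (h : ∀ {A B : Finset ℕ} (h : Split A B E) {i j : ℤ} (hn : i + j = n) (x : El M A i)
      (y : El N B j), f (pt h hn x y) = g (pt h hn x y)) : f = g := by
  ext1 x
  refine TX.ind (p := fun x => f x = g x) (by simp) (fun x y hx hy => by simp [hx, hy]) ?_ x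
  intros; apply h

end TX

lemma Split.left {A B E : Finset ℕ} (h : Split A B E) : A ⊆ E :=
  h.2 ▸ Finset.subset_union_left

lemma Split.right {A B E : Finset ℕ} (h : Split A B E) : B ⊆ E :=
  h.2 ▸ Finset.subset_union_right

lemma Split.mem {A B E : Finset ℕ} (h : Split A B E) {x : ℕ} (hx : x ∈ E) : x ∈ A ∨ x ∈ B := by
  rw [← h.2] at hx; simpa using hx

lemma Split.not_mem {A B E : Finset ℕ} (h : Split A B E) {x : ℕ} (hx : x ∈ A) : x ∉ B :=
  Finset.disjoint_left.1 h.1 hx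

/-- The image of `A` under the bijection `σ : E ≃ E'`. -/
def im {E E' : Finset ℕ} (σ : E ≃ E') (A : Finset ℕ) : Finset ℕ :=
  (E'.attach.filter (fun y => (σ.symm y : ℕ) ∈ A)).map (Function.Embedding.subtype _)

lemma mem_im {E E' : Finset ℕ} (σ : E ≃ E') (A : Finset ℕ) (y : ℕ) :
    y ∈ im σ A ↔ ∃ h : y ∈ E', (σ.symm ⟨y, h⟩ : ℕ) ∈ A := by
  simp [im]

/-- The restriction of `σ : E ≃ E'` to a bijection from `A ⊆ E` onto its image. -/
def res {E E' : Finset ℕ} (σ : E ≃ E') {A : Finset ℕ} (hA : A ⊆ E) : A ≃ im σ A where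
  toFun x := ⟨σ ⟨x, hA x.2⟩, (mem_im _ _ _).2 ⟨(σ _).2, by simp⟩⟩
  invFun y := ⟨σ.symm ⟨y, ((mem_im _ _ _).1 y.2).1⟩, ((mem_im _ _ _).1 y.2).2⟩
  left_inv x := by simp
  right_inv y := by simp

lemma res_extends {E E' : Finset ℕ} (σ : E ≃ E') {A : Finset ℕ} (hA : A ⊆ E) :
    Extends (res σ hA) σ := fun _ _ _ => rfl

lemma eq_im {E E' A A' : Finset ℕ} {σ : E ≃ E'} {τ : A ≃ A'} (h : Extends τ σ) (hA : A ⊆ E) :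
    A' = im σ A := by
  ext y
  rw [mem_im]
  constructor
  · intro hy
    have h1 := h (τ.symm ⟨y, hy⟩) (τ.symm ⟨y, hy⟩).2 (hA (τ.symm ⟨y, hy⟩).2)
    simp only [Subtype.coe_eta, Equiv.apply_symm_apply] at h1
    refine ⟨h1 ▸ (σ _).2, ?_⟩
    have h2 : (⟨y, h1 ▸ (σ _).2⟩ : E') = σ ⟨(τ.symm ⟨y, hy⟩ : A), hA (τ.symm ⟨y, hy⟩).2⟩ :=
      Subtype.ext h1.symm
    rw [h2]; simp
  · rintro ⟨hy, h1⟩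
    have h2 := h _ h1 (hA h1)
    simp only [Subtype.coe_eta, Equiv.apply_symm_apply] at h2
    rw [h2]; exact (τ _).2

lemma eq_res {E E' A : Finset ℕ} {σ : E ≃ E'} (hA : A ⊆ E) {τ : A ≃ im σ A} (h : Extends τ σ) :
    τ = res σ hA := by
  ext x
  exact (h x x.2 (hA x.2)).symm

lemma split_im {E E' A B : Finset ℕ} (σ : E ≃ E') (h : Split A B E) :
    Split (im σ A) (im σ B) E' := by
  constructor
  · rw [Finset.disjoint_left]
    intro y hy hy'
    exact h.not_mem ((mem_im _ _ _).1 hy).2 ((mem_im _ _ _).1 hy').2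
  · ext y
    simp only [Finset.mem_union, mem_im]
    constructor
    · rintro (⟨h, _⟩ | ⟨h, _⟩) <;> exact h
    · intro hy
      rcases h.mem (σ.symm ⟨y, hy⟩).2 with h | h
      · exact Or.inl ⟨hy, h⟩
      · exact Or.inr ⟨hy, h⟩

section tensorS

variable (M N : SMod k)

/-- `d(m ⊗ n) = dm ⊗ n + (-1)^{|m|} m ⊗ dn`. -/
def tensorD (E : Finset ℕ) (n n' : ℤ) : TX M N E n →ₗ[k] TX M N E n' :=
  if h : n' + 1 = n then
    TX.lift fun A B i j hs hn =>
      (pt hs (i := i - 1) (j := j) (by omega)).comp (dl M A i (i - 1)) +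
        sg i • (pt hs (i := i) (j := j - 1) (by omega)).compl₂ (dl N B j (j - 1))
  else 0

/-- `σ(m ⊗ n) = σ(m) ⊗ σ(n)`. -/
def tensorR {E E' : Finset ℕ} (σ : E ≃ E') (n : ℤ) : TX M N E n →ₗ[k] TX M N E' n :=
  TX.lift fun _ _ i j hs hn =>
    (pt (split_im σ hs) hn).compl₁₂ (rl M (res σ hs.left) i) (rl N (res σ hs.right) j)

variable {M N}

lemma tensorD_pt {A B E : Finset ℕ} (hs : Split A B E) {i i' j j' n n' : ℤ} (hn : i + j = n)
    (h : n' + 1 = n) (hi : i' + 1 = i) (hj : j' + 1 = j) (x : El M A i) (y : El N B j) :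
    tensorD M N E n n' (pt hs hn x y) =
      pt hs (by omega) (dl M A i i' x) y + sg i • pt hs (by omega) x (dl N B j j' y) := by
  obtain rfl : i' = i - 1 := by omega
  obtain rfl : j' = j - 1 := by omega
  rw [tensorD, dif_pos h, TX.lift_pt]
  rfl

lemma tensorR_pt {A B A' B' E E' : Finset ℕ} (σ : E ≃ E') (hs : Split A B E)
    (hs' : Split A' B' E') (σA : A ≃ A') (σB : B ≃ B') (hA : Extends σA σ) (hB : Extends σB σ)
    {i j n : ℤ} (hn : i + j = n) (x : El M A i) (y : El N B j) :
    tensorR M N σ n (pt hs hn x y) = pt hs' hn (rl M σA i x) (rl N σB j y) := by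
  obtain rfl := eq_im hA hs.left
  obtain rfl := eq_im hB hs.right
  obtain rfl := eq_res hs.left hA
  obtain rfl := eq_res hs.right hB
  rw [tensorR, TX.lift_pt]
  rfl

variable (M N)

/-- The tensor product of `Σ_*`-modules. -/
def tensorS : SMod k :=
  mkSMod (TX M N) (tensorD M N) (fun σ n => tensorR M N σ n)
    (fun E n n' h => by rw [tensorD, dif_neg h])
    (fun E n n' n'' x h h' => by
      refine TX.ind (p := fun x => tensorD M N E n' n'' (tensorD M N E n n' x) = 0)
        (by simp) (fun x y hx hy => by simp [hx, hy]) ?_ x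
      intro A B hs i j hn x y
      rw [tensorD_pt hs hn h (i' := i - 1) (j' := j - 1) (by omega) (by omega), map_add,
        map_zsmul, tensorD_pt hs _ h' (i' := i - 1 - 1) (j' := j - 1) (by omega) (by omega),
        tensorD_pt hs _ h' (i' := i - 1) (j' := j - 1 - 1) (by omega) (by omega)]
      rw [dl_dl, dl_dl, sg_pred (i' := i - 1) (i := i) (by omega)]
      simp)
    (fun E n x => by
      refine TX.ind (p := fun x => tensorR M N (Equiv.refl E) n x = x)
        (by simp) (fun x y hx hy => by simp only [map_add, hx, hy]) ?_ x
      intro A B hs i j hn x y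
      rw [tensorR_pt _ hs hs (Equiv.refl A) (Equiv.refl B) (fun _ _ _ => rfl) (fun _ _ _ => rfl),
        rl_refl, rl_refl])
    (fun {E E' E''} σ τ n x => by
      refine TX.ind (p := fun x => tensorR M N (σ.trans τ) n x =
        tensorR M N τ n (tensorR M N σ n x))
        (by simp) (fun x y hx hy => by simp only [map_add, hx, hy]) ?_ x
      intro A B hs i j hn x y
      rw [tensorR_pt σ hs (split_im σ hs) (res σ hs.left) (res σ hs.right) (res_extends _ _)
          (res_extends _ _),
        tensorR_pt τ (split_im σ hs) (split_im τ (split_im σ hs))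
          (res τ (split_im σ hs).left) (res τ (split_im σ hs).right) (res_extends _ _)
          (res_extends _ _),
        tensorR_pt (σ.trans τ) hs (split_im τ (split_im σ hs))
          ((res σ hs.left).trans (res τ (split_im σ hs).left))
          ((res σ hs.right).trans (res τ (split_im σ hs).right))
          (fun _ _ _ => rfl) (fun _ _ _ => rfl), rl_trans, rl_trans])
    (fun {E E'} σ n n' x h => by
      refine TX.ind (p := fun x => tensorD M N E' n n' (tensorR M N σ n x) =
        tensorR M N σ n' (tensorD M N E n n' x))
        (by simp) (fun x y hx hy => by simp only [map_add, hx, hy]) ?_ x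
      intro A B hs i j hn x y
      rw [tensorR_pt σ hs (split_im σ hs) (res σ hs.left) (res σ hs.right) (res_extends _ _)
          (res_extends _ _),
        tensorD_pt hs hn h (i' := i - 1) (j' := j - 1) (by omega) (by omega),
        tensorD_pt _ hn h (i' := i - 1) (j' := j - 1) (by omega) (by omega), map_add, map_zsmul,
        tensorR_pt σ hs (split_im σ hs) (res σ hs.left) (res σ hs.right) (res_extends _ _)
          (res_extends _ _),
        tensorR_pt σ hs (split_im σ hs) (res σ hs.left) (res σ hs.right) (res_extends _ _)
          (res_extends _ _), dl_rl, dl_rl])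

end tensorS

section tmul

variable {M N : SMod k} {E : Finset ℕ} {n : ℤ} {Z : Type u} [AddCommGroup Z] [Module k Z]

/-- The homogeneous pure tensor `x ⊗ y` in `(M ⊗ N)(E)_n`. -/
def tmul {A B : Finset ℕ} (h : Split A B E) {i j : ℤ} (hn : i + j = n) :
    El M A i →ₗ[k] El N B j →ₗ[k] El (tensorS M N) E n :=
  pt h hn

/-- Linear maps out of `(M ⊗ N)(E)_n` from families of bilinear maps. -/
def tlift (b : ∀ (A B : Finset ℕ) (i j : ℤ), Split A B E → i + j = n →
    (El M A i →ₗ[k] El N B j →ₗ[k] Z)) : El (tensorS M N) E n →ₗ[k] Z :=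
  TX.lift b

lemma tlift_tmul (b : ∀ (A B : Finset ℕ) (i j : ℤ), Split A B E → i + j = n →
    (El M A i →ₗ[k] El N B j →ₗ[k] Z)) {A B : Finset ℕ} (h : Split A B E) {i j : ℤ}
    (hn : i + j = n) (x : El M A i) (y : El N B j) :
    tlift b (tmul h hn x y) = b A B i j h hn x y :=
  TX.lift_pt b h hn x y

lemma tind {p : El (tensorS M N) E n → Prop} (h0 : p 0) (hadd : ∀ x y, p x → p y → p (x + y))
    (hpt : ∀ {A B : Finset ℕ} (h : Split A B E) {i j : ℤ} (hn : i + j = n) (x : El M A i)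
      (y : El N B j), p (tmul h hn x y)) (x : El (tensorS M N) E n) : p x :=
  TX.ind (M := M) (N := N) (p := p) h0 hadd hpt x

lemma dl_tmul {A B : Finset ℕ} (hs : Split A B E) {i i' j j' n' : ℤ} (hn : i + j = n)
    (h : n' + 1 = n) (hi : i' + 1 = i) (hj : j' + 1 = j) (x : El M A i) (y : El N B j) :
    dl (tensorS M N) E n n' (tmul hs hn x y) =
      tmul hs (by omega) (dl M A i i' x) y + sg i • tmul hs (by omega) x (dl N B j j' y) :=
  tensorD_pt hs hn h hi hj x y

lemma rl_tmul {A B A' B' E' : Finset ℕ} (σ : E ≃ E') (hs : Split A B E)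
    (hs' : Split A' B' E') (σA : A ≃ A') (σB : B ≃ B') (hA : Extends σA σ) (hB : Extends σB σ)
    {i j : ℤ} (hn : i + j = n) (x : El M A i) (y : El N B j) :
    rl (tensorS M N) σ n (tmul hs hn x y) = tmul hs' hn (rl M σA i x) (rl N σB j y) :=
  tensorR_pt σ hs hs' σA σB hA hB hn x y

end tmul

section tensor3

/-- A trilinear map from a function which is linear in each variable. -/
def mk₃ {U V W Z : Type u} [AddCommGroup U] [Module k U] [AddCommGroup V] [Module k V]
    [AddCommGroup W] [Module k W] [AddCommGroup Z] [Module k Z] (f : U → V → W → Z)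
    (a₁ : ∀ u u' v w, f (u + u') v w = f u v w + f u' v w)
    (s₁ : ∀ (c : k) u v w, f (c • u) v w = c • f u v w)
    (a₂ : ∀ u v v' w, f u (v + v') w = f u v w + f u v' w)
    (s₂ : ∀ (c : k) u v w, f u (c • v) w = c • f u v w)
    (a₃ : ∀ u v w w', f u v (w + w') = f u v w + f u v w')
    (s₃ : ∀ (c : k) u v w, f u v (c • w) = c • f u v w) : U →ₗ[k] V →ₗ[k] W →ₗ[k] Z :=
  LinearMap.mk₂ k (fun u v => { toFun := f u v, map_add' := a₃ u v, map_smul' := fun c => s₃ c u v })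
    (fun _ _ _ => LinearMap.ext fun _ => a₁ _ _ _ _)
    (fun _ _ _ => LinearMap.ext fun _ => s₁ _ _ _ _)
    (fun _ _ _ => LinearMap.ext fun _ => a₂ _ _ _ _)
    (fun _ _ _ => LinearMap.ext fun _ => s₂ _ _ _ _)

lemma Subst.split_left {E F G A B : Finset ℕ} {e : ℕ} (h : Subst E e F G) (hs : Split A B E)
    (he : e ∈ A) : Subst A e F (A.erase e ∪ F) ∧ Split (A.erase e ∪ F) B G := by
  obtain ⟨h1, h2, rfl⟩ := h
  obtain ⟨h3, rfl⟩ := hs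
  have : e ∉ B := Finset.disjoint_left.1 h3 he
  simp only [Finset.disjoint_left, Finset.mem_erase, Finset.mem_union] at h2 h3
  refine ⟨⟨he, ?_, rfl⟩, ?_, ?_⟩
  · simp only [Finset.disjoint_left, Finset.mem_erase]; grind
  · simp only [Finset.disjoint_left, Finset.mem_erase, Finset.mem_union]; grind
  · ext x; simp only [Finset.mem_erase, Finset.mem_union]; grind

lemma Subst.split_right {E F G A B : Finset ℕ} {e : ℕ} (h : Subst E e F G) (hs : Split A B E)
    (he : e ∈ B) : Subst B e F (B.erase e ∪ F) ∧ Split A (B.erase e ∪ F) G := by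
  obtain ⟨h3, h4⟩ := hs
  have := h.split_left (A := B) (B := A) ⟨h3.symm, by rw [Finset.union_comm, h4]⟩ he
  exact ⟨this.1, this.2.1.symm, by rw [Finset.union_comm, this.2.2]⟩

open scoped Classical in
/-- `(m ⊗ n) ∘_e p` is `(-1)^{|n||p|} (m ∘_e p) ⊗ n` if `e` lies in the arity of `m`, and
`m ⊗ (n ∘_e p)` if it lies in the arity of `n`. -/
def tensorA {M N P : SMod k} (α : PartialComp M P) (β : PartialComp N P) :
    PartialComp (tensorS M N) P where
  act {E F G e} h {i j n} hn :=
    tlift fun A B a b hs hi =>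
        if he : e ∈ A then
          mk₃ (fun x y p => sg (j * b) •
              tmul (h.split_left hs he).2 (i := a + j) (j := b) (by omega)
                (α.act (h.split_left hs he).1 rfl x p) y)
            (by simp)
            (fun _ _ _ _ => by simp only [map_smul, LinearMap.smul_apply]; exact smul_comm _ _ _)
            (by simp)
            (fun _ _ _ _ => by simp only [map_smul]; exact smul_comm _ _ _)
            (by simp)
            (fun _ _ _ _ => by simp only [map_smul, LinearMap.smul_apply]; exact smul_comm _ _ _)
        else
          have he' : e ∈ B := (hs.mem h.1).resolve_left he
          mk₃ (fun x y p => tmul (h.split_right hs he').2 (i := a) (j := b + j) (by omega)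
              x (β.act (h.split_right hs he').1 rfl y p))
            (by simp) (by simp) (by simp) (by simp) (by simp) (by simp)

end tensor3

section tensorAction

lemma sg_congr {i j : ℤ} (h : Even (i - j)) : sg i = sg j := by
  have : sg i = sg (i - j) * sg j := by rw [← sg_add]; congr 1; ring
  rw [this, sg, Int.negOnePow_even _ h]; simp

variable {M N P : SMod k} (α : PartialComp M P) (β : PartialComp N P)

lemma tensorA_left {A B A' E F G : Finset ℕ} {e : ℕ} (h : Subst E e F G) (hs : Split A B E)
    (hA : Subst A e F A') (hs' : Split A' B G) {a b i j a' n : ℤ} (hi : a + b = i) (hn : i + j = n)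
    (ha : a + j = a') (hn' : a' + b = n) (x : El M A a) (y : El N B b) (p : El P F j) :
    (tensorA α β).act h hn (tmul hs hi x y) p =
      sg (j * b) • tmul hs' hn' (α.act hA ha x p) y := by
  obtain rfl := hA.2.2
  subst ha
  simp only [tensorA]
  rw [tlift_tmul, dif_pos hA.1]
  rfl

lemma tensorA_right {A B B' E F G : Finset ℕ} {e : ℕ} (h : Subst E e F G) (hs : Split A B E)
    (hB : Subst B e F B') (hs' : Split A B' G) {a b i j b' n : ℤ} (hi : a + b = i) (hn : i + j = n)
    (hb : b + j = b') (hn' : a + b' = n) (x : El M A a) (y : El N B b) (p : El P F j) :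
    (tensorA α β).act h hn (tmul hs hi x y) p = tmul hs' hn' x (β.act hB hb y p) := by
  obtain rfl := hB.2.2
  subst hb
  have he : e ∉ A := fun h' => hs.not_mem h' hB.1
  simp only [tensorA]
  rw [tlift_tmul, dif_neg he]
  rfl

end tensorAction

section tensorIs

variable {P : Operad k} (M N : RMod P)

lemma tensor_leibniz {E F G : Finset ℕ} {e : ℕ} (h : Subst E e F G) {i i' j j' n n' : ℤ}
    (hi : i' + 1 = i) (hj : j' + 1 = j) (hn' : n' + 1 = n) (hn : i + j = n) (hl : i' + j = n')
    (hr : i + j' = n') (m : El (tensorS M.S N.S) E i) (p : El P.S F j) :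
    dl (tensorS M.S N.S) G n n' ((tensorA M.α N.α).act h hn m p) =
      (tensorA M.α N.α).act h hl (dl (tensorS M.S N.S) E i i' m) p +
        sg i • (tensorA M.α N.α).act h hr m (dl P.S F j j' p) := by
  induction m using tind with
  | h0 => simp
  | hadd x y hx hy =>
    simp only [LinearMap.add_apply, map_add, hx, hy, smul_add]; abel
  | @hpt A B hs a b hab x y =>
  rcases hs.mem h.1 with he | he
  · obtain ⟨hA, hs'⟩ := h.split_left hs he
    rw [tensorA_left _ _ h hs hA hs' hab hn rfl (by omega),
      tensorA_left _ _ h hs hA hs' hab _ (a' := a + j') (by omega) (by omega), map_zsmul,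
      dl_tmul hs' _ hn' (i' := a + j') (j' := b - 1) (by omega) (by omega),
      dl_tmul hs _ hi (i' := a - 1) (j' := b - 1) (by omega) (by omega), map_add, map_zsmul,
      LinearMap.add_apply, LinearMap.smul_apply,
      tensorA_left _ _ h hs hA hs' _ _ (a' := a + j') (by omega) (by omega),
      tensorA_left _ _ h hs hA hs' _ _ rfl (by omega),
      M.isRightAction.leibniz hA (i' := a - 1) (j' := j') (by omega) hj (by omega)]
    simp only [map_add, map_zsmul, LinearMap.add_apply, LinearMap.smul_apply, smul_add, smul_smul,
      ← sg_add]
    have e1 : sg (a + j * (b - 1)) = sg (j * b + (a + j)) := by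
      apply sg_congr
      rw [show a + j * (b - 1) - (j * b + (a + j)) = 2 * (-j) by ring]; simp
    have e2 : sg (i + j' * b) = sg (j * b + a) := by
      congr 1; rw [← hab, ← hj]; ring
    rw [e1, e2]
    abel
  · obtain ⟨hB, hs'⟩ := h.split_right hs he
    rw [tensorA_right _ _ h hs hB hs' hab hn rfl (by omega),
      tensorA_right _ _ h hs hB hs' hab hr (b' := b + j') (by omega) (by omega),
      dl_tmul hs' (i := a) (j := b + j) (by omega) hn' (i' := a - 1) (j' := b + j') (by omega)
        (by omega),
      dl_tmul hs hab hi (i' := a - 1) (j' := b - 1) (by omega) (by omega), map_add, map_zsmul,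
      LinearMap.add_apply, LinearMap.smul_apply,
      tensorA_right _ _ h hs hB hs' (by omega) hl (b := b) rfl (by omega),
      tensorA_right _ _ h hs hB hs' (by omega) hl (b := b - 1) (b' := b + j') (by omega) (by omega),
      N.isRightAction.leibniz hB (i' := b - 1) (j' := j') (by omega) hj (by omega)]
    simp only [map_add, map_zsmul, smul_add, smul_smul, ← sg_add]
    rw [show sg (a + b) = sg i by rw [hab]]
    abel

lemma Glues.restrict {E E' F F' G G' A : Finset ℕ} {e e' : ℕ} (h : Subst E e F G)
    (h' : Subst E' e' F' G') {σ : E ≃ E'} {τ : F ≃ F'} {ρ : G ≃ G'} (he : (σ ⟨e, h.1⟩ : ℕ) = e')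
    (hg : Glues e σ τ ρ) (hA : A ⊆ E) (heA : e ∈ A) {A₁ : Finset ℕ} (hA₁ : Subst A e F A₁)
    (hA₁G : A₁ ⊆ G) :
    Subst (im σ A) e' F' (im ρ A₁) ∧ (res σ hA ⟨e, heA⟩ : ℕ) = e' ∧
      Glues e (res σ hA) τ (res ρ hA₁G) := by
  have hg1 : Glues e (res σ hA) τ (res ρ hA₁G) :=
    ⟨fun x hx hx' hxe => hg.1 x (hA hx) (hA₁G hx') hxe, fun x hx hx' => hg.2 x hx (hA₁G hx')⟩
  refine ⟨⟨?_, ?_, ?_⟩, he, hg1⟩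
  · rw [← he]; exact (res σ hA ⟨e, heA⟩).2
  · refine Disjoint.mono_left ?_ h'.2.1
    refine Finset.erase_subset_erase _ ?_
    intro y hy
    exact ((mem_im _ _ _).1 hy).1
  · ext y
    constructor
    · intro hy
      rcases Finset.mem_union.1 hy with hy | hy
      · obtain ⟨hye, hy⟩ := Finset.mem_erase.1 hy
        obtain ⟨x, hx⟩ := (res σ hA).surjective ⟨y, hy⟩
        have hxe : (x : ℕ) ≠ e := by
          rintro hxe
          apply hye
          have : x = ⟨e, heA⟩ := Subtype.ext hxe
          rw [this] at hx
          rw [← he]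
          exact (congrArg Subtype.val hx).symm
        have hxA : (x : ℕ) ∈ A₁ := by
          rw [← hA₁.2.2]; exact Finset.mem_union_left _ (Finset.mem_erase.2 ⟨hxe, x.2⟩)
        have := hg1.1 x x.2 hxA hxe
        have h2 : (res ρ hA₁G ⟨x, hxA⟩ : ℕ) = y := this.trans (congrArg Subtype.val hx)
        rw [← h2]; exact (res ρ hA₁G _).2
      · obtain ⟨x, hx⟩ := τ.surjective ⟨y, hy⟩
        have hxA : (x : ℕ) ∈ A₁ := by
          rw [← hA₁.2.2]; exact Finset.mem_union_right _ x.2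
        have h2 : (res ρ hA₁G ⟨x, hxA⟩ : ℕ) = y :=
          (hg1.2 x x.2 hxA).trans (congrArg Subtype.val hx)
        rw [← h2]; exact (res ρ hA₁G _).2
    · intro hy
      obtain ⟨x, hx⟩ := (res ρ hA₁G).surjective ⟨y, hy⟩
      have hx' : (x : ℕ) ∈ A.erase e ∪ F := by rw [hA₁.2.2]; exact x.2
      have hxy : (res ρ hA₁G x : ℕ) = y := congrArg Subtype.val hx
      rcases Finset.mem_union.1 hx' with hx' | hx'
      · obtain ⟨hxe, hxA⟩ := Finset.mem_erase.1 hx'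
        have h3 := hg1.1 x hxA x.2 hxe
        rw [Subtype.coe_eta, hxy] at h3
        refine Finset.mem_union_left _ (Finset.mem_erase.2 ⟨?_, h3 ▸ (res σ hA _).2⟩)
        rintro rfl
        have h4 : σ ⟨x, hA hxA⟩ = σ ⟨e, h.1⟩ := Subtype.ext (h3.symm.trans he.symm)
        exact hxe (congrArg Subtype.val (σ.injective h4))
      · have h3 := hg1.2 x hx' x.2
        rw [Subtype.coe_eta, hxy] at h3
        exact Finset.mem_union_right _ (h3 ▸ (τ _).2)

/-- On the part which `∘_e` does not touch, `ρ` restricts to the same bijection as `σ`. -/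
lemma Glues.other {E E' F F' G G' B : Finset ℕ} {e : ℕ}
    {σ : E ≃ E'} {τ : F ≃ F'} {ρ : G ≃ G'}
    (hg : Glues e σ τ ρ) (hB : B ⊆ E) (heB : e ∉ B) :
    Extends (res σ hB) ρ :=
  fun x hx hx' => hg.1 x (hB hx) hx' (fun h => heB (h ▸ hx))

lemma tensor_equivariant {E F G E' F' G' : Finset ℕ} {e e' : ℕ} (h : Subst E e F G)
    (h' : Subst E' e' F' G') (σ : E ≃ E') (τ : F ≃ F') (ρ : G ≃ G')
    (he : (σ ⟨e, h.1⟩ : ℕ) = e') (hg : Glues e σ τ ρ)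
    {i j n : ℤ} (hn : i + j = n) (m : El (tensorS M.S N.S) E i) (p : El P.S F j) :
    rl (tensorS M.S N.S) ρ n ((tensorA M.α N.α).act h hn m p) =
      (tensorA M.α N.α).act h' hn (rl (tensorS M.S N.S) σ i m) (rl P.S τ j p) := by
  induction m using tind with
  | h0 => simp
  | hadd x y hx hy => simp only [LinearMap.add_apply, map_add, hx, hy]
  | @hpt A B hs a b hab x y =>
  rcases hs.mem h.1 with heA | heB
  · obtain ⟨hA, hs'⟩ := h.split_left hs heA
    obtain ⟨h1, h2, h3⟩ := Glues.restrict h h' he hg hs.left heA hA hs'.left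
    have h4 := hg.other hs.right (hs.not_mem heA)
    have h5 : Split (im ρ (A.erase e ∪ F)) (im σ B) G' := by
      rw [eq_im h4 hs'.right]; exact split_im ρ hs'
    rw [tensorA_left _ _ h hs hA hs' hab hn rfl (by omega), map_zsmul,
      rl_tmul σ hs (split_im σ hs) (res σ hs.left) (res σ hs.right) (res_extends _ _)
        (res_extends _ _),
      rl_tmul ρ hs' h5 (res ρ hs'.left) (res σ hs.right) (res_extends _ _) h4,
      tensorA_left _ _ h' (split_im σ hs) h1 h5 hab hn rfl (by omega),
      M.isRightAction.equivariant hA h1 (res σ hs.left) τ (res ρ hs'.left) h2 h3]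
  · obtain ⟨hB, hs'⟩ := h.split_right hs heB
    obtain ⟨h1, h2, h3⟩ := Glues.restrict h h' he hg hs.right heB hB hs'.right
    have h4 := hg.other hs.left (fun hh => hs.not_mem hh heB)
    have h5 : Split (im σ A) (im ρ (B.erase e ∪ F)) G' := by
      rw [eq_im h4 hs'.left]; exact split_im ρ hs'
    rw [tensorA_right _ _ h hs hB hs' hab hn rfl (by omega),
      rl_tmul σ hs (split_im σ hs) (res σ hs.left) (res σ hs.right) (res_extends _ _)
        (res_extends _ _),
      rl_tmul ρ hs' h5 (res σ hs.left) (res ρ hs'.right) h4 (res_extends _ _),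
      tensorA_right _ _ h' (split_im σ hs) h1 h5 hab hn rfl (by omega),
      N.isRightAction.equivariant hB h1 (res σ hs.right) τ (res ρ hs'.right) h2 h3]

lemma Subst.assoc {E F G H F' L A A' : Finset ℕ} {e f : ℕ} (_ : Subst E e F H) (hf : f ∈ F)
    (_ : Subst H f G L) (h₃ : Subst F f G F') (h₄ : Subst E e F' L) (hA : A ⊆ E)
    (h₅ : Subst A e F A') : ∃ A'', Subst A' f G A'' ∧ Subst A e F' A'' := by
  refine ⟨A.erase e ∪ F', ?_⟩
  obtain ⟨a1, a2, rfl⟩ := h₃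
  obtain ⟨b1, b2, rfl⟩ := h₄
  obtain ⟨c1, c2, rfl⟩ := h₅
  simp only [Finset.disjoint_left, Finset.mem_erase, Finset.mem_union] at *
  refine ⟨⟨?_, ?_, ?_⟩, c1, ?_, rfl⟩
  · simp [hf]
  · simp only [Finset.disjoint_left, Finset.mem_erase, Finset.mem_union]; grind
  · ext x; simp only [Finset.mem_erase, Finset.mem_union]; grind
  · simp only [Finset.disjoint_left, Finset.mem_erase, Finset.mem_union]; grind

lemma Split.subst {A B E F G A' : Finset ℕ} {e : ℕ} (hs : Split A B E) (h : Subst E e F G)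
    (hA : Subst A e F A') : Split A' B G := by
  obtain rfl := hA.2.2
  exact (h.split_left hs hA.1).2

lemma Split.subst' {A B E F G B' : Finset ℕ} {e : ℕ} (hs : Split A B E) (h : Subst E e F G)
    (hB : Subst B e F B') : Split A B' G := by
  obtain rfl := hB.2.2
  exact (h.split_right hs hB.1).2

lemma tensor_assoc_seq {E F H G F' L : Finset ℕ} {e f : ℕ} (h₁ : Subst E e F H) (hf : f ∈ F)
    (h₂ : Subst H f G L) (h₃ : Subst F f G F') (h₄ : Subst E e F' L)
    {i j l s t n : ℤ} (hs : i + j = s) (hn : s + l = n) (ht : j + l = t) (hn' : i + t = n)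
    (m : El (tensorS M.S N.S) E i) (p : El P.S F j) (q : El P.S G l) :
    (tensorA M.α N.α).act h₂ hn ((tensorA M.α N.α).act h₁ hs m p) q =
      (tensorA M.α N.α).act h₄ hn' m (P.comp.act h₃ ht p q) := by
  induction m using tind with
  | h0 => simp
  | hadd x y hx hy => simp only [LinearMap.add_apply, map_add, hx, hy]
  | @hpt A B hsp a b hab x y =>
  rcases hsp.mem h₁.1 with heA | heB
  · obtain ⟨hA, hs'⟩ := h₁.split_left hsp heA
    obtain ⟨A'', h5, h6⟩ := Subst.assoc h₁ hf h₂ h₃ h₄ hsp.left hA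
    rw [tensorA_left _ _ h₁ hsp hA hs' hab hs rfl (by omega), map_zsmul, LinearMap.smul_apply,
      tensorA_left _ _ h₂ hs' h5 (hs'.subst h₂ h5) _ hn rfl (by omega),
      tensorA_left _ _ h₄ hsp h6 (hs'.subst h₂ h5) hab hn' (a' := a + j + l) (by omega) (by omega),
      M.isRightAction.assoc_seq hA hf h5 h₃ h6 rfl rfl ht (by omega), smul_smul, ← sg_add]
    congr 2
    subst ht; ring
  · obtain ⟨hB, hs'⟩ := h₁.split_right hsp heB
    obtain ⟨B'', h5, h6⟩ := Subst.assoc h₁ hf h₂ h₃ h₄ hsp.right hB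
    rw [tensorA_right _ _ h₁ hsp hB hs' hab hs rfl (by omega),
      tensorA_right _ _ h₂ hs' h5 (hs'.subst' h₂ h5) _ hn rfl (by omega),
      tensorA_right _ _ h₄ hsp h6 (hs'.subst' h₂ h5) hab hn' (b' := b + j + l) (by omega)
        (by omega),
      N.isRightAction.assoc_seq hB hf h5 h₃ h6 rfl rfl ht (by omega)]

lemma Subst.par {E F G H H' L A A₁ : Finset ℕ} {e f : ℕ} (hef : e ≠ f)
    (h₁ : Subst E e F H) (h₂ : Subst H f G L) (h₃ : Subst E f G H') (h₄ : Subst H' e F L)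
    (hA : A ⊆ E) (hf : f ∈ A) (h₅ : Subst A e F A₁) :
    ∃ A₂ A₃, Subst A₁ f G A₃ ∧ Subst A f G A₂ ∧ Subst A₂ e F A₃ := by
  refine ⟨A.erase f ∪ G, (A.erase f ∪ G).erase e ∪ F, ?_⟩
  obtain ⟨a1, a2, rfl⟩ := h₁
  obtain ⟨b1, b2, rfl⟩ := h₂
  obtain ⟨c1, c2, rfl⟩ := h₃
  obtain ⟨d1, d2, d3⟩ := h₄
  obtain ⟨e1, e2, rfl⟩ := h₅
  simp only [Finset.disjoint_left, Finset.mem_erase, Finset.mem_union] at a2 b2 c2 d2 e2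
  refine ⟨⟨?_, ?_, ?_⟩, ⟨?_, ?_, ?_⟩, ⟨?_, ?_, ?_⟩⟩
  all_goals
    try simp only [Finset.disjoint_left, Finset.ext_iff, Finset.mem_erase, Finset.mem_union]
    try grind

lemma tensor_assoc_par {E F G H H' L : Finset ℕ} {e f : ℕ} (hef : e ≠ f) (_ : e ∈ E)
    (hfE : f ∈ E) (h₁ : Subst E e F H) (h₂ : Subst H f G L) (h₃ : Subst E f G H')
    (h₄ : Subst H' e F L)
    {i j l s t n : ℤ} (hs : i + j = s) (hn : s + l = n) (ht : i + l = t) (hn' : t + j = n)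
    (m : El (tensorS M.S N.S) E i) (p : El P.S F j) (q : El P.S G l) :
    (tensorA M.α N.α).act h₂ hn ((tensorA M.α N.α).act h₁ hs m p) q =
      sg (j * l) • (tensorA M.α N.α).act h₄ hn' ((tensorA M.α N.α).act h₃ ht m q) p := by
  induction m using tind with
  | h0 => simp
  | hadd x y hx hy => simp only [LinearMap.add_apply, map_add, hx, hy, smul_add]
  | @hpt A B hsp a b hab x y =>
  rcases hsp.mem h₁.1 with heA | heB
  · obtain ⟨hA, hs'⟩ := h₁.split_left hsp heA
    rcases hsp.mem hfE with hfA | hfB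
    · obtain ⟨A₂, A₃, h5, h6, h7⟩ := Subst.par hef h₁ h₂ h₃ h₄ hsp.left hfA hA
      rw [tensorA_left _ _ h₁ hsp hA hs' hab hs rfl (by omega), map_zsmul, LinearMap.smul_apply,
        tensorA_left _ _ h₂ hs' h5 (hs'.subst h₂ h5) _ hn rfl (by omega),
        tensorA_left _ _ h₃ hsp h6 (hsp.subst h₃ h6) hab ht rfl (by omega), map_zsmul,
        LinearMap.smul_apply,
        tensorA_left _ _ h₄ (hsp.subst h₃ h6) h7 (hs'.subst h₂ h5) _ hn' (a' := a + j + l)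
          (by omega) (by omega),
        M.isRightAction.assoc_par hef heA hfA hA h5 h6 h7 rfl rfl rfl (by omega), map_zsmul,
        LinearMap.smul_apply]
      simp only [smul_smul, ← sg_add]
      congr 2
      ring
    · obtain ⟨hB, hs''⟩ := h₃.split_right hsp hfB
      rw [tensorA_left _ _ h₁ hsp hA hs' hab hs rfl (by omega), map_zsmul, LinearMap.smul_apply,
        tensorA_right _ _ h₂ hs' hB (hs'.subst' h₂ hB) _ hn rfl (by omega),
        tensorA_right _ _ h₃ hsp hB hs'' hab ht rfl (by omega),
        tensorA_left _ _ h₄ hs'' hA (hs'.subst' h₂ hB) _ hn' rfl (by omega), smul_smul, ← sg_add]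
      congr 1
      apply sg_congr
      rw [show j * b - (j * l + j * (b + l)) = 2 * (-(j * l)) by ring]; simp
  · obtain ⟨hB, hs'⟩ := h₁.split_right hsp heB
    rcases hsp.mem hfE with hfA | hfB
    · obtain ⟨hA, hs''⟩ := h₃.split_left hsp hfA
      rw [tensorA_right _ _ h₁ hsp hB hs' hab hs rfl (by omega),
        tensorA_left _ _ h₂ hs' hA (hs'.subst h₂ hA) _ hn rfl (by omega),
        tensorA_left _ _ h₃ hsp hA hs'' hab ht rfl (by omega), map_zsmul, LinearMap.smul_apply,
        tensorA_right _ _ h₄ hs'' hB (hs'.subst h₂ hA) _ hn' rfl (by omega), smul_smul, ← sg_add]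
      congr 2
      ring
    · obtain ⟨A₂, A₃, h5, h6, h7⟩ := Subst.par hef h₁ h₂ h₃ h₄ hsp.right hfB hB
      rw [tensorA_right _ _ h₁ hsp hB hs' hab hs rfl (by omega),
        tensorA_right _ _ h₂ hs' h5 (hs'.subst' h₂ h5) _ hn rfl (by omega),
        tensorA_right _ _ h₃ hsp h6 (hsp.subst' h₃ h6) hab ht rfl (by omega),
        tensorA_right _ _ h₄ (hsp.subst' h₃ h6) h7 (hs'.subst' h₂ h5) _ hn' (b' := b + j + l)
          (by omega) (by omega),
        N.isRightAction.assoc_par hef heB hfB hB h5 h6 h7 rfl rfl rfl (by omega), map_zsmul]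

lemma Subst.unit_of_mem {A : Finset ℕ} {e : ℕ} (he : e ∈ A) : Subst A e {e} A := by
  refine ⟨he, by simp, ?_⟩
  ext x; simp only [Finset.mem_union, Finset.mem_erase, Finset.mem_singleton]; grind

lemma tensor_act_one {E : Finset ℕ} {e : ℕ} (h : Subst E e {e} E) {i : ℤ} (hi : i + 0 = i)
    (m : El (tensorS M.S N.S) E i) : (tensorA M.α N.α).act h hi m (P.one e) = m := by
  induction m using tind with
  | h0 => simp
  | hadd x y hx hy => simp only [LinearMap.add_apply, map_add, hx, hy]
  | @hpt A B hsp a b hab x y =>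
  rcases hsp.mem h.1 with heA | heB
  · rw [tensorA_left _ _ h hsp (Subst.unit_of_mem heA) hsp hab hi (add_zero a) hab,
      M.isRightAction.act_one]
    simp [sg]
  · rw [tensorA_right _ _ h hsp (Subst.unit_of_mem heB) hsp hab hi (add_zero b) hab,
      N.isRightAction.act_one]

/-- The tensor product of right `P`-modules. -/
def RMod.tensor : RMod P where
  S := tensorS M.S N.S
  α := tensorA M.α N.α
  isRightAction :=
    { leibniz := fun h _ _ _ _ _ _ hi hj hn' hn m p =>
        tensor_leibniz M N h hi hj hn' hn (by omega) (by omega) m p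
      equivariant := fun h h' σ τ ρ he hg _ _ _ hn m p =>
        tensor_equivariant M N h h' σ τ ρ he hg hn m p
      assoc_seq := fun h₁ hf h₂ h₃ h₄ _ _ _ _ _ _ hs hn ht hn' m p q =>
        tensor_assoc_seq M N h₁ hf h₂ h₃ h₄ hs hn ht hn' m p q
      assoc_par := fun hef he hf h₁ h₂ h₃ h₄ _ _ _ _ _ _ hs hn ht hn' m p q =>
        tensor_assoc_par M N hef he hf h₁ h₂ h₃ h₄ hs hn ht hn' m p q
      act_one := fun h _ hi m => tensor_act_one M N h hi m }

end tensorIs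

section tp

variable {P : Operad k}

/-- The homogeneous pure tensor `x ⊗ y` in `(M ⊗ N)(E)_n`, for right `P`-modules `M` and `N`. -/
def RMod.tp (M N : RMod P) {A B E : Finset ℕ} (h : Split A B E) {i j n : ℤ} (hn : i + j = n) :
    El M.S A i →ₗ[k] El N.S B j →ₗ[k] El (M.tensor N).S E n :=
  tmul h hn

/-- Linear maps out of `(M ⊗ N)(E)_n` from families of bilinear maps. -/
def RMod.tpLift (M N : RMod P) {E : Finset ℕ} {n : ℤ} {Z : Type u} [AddCommGroup Z] [Module k Z]
    (b : ∀ (A B : Finset ℕ) (i j : ℤ), Split A B E → i + j = n →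
      (El M.S A i →ₗ[k] El N.S B j →ₗ[k] Z)) : El (M.tensor N).S E n →ₗ[k] Z :=
  tlift b

variable {M N : RMod P}

lemma tpLift_tp {E : Finset ℕ} {n : ℤ} {Z : Type u} [AddCommGroup Z] [Module k Z]
    (b : ∀ (A B : Finset ℕ) (i j : ℤ), Split A B E → i + j = n →
      (El M.S A i →ₗ[k] El N.S B j →ₗ[k] Z)) {A B : Finset ℕ} (h : Split A B E) {i j : ℤ}
    (hn : i + j = n) (x : El M.S A i) (y : El N.S B j) :
    M.tpLift N b (M.tp N h hn x y) = b A B i j h hn x y :=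
  tlift_tmul b h hn x y

lemma tp_ind {E : Finset ℕ} {n : ℤ} {p : El (M.tensor N).S E n → Prop} (h0 : p 0)
    (hadd : ∀ x y, p x → p y → p (x + y))
    (hpt : ∀ {A B : Finset ℕ} (h : Split A B E) {i j : ℤ} (hn : i + j = n) (x : El M.S A i)
      (y : El N.S B j), p (M.tp N h hn x y)) (x : El (M.tensor N).S E n) : p x :=
  tind (M := M.S) (N := N.S) (p := p) h0 hadd hpt x

lemma dl_tp {A B E : Finset ℕ} (hs : Split A B E) {i i' j j' n n' : ℤ} (hn : i + j = n)
    (h : n' + 1 = n) (hi : i' + 1 = i) (hj : j' + 1 = j) (x : El M.S A i) (y : El N.S B j) :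
    dl (M.tensor N).S E n n' (M.tp N hs hn x y) =
      M.tp N hs (by omega) (dl M.S A i i' x) y +
        sg i • M.tp N hs (by omega) x (dl N.S B j j' y) :=
  dl_tmul hs hn h hi hj x y

lemma rl_tp {A B A' B' E E' : Finset ℕ} (σ : E ≃ E') (hs : Split A B E)
    (hs' : Split A' B' E') (σA : A ≃ A') (σB : B ≃ B') (hA : Extends σA σ) (hB : Extends σB σ)
    {i j n : ℤ} (hn : i + j = n) (x : El M.S A i) (y : El N.S B j) :
    rl (M.tensor N).S σ n (M.tp N hs hn x y) =
      M.tp N hs' hn (rl M.S σA i x) (rl N.S σB j y) :=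
  rl_tmul σ hs hs' σA σB hA hB hn x y

lemma act_tp_left {A B A' E F G : Finset ℕ} {e : ℕ} (h : Subst E e F G) (hs : Split A B E)
    (hA : Subst A e F A') (hs' : Split A' B G) {a b i j a' n : ℤ} (hi : a + b = i) (hn : i + j = n)
    (ha : a + j = a') (hn' : a' + b = n) (x : El M.S A a) (y : El N.S B b) (p : El P.S F j) :
    (M.tensor N).α.act h hn (M.tp N hs hi x y) p =
      sg (j * b) • M.tp N hs' hn' (M.α.act hA ha x p) y :=
  tensorA_left M.α N.α h hs hA hs' hi hn ha hn' x y p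

lemma act_tp_right {A B B' E F G : Finset ℕ} {e : ℕ} (h : Subst E e F G) (hs : Split A B E)
    (hB : Subst B e F B') (hs' : Split A B' G) {a b i j b' n : ℤ} (hi : a + b = i) (hn : i + j = n)
    (hb : b + j = b') (hn' : a + b' = n) (x : El M.S A a) (y : El N.S B b) (p : El P.S F j) :
    (M.tensor N).α.act h hn (M.tp N hs hi x y) p = M.tp N hs' hn' x (N.α.act hB hb y p) :=
  tensorA_right M.α N.α h hs hB hs' hi hn hb hn' x y p

end tp

section tensorMap

variable {P : Operad k}

/-- `f ⊗ g` on `Σ_*`-modules. -/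
def tensorMapS {M M' N N' : SMod k} (f : M ⟶ M') (g : N ⟶ N') :
    tensorS M N ⟶ tensorS M' N' :=
  mkHom (fun _ _ => tlift fun A B i j hs hn => (tmul hs hn).compl₁₂ (hl f A i) (hl g B j))
    (fun E n n' x h => by
      induction x using tind with
      | h0 => simp
      | hadd x y hx hy => simp only [map_add, hx, hy]
      | @hpt A B hs i j hn x y =>
        rw [dl_tmul hs hn h (i' := i - 1) (j' := j - 1) (by omega) (by omega), map_add, map_zsmul,
          tlift_tmul, tlift_tmul, tlift_tmul]
        simp only [LinearMap.compl₁₂_apply]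
        rw [dl_tmul hs hn h (i' := i - 1) (j' := j - 1) (by omega) (by omega), hl_dl, hl_dl])
    (fun {E E'} σ n x => by
      induction x using tind with
      | h0 => simp
      | hadd x y hx hy => simp only [map_add, hx, hy]
      | @hpt A B hs i j hn x y =>
        rw [rl_tmul σ hs (split_im σ hs) (res σ hs.left) (res σ hs.right) (res_extends _ _)
          (res_extends _ _), tlift_tmul, tlift_tmul]
        simp only [LinearMap.compl₁₂_apply]
        rw [rl_tmul σ hs (split_im σ hs) (res σ hs.left) (res σ hs.right) (res_extends _ _)
          (res_extends _ _), hl_rl, hl_rl])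

lemma tensorMapS_tmul {M M' N N' : SMod k} (f : M ⟶ M') (g : N ⟶ N') {A B E : Finset ℕ}
    (hs : Split A B E) {i j n : ℤ} (hn : i + j = n) (x : El M A i) (y : El N B j) :
    hl (tensorMapS f g) E n (tmul hs hn x y) = tmul hs hn (hl f A i x) (hl g B j y) := by
  change tlift (fun A B i j hs hn => (tmul hs hn).compl₁₂ (hl f A i) (hl g B j))
    (tmul hs hn x y) = _
  rw [tlift_tmul]
  rfl

/-- `f ⊗ g` on right `P`-modules. -/
def RMod.tensorMap {M M' N N' : RMod P} (f : M ⟶ M') (g : N ⟶ N') :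
    M.tensor N ⟶ M'.tensor N' where
  hom := tensorMapS f.hom g.hom
  map_act {E F G e} h {i j n} hn m p := by
    change hl (tensorMapS f.hom g.hom) G n ((tensorA M.α N.α).act h hn m p) =
      (tensorA M'.α N'.α).act h hn (hl (tensorMapS f.hom g.hom) E i m) p
    induction m using tind with
    | h0 => simp
    | hadd x y hx hy => simp only [map_add, LinearMap.add_apply, hx, hy]
    | @hpt A B hs a b hi x y =>
      rcases hs.mem h.1 with he | he
      · obtain ⟨hA, hs'⟩ := h.split_left hs he
        rw [tensorA_left _ _ h hs hA hs' hi hn rfl (by omega), map_zsmul, tensorMapS_tmul,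
          tensorMapS_tmul, tensorA_left _ _ h hs hA hs' hi hn rfl (by omega), f.map_act]
      · obtain ⟨hB, hs'⟩ := h.split_right hs he
        rw [tensorA_right _ _ h hs hB hs' hi hn rfl (by omega), tensorMapS_tmul,
          tensorMapS_tmul, tensorA_right _ _ h hs hB hs' hi hn rfl (by omega), g.map_act]

lemma RMod.tensorMap_tp {M M' N N' : RMod P} (f : M ⟶ M') (g : N ⟶ N') {A B E : Finset ℕ}
    (hs : Split A B E) {i j n : ℤ} (hn : i + j = n) (x : El M.S A i) (y : El N.S B j) :
    hl (RMod.tensorMap f g).hom E n (M.tp N hs hn x y) =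
      M'.tp N' hs hn (hl f.hom A i x) (hl g.hom B j y) :=
  tensorMapS_tmul f.hom g.hom hs hn x y

lemma RMod.tensor_hom_ext {M N L : RMod P} {f g : M.tensor N ⟶ L}
    (h : ∀ {A B E : Finset ℕ} (hs : Split A B E) {i j n : ℤ} (hn : i + j = n) (x : El M.S A i)
      (y : El N.S B j), hl f.hom E n (M.tp N hs hn x y) = hl g.hom E n (M.tp N hs hn x y)) :
    f = g := by
  apply RMod.hom_ext
  apply DGOperad.hom_ext
  intro E n x
  induction x using tp_ind with
  | h0 => simp
  | hadd x y hx hy => simp only [map_add, hx, hy]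
  | hpt hs hn x y => exact h hs hn x y

end tensorMap

/-! ### Algebras in right modules and their left modules -/

lemma split_empty_left (E : Finset ℕ) : Split ∅ E E := ⟨by simp, by simp⟩
lemma split_empty_right (E : Finset ℕ) : Split E ∅ E := ⟨by simp, by simp⟩

/-- Associative unital algebras in right `P`-modules. The unit, a morphism from the unit of the
tensor product (`k` in arity `∅`), is given by a cycle of arity `∅` and degree `0`. -/
structure RAlg (P : Operad k) where
  /-- the underlying right `P`-module -/
  U : RMod P
  /-- the multiplication -/
  mul : U.tensor U ⟶ U
  /-- the unit -/
  one : El U.S ∅ 0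
  d_one : ∀ n : ℤ, dl U.S ∅ 0 n one = 0
  one_mul : ∀ {A : Finset ℕ} {i : ℤ} (x : El U.S A i),
    hl mul.hom A i (U.tp U (split_empty_left A) (zero_add i) one x) = x
  mul_one : ∀ {A : Finset ℕ} {i : ℤ} (x : El U.S A i),
    hl mul.hom A i (U.tp U (split_empty_right A) (add_zero i) x one) = x
  mul_assoc : ∀ {A B C AB BC E : Finset ℕ} (h₁ : Split A B AB) (h₂ : Split AB C E)
    (h₃ : Split B C BC) (h₄ : Split A BC E) {a b c ab bc n : ℤ} (e₁ : a + b = ab)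
    (e₂ : ab + c = n) (e₃ : b + c = bc) (e₄ : a + bc = n)
    (x : El U.S A a) (y : El U.S B b) (z : El U.S C c),
    hl mul.hom E n (U.tp U h₂ e₂ (hl mul.hom AB ab (U.tp U h₁ e₁ x y)) z) =
      hl mul.hom E n (U.tp U h₄ e₄ x (hl mul.hom BC bc (U.tp U h₃ e₃ y z)))

/-- Left `U`-modules in right `P`-modules: right `P`-modules `M` with an associative and unital
left action `U ⊗ M ⟶ M` which is a morphism of right `P`-modules. -/
structure LMod {P : Operad k} (U : RAlg P) where
  /-- the underlying right `P`-module -/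
  M : RMod P
  /-- the left action -/
  act : U.U.tensor M ⟶ M
  one_act : ∀ {A : Finset ℕ} {i : ℤ} (x : El M.S A i),
    hl act.hom A i (U.U.tp M (split_empty_left A) (zero_add i) U.one x) = x
  mul_act : ∀ {A B C AB BC E : Finset ℕ} (h₁ : Split A B AB) (h₂ : Split AB C E)
    (h₃ : Split B C BC) (h₄ : Split A BC E) {a b c ab bc n : ℤ} (e₁ : a + b = ab)
    (e₂ : ab + c = n) (e₃ : b + c = bc) (e₄ : a + bc = n)
    (x : El U.U.S A a) (y : El U.U.S B b) (z : El M.S C c),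
    hl act.hom E n (U.U.tp M h₂ e₂ (hl U.mul.hom AB ab (U.U.tp U.U h₁ e₁ x y)) z) =
      hl act.hom E n (U.U.tp M h₄ e₄ x (hl act.hom BC bc (U.U.tp M h₃ e₃ y z)))

/-- Morphisms of right `P`-modules which preserve the `U`-action. -/
@[ext]
structure LMod.Hom {P : Operad k} {U : RAlg P} (M N : LMod U) where
  /-- the underlying morphism of right `P`-modules -/
  hom : M.M ⟶ N.M
  comm : M.act ≫ hom = RMod.tensorMap (𝟙 U.U) hom ≫ N.act

section LModCat

variable {P : Operad k} {U : RAlg P}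

instance : Category (LMod U) where
  Hom := LMod.Hom
  id M := ⟨𝟙 M.M, by
    apply RMod.tensor_hom_ext
    intro A B E hs i j n hn x y
    rw [RMod.hl_comp, RMod.hl_comp, RMod.tensorMap_tp]
    rfl⟩
  comp {M N L} f g := ⟨f.hom ≫ g.hom, by
    rw [← Category.assoc, f.comm, Category.assoc, g.comm, ← Category.assoc]
    apply RMod.tensor_hom_ext
    intro A B E hs i j n hn x y
    simp only [RMod.hl_comp, RMod.tensorMap_tp]
    rfl⟩

@[ext]
lemma LMod.hom_ext {M N : LMod U} {f g : M ⟶ N} (h : f.hom = g.hom) : f = g := LMod.Hom.ext h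

variable (U) in
/-- The functor which forgets the left `U`-action. -/
def forgetL : LMod U ⥤ RMod P where
  obj M := M.M
  map f := f.hom

end LModCat

/-! ### The left `U`-module `U ⊗ N` for a right `P`-module `N` -/

section freeLeft

variable {P : Operad k} (U : RAlg P)

/-- The product `x · y` of homogeneous elements of `U`. -/
def RAlg.m {A B AB : Finset ℕ} (h : Split A B AB) {i j n : ℤ} (hn : i + j = n) :
    El U.U.S A i →ₗ[k] El U.U.S B j →ₗ[k] El U.U.S AB n :=
  (U.U.tp U.U h hn).compr₂ (hl U.mul.hom AB n)

lemma RAlg.m_apply {A B AB : Finset ℕ} (h : Split A B AB) {i j n : ℤ} (hn : i + j = n)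
    (x : El U.U.S A i) (y : El U.U.S B j) : U.m h hn x y = hl U.mul.hom AB n (U.U.tp U.U h hn x y) := rfl

lemma RAlg.dl_m {A B AB : Finset ℕ} (h : Split A B AB) {i i' j j' n n' : ℤ} (hn : i + j = n)
    (hn' : n' + 1 = n) (hi : i' + 1 = i) (hj : j' + 1 = j)
    (x : El U.U.S A i) (y : El U.U.S B j) :
    dl U.U.S AB n n' (U.m h hn x y) = U.m h (by omega) (dl U.U.S A i i' x) y +
      sg i • U.m h (by omega) x (dl U.U.S B j j' y) := by
  rw [m_apply, ← hl_dl]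
  rw [dl_tp h hn hn' hi hj, map_add, map_zsmul]
  rfl

lemma RAlg.rl_m {A B A' B' E E' : Finset ℕ} (σ : E ≃ E') (hs : Split A B E)
    (hs' : Split A' B' E') (σA : A ≃ A') (σB : B ≃ B') (hA : Extends σA σ) (hB : Extends σB σ)
    {i j n : ℤ} (hn : i + j = n) (x : El U.U.S A i) (y : El U.U.S B j) :
    rl U.U.S σ n (U.m hs hn x y) = U.m hs' hn (rl U.U.S σA i x) (rl U.U.S σB j y) := by
  rw [m_apply, ← hl_rl]
  rw [rl_tp σ hs hs' σA σB hA hB]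
  rfl

lemma RAlg.act_m_left {A B A' E F G : Finset ℕ} {e : ℕ} (h : Subst E e F G) (hs : Split A B E)
    (hA : Subst A e F A') (hs' : Split A' B G) {a b i j a' n : ℤ} (hi : a + b = i) (hn : i + j = n)
    (ha : a + j = a') (hn' : a' + b = n) (x : El U.U.S A a) (y : El U.U.S B b) (p : El P.S F j) :
    U.U.α.act h hn (U.m hs hi x y) p = sg (j * b) • U.m hs' hn' (U.U.α.act hA ha x p) y := by
  rw [m_apply, ← U.mul.map_act]
  rw [act_tp_left h hs hA hs' hi hn ha hn', map_zsmul]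
  rfl

lemma RAlg.act_m_right {A B B' E F G : Finset ℕ} {e : ℕ} (h : Subst E e F G) (hs : Split A B E)
    (hB : Subst B e F B') (hs' : Split A B' G) {a b i j b' n : ℤ} (hi : a + b = i) (hn : i + j = n)
    (hb : b + j = b') (hn' : a + b' = n) (x : El U.U.S A a) (y : El U.U.S B b) (p : El P.S F j) :
    U.U.α.act h hn (U.m hs hi x y) p = U.m hs' hn' x (U.U.α.act hB hb y p) := by
  rw [m_apply, ← U.mul.map_act]
  rw [act_tp_right h hs hB hs' hi hn hb hn']
  rfl

lemma Split.assoc {A B C BC E : Finset ℕ} (h₃ : Split B C BC) (h₄ : Split A BC E) :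
    Split A B (A ∪ B) ∧ Split (A ∪ B) C E := by
  obtain ⟨a1, rfl⟩ := h₃
  obtain ⟨b1, rfl⟩ := h₄
  rw [Finset.disjoint_union_right] at b1
  exact ⟨⟨b1.1, rfl⟩, ⟨Finset.disjoint_union_left.2 ⟨b1.2, a1⟩, Finset.union_assoc _ _ _⟩⟩

variable (N : RMod P)

/-- The map `x ⊗ (y ⊗ z) ↦ (x · y) ⊗ z`. -/
def freeActL (E : Finset ℕ) (n : ℤ) :
    El (U.U.tensor (U.U.tensor N)).S E n →ₗ[k] El (U.U.tensor N).S E n :=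
  U.U.tpLift (U.U.tensor N) fun A _ a _ h₄ e₄ => LinearMap.flip <|
    U.U.tpLift N fun B _ b _ h₃ e₃ =>
      mk₃ (fun y z x => U.U.tp N (Split.assoc h₃ h₄).2 (i := a + b) (by omega)
          (U.m (Split.assoc h₃ h₄).1 rfl x y) z)
        (by simp) (by simp) (by simp) (by simp) (by simp) (by simp)

lemma freeActL_tmul {A B C AB BC E : Finset ℕ} (h₁ : Split A B AB) (h₂ : Split AB C E)
    (h₃ : Split B C BC) (h₄ : Split A BC E) {a b c ab bc n : ℤ} (e₁ : a + b = ab)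
    (e₂ : ab + c = n) (e₃ : b + c = bc) (e₄ : a + bc = n)
    (x : El U.U.S A a) (y : El U.U.S B b) (z : El N.S C c) :
    freeActL U N E n (U.U.tp (U.U.tensor N) h₄ e₄ x (U.U.tp N h₃ e₃ y z)) =
      U.U.tp N h₂ e₂ (U.m h₁ e₁ x y) z := by
  obtain rfl := h₁.2
  subst e₁
  rw [freeActL, tpLift_tp, LinearMap.flip_apply, tpLift_tp]
  rfl

lemma freeActL_dl (E : Finset ℕ) (n n' : ℤ) (h : n' + 1 = n)
    (x : El (U.U.tensor (U.U.tensor N)).S E n) :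
    freeActL U N E n' (dl (U.U.tensor (U.U.tensor N)).S E n n' x) =
      dl (U.U.tensor N).S E n n' (freeActL U N E n x) := by
  induction x using tp_ind with
  | h0 => simp only [map_zero]
  | hadd x y hx hy => simp only [map_add, hx, hy]
  | @hpt A BC h₄ a bc e₄ x w =>
  induction w using tp_ind with
  | h0 => simp only [map_zero]
  | hadd x y hx hy => simp only [map_add, hx, hy]
  | @hpt B C h₃ b c e₃ y z =>
  obtain ⟨h₁, h₂⟩ := Split.assoc h₃ h₄
  rw [dl_tp h₄ e₄ h (i' := a - 1) (j' := bc - 1) (by omega) (by omega),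
    dl_tp h₃ e₃ (n' := bc - 1) (by omega) (i' := b - 1) (j' := c - 1) (by omega) (by omega),
    map_add, map_add, map_zsmul, map_zsmul, map_add, map_zsmul,
    freeActL_tmul U N h₁ h₂ h₃ h₄ (ab := a - 1 + b) rfl (by omega) _ _,
    freeActL_tmul U N h₁ h₂ h₃ h₄ (ab := a - 1 + b) (by omega) (by omega) _ _,
    freeActL_tmul U N h₁ h₂ h₃ h₄ (ab := a + b) rfl (by omega) _ _,
    freeActL_tmul U N h₁ h₂ h₃ h₄ (ab := a + b) rfl (by omega) _ _,
    dl_tp h₂ _ h (i' := a - 1 + b) (j' := c - 1) (by omega) (by omega),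
    U.dl_m h₁ _ (by omega) (i' := a - 1) (j' := b - 1) (by omega) (by omega), sg_add]
  simp only [map_add, LinearMap.add_apply, map_zsmul, LinearMap.smul_apply, smul_add, smul_smul]
  abel

lemma freeActL_rl {E E' : Finset ℕ} (σ : E ≃ E') (n : ℤ)
    (x : El (U.U.tensor (U.U.tensor N)).S E n) :
    freeActL U N E' n (rl (U.U.tensor (U.U.tensor N)).S σ n x) =
      rl (U.U.tensor N).S σ n (freeActL U N E n x) := by
  induction x using tp_ind with
  | h0 => simp only [map_zero]
  | hadd x y hx hy => simp only [map_add, hx, hy]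
  | @hpt A BC h₄ a bc e₄ x w =>
  induction w using tp_ind with
  | h0 => simp only [map_zero]
  | hadd x y hx hy => simp only [map_add, hx, hy]
  | @hpt B C h₃ b c e₃ y z =>
  obtain ⟨h₁, h₂⟩ := Split.assoc h₃ h₄
  have hB : B ⊆ E := h₃.left.trans h₄.right
  have hC : C ⊆ E := h₃.right.trans h₄.right
  have k4 := split_im σ h₄
  have k2 := split_im σ h₂
  have k3 : Split (im σ B) (im σ C) (im σ BC) := by
    have := split_im (res σ h₄.right) h₃
    rwa [← eq_im (σ := res σ h₄.right) (τ := res σ hB) (fun _ _ _ => rfl) h₃.left,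
      ← eq_im (σ := res σ h₄.right) (τ := res σ hC) (fun _ _ _ => rfl) h₃.right] at this
  have k1 : Split (im σ A) (im σ B) (im σ (A ∪ B)) := by
    have := split_im (res σ h₂.left) h₁
    rwa [← eq_im (σ := res σ h₂.left) (τ := res σ h₄.left) (fun _ _ _ => rfl) h₁.left,
      ← eq_im (σ := res σ h₂.left) (τ := res σ hB) (fun _ _ _ => rfl) h₁.right] at this
  rw [rl_tp σ h₄ k4 (res σ h₄.left) (res σ h₄.right) (fun _ _ _ => rfl) (fun _ _ _ => rfl),
    rl_tp (res σ h₄.right) h₃ k3 (res σ hB) (res σ hC) (fun _ _ _ => rfl) (fun _ _ _ => rfl),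
    freeActL_tmul U N k1 k2 k3 k4 rfl (by omega) _ _,
    freeActL_tmul U N h₁ h₂ h₃ h₄ rfl (by omega) _ _,
    rl_tp σ h₂ k2 (res σ h₂.left) (res σ hC) (fun _ _ _ => rfl) (fun _ _ _ => rfl),
    U.rl_m (res σ h₂.left) h₁ k1 (res σ h₄.left) (res σ hB) (fun _ _ _ => rfl)
      (fun _ _ _ => rfl)]

lemma freeActL_act {E F G : Finset ℕ} {e : ℕ} (h : Subst E e F G) {i j n : ℤ} (hn : i + j = n)
    (x : El (U.U.tensor (U.U.tensor N)).S E i) (p : El P.S F j) :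
    freeActL U N G n ((U.U.tensor (U.U.tensor N)).α.act h hn x p) =
      (U.U.tensor N).α.act h hn (freeActL U N E i x) p := by
  induction x using tp_ind with
  | h0 => simp only [map_zero, LinearMap.zero_apply]
  | hadd x y hx hy => simp only [map_add, LinearMap.add_apply, hx, hy]
  | @hpt A BC h₄ a bc e₄ x w =>
  induction w using tp_ind with
  | h0 => simp only [map_zero, LinearMap.zero_apply]
  | hadd x y hx hy => simp only [map_add, LinearMap.add_apply, hx, hy]
  | @hpt B C h₃ b c e₃ y z =>
  obtain ⟨h₁, h₂⟩ := Split.assoc h₃ h₄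
  rw [freeActL_tmul U N h₁ h₂ h₃ h₄ rfl (by omega) _ _]
  rcases h₄.mem h.1 with hA | hBC
  · obtain ⟨s4, k4⟩ := h.split_left h₄ hA
    obtain ⟨s2, k2⟩ := h.split_left h₂ (Finset.mem_union_left _ hA)
    have k1 := h₁.subst s2 s4
    rw [act_tp_left h h₄ s4 k4 e₄ hn rfl (by omega), map_zsmul,
      freeActL_tmul U N k1 k2 h₃ k4 rfl (by omega) _ _,
      act_tp_left h h₂ s2 k2 _ hn (a' := a + j + b) (by omega) (by omega),
      U.act_m_left s2 h₁ s4 k1 _ _ rfl rfl, map_zsmul, LinearMap.smul_apply, smul_smul, ← sg_add]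
    congr 2
    rw [← e₃]; ring
  · obtain ⟨s4, k4⟩ := h.split_right h₄ hBC
    rcases h₃.mem hBC with hB | hC
    · obtain ⟨s3, k3⟩ := s4.split_left h₃ hB
      obtain ⟨s2, k2⟩ := h.split_left h₂ (Finset.mem_union_right _ hB)
      have k1 := h₁.subst' s2 s3
      rw [act_tp_right h h₄ s4 k4 e₄ hn rfl (by omega),
        act_tp_left s4 h₃ s3 k3 e₃ rfl rfl (by omega), map_zsmul, map_zsmul,
        freeActL_tmul U N k1 k2 k3 k4 (ab := a + b + j) (by omega) (by omega) _ _,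
        act_tp_left h h₂ s2 k2 _ hn rfl (by omega),
        U.act_m_right s2 h₁ s3 k1 _ _ rfl (by omega)]
    · obtain ⟨s3, k3⟩ := s4.split_right h₃ hC
      have k2 := h₂.subst' h s3
      rw [act_tp_right h h₄ s4 k4 e₄ hn rfl (by omega),
        act_tp_right s4 h₃ s3 k3 e₃ rfl rfl (by omega),
        freeActL_tmul U N h₁ k2 k3 k4 rfl (by omega) _ _,
        act_tp_right h h₂ s3 k2 _ hn rfl (by omega)]

/-- The action `U ⊗ (U ⊗ N) ⟶ U ⊗ N` induced by the multiplication of `U`. -/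
def freeAct : U.U.tensor (U.U.tensor N) ⟶ U.U.tensor N where
  hom := mkHom (M := (U.U.tensor (U.U.tensor N)).S) (N := tensorS U.U.S N.S)
    (freeActL U N) (fun E n n' x h => freeActL_dl U N E n n' h x) (freeActL_rl U N)
  map_act h _ _ _ hn m p := freeActL_act U N h hn m p

lemma freeAct_tmul {A B C AB BC E : Finset ℕ} (h₁ : Split A B AB) (h₂ : Split AB C E)
    (h₃ : Split B C BC) (h₄ : Split A BC E) {a b c ab bc n : ℤ} (e₁ : a + b = ab)
    (e₂ : ab + c = n) (e₃ : b + c = bc) (e₄ : a + bc = n)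
    (x : El U.U.S A a) (y : El U.U.S B b) (z : El N.S C c) :
    hl (freeAct U N).hom E n
        (U.U.tp (U.U.tensor N) h₄ e₄ x (U.U.tp N h₃ e₃ y z)) =
      U.U.tp N h₂ e₂ (U.m h₁ e₁ x y) z :=
  freeActL_tmul U N h₁ h₂ h₃ h₄ e₁ e₂ e₃ e₄ x y z

/-- The left `U`-module `U ⊗ N` in right `P`-modules, with the action
`U ⊗ (U ⊗ N) ⟶ U ⊗ N` given by the multiplication of `U`. -/
def freeL : LMod U where
  M := U.U.tensor N
  act := freeAct U N
  one_act {A i} x := by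
    refine tp_ind (M := U.U) (N := N) (p := fun x => hl (freeAct U N).hom A i
      (U.U.tp (U.U.tensor N) (split_empty_left A) (zero_add i) U.one x) = x)
      (by simp only [map_zero]) (fun x y hx hy => by simp only [map_add, hx, hy]) ?_ x
    intro B C h₃ b c e₃ y z
    rw [freeAct_tmul U N (split_empty_left B) h₃ h₃ (split_empty_left A) (zero_add b) e₃ e₃ _,
      RAlg.m_apply, U.one_mul]
  mul_act {A B C AB BC E} h₁ h₂ h₃ h₄ {a b c ab bc n} e₁ e₂ e₃ e₄ x y z := by
    refine tp_ind (M := U.U) (N := N) (p := fun z => hl (freeAct U N).hom E n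
      (U.U.tp (U.U.tensor N) h₂ e₂ (U.m h₁ e₁ x y) z) =
      hl (freeAct U N).hom E n (U.U.tp (U.U.tensor N) h₄ e₄ x
        (hl (freeAct U N).hom BC bc (U.U.tp (U.U.tensor N) h₃ e₃ y z))))
      (by simp only [map_zero]) (fun x y hx hy => by simp only [map_add, hx, hy]) ?_ z
    intro C' D hC c' d hc z w
    obtain ⟨p1, p2⟩ := Split.assoc hC h₂
    obtain ⟨q1, q2⟩ := Split.assoc hC h₃
    obtain ⟨r1, r2⟩ := Split.assoc q2 h₄
    have hr : Split A (B ∪ C') (AB ∪ C') := by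
      have : AB ∪ C' = A ∪ (B ∪ C') := by rw [← h₁.2, Finset.union_assoc]
      rw [this]; exact r1
    rw [freeAct_tmul U N p1 p2 hC h₂ (ab := ab + c') rfl (by omega) hc _,
      freeAct_tmul U N q1 q2 hC h₃ (ab := b + c') rfl (by omega) hc _,
      freeAct_tmul U N hr p2 q2 h₄ (ab := ab + c') (by omega) (by omega) (by omega) _]
    congr 1
    exact congrArg _ (U.mul_assoc h₁ p1 q1 hr e₁ rfl rfl (by omega) x y z)

lemma freeAct_naturality {N N' : RMod P} (g : N ⟶ N') :
    freeAct U N ≫ RMod.tensorMap (𝟙 U.U) g =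
      RMod.tensorMap (𝟙 U.U) (RMod.tensorMap (𝟙 U.U) g) ≫ freeAct U N' := by
  apply RMod.tensor_hom_ext
  intro A BC E h₄ a bc n e₄ x w
  rw [RMod.hl_comp, RMod.hl_comp, RMod.tensorMap_tp]
  induction w using tp_ind with
  | h0 => simp only [map_zero]
  | hadd x y hx hy => simp only [map_add, hx, hy]
  | @hpt B C h₃ b c e₃ y z =>
  obtain ⟨h₁, h₂⟩ := Split.assoc h₃ h₄
  rw [freeAct_tmul U N h₁ h₂ h₃ h₄ rfl (by omega) e₃ _, RMod.tensorMap_tp,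
    RMod.tensorMap_tp, freeAct_tmul U N' h₁ h₂ h₃ h₄ rfl (by omega) e₃ _]
  rfl

/-- The morphism `U ⊗ g` of left `U`-modules. -/
def freeLMap {N N' : RMod P} (g : N ⟶ N') : freeL U N ⟶ freeL U N' where
  hom := RMod.tensorMap (𝟙 U.U) g
  comm := freeAct_naturality U g

end freeLeft

/-! ### The free right `P`-module on a `Σ_*`-module -/

section freeRight

variable (P : Operad k) (K : SMod k)

/-- Formal expressions in elements of `K` with respect to the operations of right `P`-modules in
dg modules. -/
inductive FPre : Finset ℕ → ℤ → Type u
  | of {E : Finset ℕ} {n : ℤ} (x : El K E n) : FPre E n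
  | zero {E : Finset ℕ} {n : ℤ} : FPre E n
  | add {E : Finset ℕ} {n : ℤ} (x y : FPre E n) : FPre E n
  | smul {E : Finset ℕ} {n : ℤ} (c : k) (x : FPre E n) : FPre E n
  | d {E : Finset ℕ} {n : ℤ} (n' : ℤ) (x : FPre E n) : FPre E n'
  | rl {E E' : Finset ℕ} {n : ℤ} (σ : E ≃ E') (x : FPre E n) : FPre E' n
  | act {E F G : Finset ℕ} {e : ℕ} (h : Subst E e F G) {i j n : ℤ} (hn : i + j = n)
      (x : FPre E i) (p : El P.S F j) : FPre G n

variable {P K}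

/-- The relations which hold in a right `P`-module under `K`: the congruence generated by the
axioms of dg modules, of `Σ_*`-modules and of right actions, and by the relations saying that
`K` maps to the quotient by a morphism of `Σ_*`-modules. -/
inductive FRel : ∀ {E : Finset ℕ} {n : ℤ}, FPre P K E n → FPre P K E n → Prop
  -- congruence
  | refl {E : Finset ℕ} {n : ℤ} (x : FPre P K E n) : FRel x x
  | symm {E : Finset ℕ} {n : ℤ} {x y : FPre P K E n} : FRel x y → FRel y x
  | trans {E : Finset ℕ} {n : ℤ} {x y z : FPre P K E n} : FRel x y → FRel y z → FRel x z
  | add_congr {E : Finset ℕ} {n : ℤ} {x x' y y' : FPre P K E n} : FRel x x' → FRel y y' →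
      FRel (.add x y) (.add x' y')
  | smul_congr {E : Finset ℕ} {n : ℤ} (c : k) {x x' : FPre P K E n} : FRel x x' →
      FRel (.smul c x) (.smul c x')
  | d_congr {E : Finset ℕ} {n : ℤ} (n' : ℤ) {x x' : FPre P K E n} : FRel x x' →
      FRel (.d n' x) (.d n' x')
  | rl_congr {E E' : Finset ℕ} {n : ℤ} (σ : E ≃ E') {x x' : FPre P K E n} : FRel x x' →
      FRel (.rl σ x) (.rl σ x')
  | act_congr {E F G : Finset ℕ} {e : ℕ} (h : Subst E e F G) {i j n : ℤ} (hn : i + j = n)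
      {x x' : FPre P K E i} (p : El P.S F j) : FRel x x' → FRel (.act h hn x p) (.act h hn x' p)
  -- modules
  | add_assoc {E : Finset ℕ} {n : ℤ} (x y z : FPre P K E n) :
      FRel (.add (.add x y) z) (.add x (.add y z))
  | add_comm {E : Finset ℕ} {n : ℤ} (x y : FPre P K E n) : FRel (.add x y) (.add y x)
  | zero_add {E : Finset ℕ} {n : ℤ} (x : FPre P K E n) : FRel (.add .zero x) x
  | one_smul {E : Finset ℕ} {n : ℤ} (x : FPre P K E n) : FRel (.smul 1 x) x
  | mul_smul {E : Finset ℕ} {n : ℤ} (a b : k) (x : FPre P K E n) :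
      FRel (.smul (a * b) x) (.smul a (.smul b x))
  | smul_zero {E : Finset ℕ} {n : ℤ} (a : k) :
      FRel (.smul a (.zero : FPre P K E n)) .zero
  | smul_add {E : Finset ℕ} {n : ℤ} (a : k) (x y : FPre P K E n) :
      FRel (.smul a (.add x y)) (.add (.smul a x) (.smul a y))
  | add_smul {E : Finset ℕ} {n : ℤ} (a b : k) (x : FPre P K E n) :
      FRel (.smul (a + b) x) (.add (.smul a x) (.smul b x))
  | zero_smul {E : Finset ℕ} {n : ℤ} (x : FPre P K E n) : FRel (.smul 0 x) .zero
  -- linearity of the operations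
  | d_add {E : Finset ℕ} {n : ℤ} (n' : ℤ) (x y : FPre P K E n) :
      FRel (.d n' (.add x y)) (.add (.d n' x) (.d n' y))
  | d_smul {E : Finset ℕ} {n : ℤ} (n' : ℤ) (c : k) (x : FPre P K E n) :
      FRel (.d n' (.smul c x)) (.smul c (.d n' x))
  | rl_add {E E' : Finset ℕ} {n : ℤ} (σ : E ≃ E') (x y : FPre P K E n) :
      FRel (.rl σ (.add x y)) (.add (.rl σ x) (.rl σ y))
  | rl_smul {E E' : Finset ℕ} {n : ℤ} (σ : E ≃ E') (c : k) (x : FPre P K E n) :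
      FRel (.rl σ (.smul c x)) (.smul c (.rl σ x))
  | act_add_left {E F G : Finset ℕ} {e : ℕ} (h : Subst E e F G) {i j n : ℤ} (hn : i + j = n)
      (x y : FPre P K E i) (p : El P.S F j) :
      FRel (.act h hn (.add x y) p) (.add (.act h hn x p) (.act h hn y p))
  | act_smul_left {E F G : Finset ℕ} {e : ℕ} (h : Subst E e F G) {i j n : ℤ} (hn : i + j = n)
      (c : k) (x : FPre P K E i) (p : El P.S F j) :
      FRel (.act h hn (.smul c x) p) (.smul c (.act h hn x p))
  | act_add_right {E F G : Finset ℕ} {e : ℕ} (h : Subst E e F G) {i j n : ℤ} (hn : i + j = n)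
      (x : FPre P K E i) (p q : El P.S F j) :
      FRel (.act h hn x (p + q)) (.add (.act h hn x p) (.act h hn x q))
  | act_smul_right {E F G : Finset ℕ} {e : ℕ} (h : Subst E e F G) {i j n : ℤ} (hn : i + j = n)
      (c : k) (x : FPre P K E i) (p : El P.S F j) :
      FRel (.act h hn x (c • p)) (.smul c (.act h hn x p))
  -- `K` maps to the quotient by a morphism of `Σ_*`-modules
  | of_add {E : Finset ℕ} {n : ℤ} (x y : El K E n) :
      FRel (.of (x + y)) (.add (.of x) (.of y))
  | of_smul {E : Finset ℕ} {n : ℤ} (c : k) (x : El K E n) :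
      FRel (.of (c • x)) (.smul c (.of x))
  | of_dl {E : Finset ℕ} {n : ℤ} (n' : ℤ) (x : El K E n) :
      FRel (.of (dl K E n n' x)) (.d n' (.of x))
  | of_rl {E E' : Finset ℕ} {n : ℤ} (σ : E ≃ E') (x : El K E n) :
      FRel (.of (DGOperad.rl K σ n x)) (.rl σ (.of x))
  -- `Σ_*`-modules in dg modules
  | d_shape {E : Finset ℕ} {n n' : ℤ} (_ : ¬ n' + 1 = n) (x : FPre P K E n) :
      FRel (.d n' x) .zero
  | d_d {E : Finset ℕ} {n : ℤ} (n' n'' : ℤ) (x : FPre P K E n) :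
      FRel (.d n'' (.d n' x)) .zero
  | rl_refl {E : Finset ℕ} {n : ℤ} (x : FPre P K E n) : FRel (.rl (Equiv.refl E) x) x
  | rl_trans {E E' E'' : Finset ℕ} {n : ℤ} (σ : E ≃ E') (τ : E' ≃ E'') (x : FPre P K E n) :
      FRel (.rl (σ.trans τ) x) (.rl τ (.rl σ x))
  | d_rl {E E' : Finset ℕ} {n : ℤ} (n' : ℤ) (σ : E ≃ E') (x : FPre P K E n) :
      FRel (.d n' (.rl σ x)) (.rl σ (.d n' x))
  -- right actions
  | leibniz {E F G : Finset ℕ} {e : ℕ} (h : Subst E e F G) {i i' j j' n n' : ℤ}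
      (_ : i' + 1 = i) (_ : j' + 1 = j) (_ : n' + 1 = n) (hn : i + j = n)
      (hl : i' + j = n') (hr : i + j' = n') (x : FPre P K E i) (p : El P.S F j) :
      FRel (.d n' (.act h hn x p))
        (.add (.act h hl (.d i' x) p) (.smul (sg i : k) (.act h hr x (dl P.S F j j' p))))
  | equivariant {E F G E' F' G' : Finset ℕ} {e e' : ℕ} (h : Subst E e F G)
      (h' : Subst E' e' F' G') (σ : E ≃ E') (τ : F ≃ F') (ρ : G ≃ G')
      (_ : (σ ⟨e, h.1⟩ : ℕ) = e') (_ : Glues e σ τ ρ)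
      {i j n : ℤ} (hn : i + j = n) (x : FPre P K E i) (p : El P.S F j) :
      FRel (.rl ρ (.act h hn x p)) (.act h' hn (.rl σ x) (DGOperad.rl P.S τ j p))
  | assoc_seq {E F H G F' L : Finset ℕ} {e f : ℕ} (h₁ : Subst E e F H) (_ : f ∈ F)
      (h₂ : Subst H f G L) (h₃ : Subst F f G F') (h₄ : Subst E e F' L)
      {i j l s t n : ℤ} (hs : i + j = s) (hn : s + l = n) (ht : j + l = t) (hn' : i + t = n)
      (x : FPre P K E i) (p : El P.S F j) (q : El P.S G l) :
      FRel (.act h₂ hn (.act h₁ hs x p) q) (.act h₄ hn' x (P.comp.act h₃ ht p q))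
  | assoc_par {E F G H H' L : Finset ℕ} {e f : ℕ} (_ : e ≠ f) (_ : e ∈ E) (_ : f ∈ E)
      (h₁ : Subst E e F H) (h₂ : Subst H f G L) (h₃ : Subst E f G H') (h₄ : Subst H' e F L)
      {i j l s t n : ℤ} (hs : i + j = s) (hn : s + l = n) (ht : i + l = t) (hn' : t + j = n)
      (x : FPre P K E i) (p : El P.S F j) (q : El P.S G l) :
      FRel (.act h₂ hn (.act h₁ hs x p) q)
        (.smul (sg (j * l) : k) (.act h₄ hn' (.act h₃ ht x q) p))
  | act_one {E : Finset ℕ} {e : ℕ} (h : Subst E e {e} E) {i : ℤ} (hi : i + 0 = i)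
      (x : FPre P K E i) : FRel (.act h hi x (P.one e)) x

variable (P K) in
/-- The elements of arity `E` and degree `n` of the free right `P`-module `K ∘ P`. -/
def FX (E : Finset ℕ) (n : ℤ) : Type u := Quot (FRel (P := P) (K := K) (E := E) (n := n))

/-- The class of a formal expression. -/
def FX.mk {E : Finset ℕ} {n : ℤ} (x : FPre P K E n) : FX P K E n := Quot.mk _ x

lemma FX.sound {E : Finset ℕ} {n : ℤ} {x y : FPre P K E n} (h : FRel x y) : FX.mk x = FX.mk y :=
  Quot.sound h

instance (E : Finset ℕ) (n : ℤ) : Add (FX P K E n) :=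
  ⟨Quot.map₂ .add (fun _ _ _ h => .add_congr (.refl _) h) (fun _ _ _ h => .add_congr h (.refl _))⟩

instance (E : Finset ℕ) (n : ℤ) : SMul k (FX P K E n) :=
  ⟨fun c => Quot.map (.smul c) (fun _ _ h => .smul_congr c h)⟩

instance (E : Finset ℕ) (n : ℤ) : Zero (FX P K E n) := ⟨FX.mk .zero⟩

instance (E : Finset ℕ) (n : ℤ) : Neg (FX P K E n) := ⟨fun x => (-1 : k) • x⟩

instance (E : Finset ℕ) (n : ℤ) : AddCommGroup (FX P K E n) where
  nsmul := nsmulRec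
  zsmul := zsmulRec
  add_assoc := by rintro ⟨x⟩ ⟨y⟩ ⟨z⟩; exact FX.sound (.add_assoc x y z)
  add_comm := by rintro ⟨x⟩ ⟨y⟩; exact FX.sound (.add_comm x y)
  zero_add := by rintro ⟨x⟩; exact FX.sound (.zero_add x)
  add_zero := by rintro ⟨x⟩; exact FX.sound (.trans (.add_comm x .zero) (.zero_add x))
  neg_add_cancel := by
    rintro ⟨x⟩
    refine FX.sound (.trans (.add_congr (.refl _) (.symm (.one_smul x))) ?_)
    refine .trans (.symm (.add_smul _ _ x)) ?_
    rw [neg_add_cancel]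
    exact .zero_smul x

instance (E : Finset ℕ) (n : ℤ) : Module k (FX P K E n) where
  one_smul := by rintro ⟨x⟩; exact FX.sound (.one_smul x)
  mul_smul := by rintro a b ⟨x⟩; exact FX.sound (.mul_smul a b x)
  smul_zero a := FX.sound (.smul_zero a)
  smul_add := by rintro a ⟨x⟩ ⟨y⟩; exact FX.sound (.smul_add a x y)
  add_smul := by rintro a b ⟨x⟩; exact FX.sound (.add_smul a b x)
  zero_smul := by rintro ⟨x⟩; exact FX.sound (.zero_smul x)

/-- The differential of the free right `P`-module. -/
def FX.d (E : Finset ℕ) (n n' : ℤ) : FX P K E n →ₗ[k] FX P K E n' where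
  toFun := Quot.map (.d n') (fun _ _ h => .d_congr n' h)
  map_add' := by rintro ⟨x⟩ ⟨y⟩; exact FX.sound (.d_add n' x y)
  map_smul' := by rintro c ⟨x⟩; exact FX.sound (.d_smul n' c x)

/-- The relabellings of the free right `P`-module. -/
def FX.rl {E E' : Finset ℕ} (σ : E ≃ E') (n : ℤ) : FX P K E n →ₗ[k] FX P K E' n where
  toFun := Quot.map (.rl σ) (fun _ _ h => .rl_congr σ h)
  map_add' := by rintro ⟨x⟩ ⟨y⟩; exact FX.sound (.rl_add σ x y)
  map_smul' := by rintro c ⟨x⟩; exact FX.sound (.rl_smul σ c x)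

variable (P K) in
/-- The underlying `Σ_*`-module of the free right `P`-module. -/
def freeRS : SMod k :=
  mkSMod (FX P K) FX.d (fun σ n => FX.rl σ n)
    (fun E n n' h => by ext ⟨x⟩; exact FX.sound (.d_shape h x))
    (fun E n n' n'' x _ _ => by
      obtain ⟨x⟩ := x
      exact FX.sound (.d_d n' n'' x))
    (fun E n x => by
      obtain ⟨x⟩ := x
      exact FX.sound (.rl_refl x))
    (fun σ τ n x => by
      obtain ⟨x⟩ := x
      exact FX.sound (.rl_trans σ τ x))
    (fun σ n n' x _ => by
      obtain ⟨x⟩ := x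
      exact FX.sound (.d_rl n' σ x))

lemma sg_smul_mk {E : Finset ℕ} {n : ℤ} (i : ℤ) (x : FPre P K E n) :
    FX.mk (.smul (sg i : k) x) = sg i • (FX.mk x : FX P K E n) := by
  rw [← Int.cast_smul_eq_zsmul k]; rfl

/-- The right action of `P` on the free right `P`-module. -/
def freeRAct : PartialComp (freeRS P K) P.S where
  act {E F G e} h {i j n} hn :=
    LinearMap.mk₂ k (M := FX P K E i) (Pₗ := FX P K G n)
      (fun x p => Quot.map (fun x => .act h hn x p) (fun _ _ hx => .act_congr h hn p hx) x)
      (by rintro ⟨x⟩ ⟨y⟩ p; exact FX.sound (.act_add_left h hn x y p))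
      (by rintro c ⟨x⟩ p; exact FX.sound (.act_smul_left h hn c x p))
      (by rintro ⟨x⟩ p q; exact FX.sound (.act_add_right h hn x p q))
      (by rintro c ⟨x⟩ p; exact FX.sound (.act_smul_right h hn c x p))

variable (P K) in
/-- The free right `P`-module `K ∘ P` generated by the `Σ_*`-module `K`. -/
def freeR : RMod P where
  S := freeRS P K
  α := freeRAct
  isRightAction :=
    { leibniz := by
        rintro E F G e h i i' j j' n n' hi hj hn' hn ⟨x⟩ p
        refine (FX.sound (.leibniz h hi hj hn' hn (by omega) (by omega) x p)).trans ?_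
        exact congrArg (FX.mk (.act h (by omega) (.d i' x) p) + ·) (sg_smul_mk i _)
      equivariant := by
        rintro E F G E' F' G' e e' h h' σ τ ρ he hg i j n hn ⟨x⟩ p
        exact FX.sound (.equivariant h h' σ τ ρ he hg hn x p)
      assoc_seq := by
        rintro E F H G F' L e f h₁ hf h₂ h₃ h₄ i j l s t n hs hn ht hn' ⟨x⟩ p q
        exact FX.sound (.assoc_seq h₁ hf h₂ h₃ h₄ hs hn ht hn' x p q)
      assoc_par := by
        rintro E F G H H' L e f hef he hf h₁ h₂ h₃ h₄ i j l s t n hs hn ht hn' ⟨x⟩ p q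
        exact (FX.sound (.assoc_par hef he hf h₁ h₂ h₃ h₄ hs hn ht hn' x p q)).trans
          (sg_smul_mk _ _)
      act_one := by
        rintro E e h i hi ⟨x⟩
        exact FX.sound (.act_one h hi x) }

variable (P K) in
/-- The universal morphism of `Σ_*`-modules `K ⟶ K ∘ P`. -/
def freeRι : K ⟶ (freeR P K).S :=
  mkHom (N := freeRS P K)
    (fun E n =>
      { toFun := fun x => (FX.mk (.of x) : FX P K E n)
        map_add' := fun x y => FX.sound (.of_add x y)
        map_smul' := fun c x => FX.sound (.of_smul c x) })
    (fun _ _ n' x _ => FX.sound (.of_dl n' x))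
    (fun σ _ x => FX.sound (.of_rl σ x))

/-- The value of a formal expression in a right `P`-module under `K`. -/
def FPre.eval {M : RMod P} (f : K ⟶ M.S) : ∀ {E : Finset ℕ} {n : ℤ}, FPre P K E n → El M.S E n
  | _, _, .of x => hl f _ _ x
  | _, _, .zero => 0
  | _, _, .add x y => x.eval f + y.eval f
  | _, _, .smul c x => c • x.eval f
  | _, _, .d n' x => dl M.S _ _ n' (x.eval f)
  | _, _, .rl σ x => DGOperad.rl M.S σ _ (x.eval f)
  | _, _, .act h hn x p => M.α.act h hn (x.eval f) p

lemma FRel.eval_eq {M : RMod P} (f : K ⟶ M.S) {E : Finset ℕ} {n : ℤ} {x y : FPre P K E n}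
    (h : FRel x y) : x.eval f = y.eval f := by
  induction h with
  | refl => rfl
  | symm _ h => exact h.symm
  | trans _ _ h h' => exact h.trans h'
  | add_congr _ _ h h' => simp only [FPre.eval, h, h']
  | smul_congr _ _ h => simp only [FPre.eval, h]
  | d_congr _ _ h => simp only [FPre.eval, h]
  | rl_congr _ _ h => simp only [FPre.eval, h]
  | act_congr _ _ _ _ h => simp only [FPre.eval, h]
  | add_assoc => exact _root_.add_assoc _ _ _
  | add_comm => exact _root_.add_comm _ _
  | zero_add => exact _root_.zero_add _
  | one_smul => exact _root_.one_smul _ _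
  | mul_smul => exact SemigroupAction.mul_smul _ _ _
  | smul_zero => exact _root_.smul_zero _
  | smul_add => exact _root_.smul_add _ _ _
  | add_smul => exact _root_.add_smul _ _ _
  | zero_smul => exact _root_.zero_smul _ _
  | d_add => simp only [FPre.eval, map_add]
  | d_smul => simp only [FPre.eval, map_smul]
  | rl_add => simp only [FPre.eval, map_add]
  | rl_smul => simp only [FPre.eval, map_smul]
  | act_add_left => simp only [FPre.eval, map_add, LinearMap.add_apply]
  | act_smul_left => simp only [FPre.eval, map_smul, LinearMap.smul_apply]
  | act_add_right => simp only [FPre.eval, map_add]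
  | act_smul_right => simp only [FPre.eval, map_smul]
  | of_add => simp only [FPre.eval, map_add]
  | of_smul => simp only [FPre.eval, map_smul]
  | of_dl => simp only [FPre.eval, hl_dl]
  | of_rl => simp only [FPre.eval, hl_rl]
  | d_shape h => simp only [FPre.eval, dl_shape M.S _ h, LinearMap.zero_apply]
  | d_d => exact dl_dl M.S _ _ _ _ _
  | rl_refl => exact DGOperad.rl_refl M.S _ _ _
  | rl_trans σ τ => exact DGOperad.rl_trans M.S σ τ _ _
  | d_rl => exact dl_rl M.S _ _ _ _
  | leibniz h hi hj hn' hn hl hr x p =>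
    simp only [FPre.eval]
    rw [M.isRightAction.leibniz h hi hj hn' hn, Int.cast_smul_eq_zsmul]
  | equivariant h h' σ τ ρ he hg hn x p =>
    exact M.isRightAction.equivariant h h' σ τ ρ he hg hn _ p
  | assoc_seq h₁ hf h₂ h₃ h₄ hs hn ht hn' x p q =>
    exact M.isRightAction.assoc_seq h₁ hf h₂ h₃ h₄ hs hn ht hn' _ p q
  | assoc_par hef he hf h₁ h₂ h₃ h₄ hs hn ht hn' x p q =>
    simp only [FPre.eval]
    rw [M.isRightAction.assoc_par hef he hf h₁ h₂ h₃ h₄ hs hn ht hn', Int.cast_smul_eq_zsmul]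
  | act_one h hi x => exact M.isRightAction.act_one h hi _

/-- The morphism of right `P`-modules `K ∘ P ⟶ M` induced by `f : K ⟶ M`. -/
def freeRDesc {M : RMod P} (f : K ⟶ M.S) : freeR P K ⟶ M where
  hom := mkHom (M := freeRS P K)
    (fun E n =>
      { toFun := fun x => Quot.lift (FPre.eval f) (fun _ _ h => h.eval_eq f) x
        map_add' := by rintro ⟨x⟩ ⟨y⟩; rfl
        map_smul' := by rintro c ⟨x⟩; rfl })
    (by rintro E n n' ⟨x⟩ _; rfl)
    (by rintro E E' σ n ⟨x⟩; rfl)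
  map_act := by rintro E F G e h i j n hn ⟨x⟩ p; rfl

lemma hl_freeR_mk {M : RMod P} (f : K ⟶ M.S) (g : freeR P K ⟶ M) (hg : freeRι P K ≫ g.hom = f)
    {E : Finset ℕ} {n : ℤ} (x : FPre P K E n) :
    hl g.hom E n (FX.mk x : FX P K E n) = x.eval f := by
  induction x with
  | of x => subst hg; rfl
  | zero => exact map_zero (hl g.hom _ _)
  | add x y hx hy =>
    exact (map_add (hl g.hom _ _) (FX.mk x : FX P K _ _) (FX.mk y : FX P K _ _)).trans
      (congrArg₂ (· + ·) hx hy)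
  | smul c x hx =>
    exact (map_smul (hl g.hom _ _) c (FX.mk x : FX P K _ _)).trans (congrArg (c • ·) hx)
  | d n' x hx =>
    exact (hl_dl g.hom _ _ n' (FX.mk x : FX P K _ _)).trans (congrArg (dl M.S _ _ n') hx)
  | rl σ x hx =>
    exact (hl_rl g.hom σ _ (FX.mk x : FX P K _ _)).trans (congrArg (DGOperad.rl M.S σ _) hx)
  | act h hn x p hx =>
    exact (g.map_act h hn (FX.mk x : FX P K _ _) p).trans
      (congrArg (fun z => M.α.act h hn z p) hx)

/-- The universal property: `K ∘ P` is the free right `P`-module generated by `K`. -/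
theorem freeR_universal {M : RMod P} (f : K ⟶ M.S) :
    ∃! g : freeR P K ⟶ M, freeRι P K ≫ g.hom = f := by
  refine ⟨freeRDesc f, rfl, ?_⟩
  intro g hg
  apply RMod.hom_ext
  apply DGOperad.hom_ext
  rintro E n ⟨x⟩
  change hl g.hom E n (FX.mk x : FX P K E n) = x.eval f
  exact hl_freeR_mk f g hg x

end freeRight

/-! ### Generating (acyclic) cofibrations -/

open scoped ZeroObject

/-- A dg module `C`, as a `Σ_*`-module concentrated in arity `∅`: `C(∅) = C` and `C(E) = 0` for
`E ≠ ∅`. -/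
def constS (C : DGMod k) : SMod k :=
  mkSMod (fun E n => PLift (E = ∅) → C.X n) (fun _ n n' => (C.d n n').hom.compLeft _)
    (fun {E E'} σ n => LinearMap.funLeft k (C.X n) (fun h : PLift (E' = ∅) =>
      (⟨by
        obtain ⟨rfl⟩ := h
        exact Finset.eq_empty_of_forall_notMem fun x hx => by
          exact absurd (σ ⟨x, hx⟩).2 (Finset.notMem_empty _)⟩ : PLift (E = ∅))))
    (fun E n n' h => by
      ext x y
      simp [C.shape n n' h])
    (fun E n n' n'' x _ _ => by
      ext y
      exact congrArg (fun f => f.hom (x y)) (C.d_comp_d n n' n''))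
    (fun _ _ _ => rfl) (fun _ _ _ _ => rfl) (fun _ _ _ _ _ => rfl)

lemma subsingleton_constS (C : DGMod k) {E : Finset ℕ} (hE : E.Nonempty) (n : ℤ) :
    Subsingleton (El (constS C) E n) :=
  ⟨fun _ _ => funext fun h => absurd h.down hE.ne_empty⟩

/-- A dg module as a right `P`-module concentrated in arity `∅`. -/
def constR (P : Operad k) (C : DGMod k) : RMod P where
  S := constS C
  α := { act := fun _ _ _ _ _ => 0 }
  isRightAction :=
    { leibniz := fun h _ _ _ _ _ _ _ _ _ _ m p => by simp
      equivariant := fun h h' σ τ ρ _ _ _ _ _ _ m p => by simp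
      assoc_seq := fun _ _ _ _ _ _ _ _ _ _ _ _ _ _ _ m p q => by simp
      assoc_par := fun _ _ _ _ _ _ _ _ _ _ _ _ _ _ _ _ _ m p q => by simp
      act_one := fun {E e} h _ _ m =>
        (subsingleton_constS C ⟨e, h.1⟩ _).elim _ _ }

/-- Morphisms of dg modules as morphisms of right `P`-modules concentrated in arity `∅`. -/
def constRMap (P : Operad k) {C D : DGMod k} (i : C ⟶ D) : constR P C ⟶ constR P D where
  hom := mkHom (M := constS C) (N := constS D) (fun _ n => (i.f n).hom.compLeft _)
    (fun E n n' x _ => by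
      refine funext fun y => ?_
      exact congrArg (fun f => f.hom (x y)) (i.comm n n').symm)
    (fun _ _ _ => rfl)
  map_act _ _ _ _ _ m p := by
    exact map_zero (hl _ _ _)

variable (k) in
/-- The free `Σ_*`-module `F_r`: the free `k`-module on the bijections `{0, …, r - 1} ≃ E` in
degree `0`. In arity `{0, …, r - 1}` this is `k[Σ_r]`, and it is zero if `E` does not have `r`
elements. -/
def freeSigma (r : ℕ) : SMod k :=
  ({ obj := fun E => ModuleCat.of k ((Finset.range r ≃ E.set) →₀ k)
     map := fun {E E'} σ => ModuleCat.ofHom (Finsupp.lmapDomain k k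
       (fun τ : Finset.range r ≃ E.set => τ.trans (show E.set ≃ E'.set from σ)))
     map_id := fun E => by
       ext τ
       simp
       rfl
     map_comp := fun f g => by
       ext τ
       simp
       rfl } : Bij ⥤ ModuleCat.{u} k) ⋙ HomologicalComplex.single _ _ 0

variable (k) in
/-- The sphere `S^d`: `k` in degree `d`. -/
def sphere (d : ℤ) : DGMod k :=
  (HomologicalComplex.single (ModuleCat.{u} k) (ComplexShape.down ℤ) d).obj (ModuleCat.of k k)

variable (k) in
/-- The disk `D^d`: `k` in degrees `d` and `d - 1`, with the identity as differential. -/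
def disk (d : ℤ) : DGMod k :=
  HomologicalComplex.double (c := ComplexShape.down ℤ) (𝟙 (ModuleCat.of k k))
    (show (ComplexShape.down ℤ).Rel d (d - 1) by simp)

variable (k) in
/-- The generating cofibration `S^{d-1} ⟶ D^d` of dg modules, the identity in degree `d - 1`. -/
def sphereToDisk (d : ℤ) : sphere k (d - 1) ⟶ disk k d :=
  HomologicalComplex.mkHomFromSingle
    (HomologicalComplex.doubleXIso₁ (c := ComplexShape.down ℤ) (𝟙 (ModuleCat.of k k))
      (show (ComplexShape.down ℤ).Rel d (d - 1) by simp) (by omega)).inv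
    (fun n _ => by
      change _ ≫ (HomologicalComplex.double _ _).d _ _ = 0
      rw [HomologicalComplex.double_d_eq_zero₀ _ _ _ _ (by omega), comp_zero]
      rfl)

variable (k) in
/-- The generating acyclic cofibration `0 ⟶ D^d` of dg modules. -/
def zeroToDisk (d : ℤ) : (0 : DGMod k) ⟶ disk k d := 0

section generating

variable {P : Operad k} (U : RAlg P)

/-- `U ⊗ (C ⊗ (F_r ∘ P))`. -/
def genObj (C : DGMod k) (r : ℕ) : LMod U :=
  freeL U ((constR P C).tensor (freeR P (freeSigma k r)))

/-- `U ⊗ (i ⊗ (F_r ∘ P)) : U ⊗ (C ⊗ (F_r ∘ P)) ⟶ U ⊗ (D ⊗ (F_r ∘ P))`. -/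
def genMap {C D : DGMod k} (i : C ⟶ D) (r : ℕ) : genObj U C r ⟶ genObj U D r :=
  freeLMap U (RMod.tensorMap (constRMap P i) (𝟙 (freeR P (freeSigma k r))))

/-- The set `FI` of the maps `U ⊗ (S^{d-1} ⊗ (F_r ∘ P)) ⟶ U ⊗ (D^d ⊗ (F_r ∘ P))`. -/
def FI : MorphismProperty (LMod U) :=
  MorphismProperty.ofHoms fun x : ℤ × ℕ => genMap U (sphereToDisk k x.1) x.2

/-- The set `FJ` of the maps `U ⊗ (0 ⊗ (F_r ∘ P)) ⟶ U ⊗ (D^d ⊗ (F_r ∘ P))`. -/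
def FJ : MorphismProperty (LMod U) :=
  MorphismProperty.ofHoms fun x : ℤ × ℕ => genMap U (zeroToDisk k x.1) x.2

end generating

/-! ### Weak equivalences, fibrations, cofibrant objects -/

variable (k) in
/-- The trivial fibrations of dg modules: the degreewise surjective quasi-isomorphisms. -/
def dgTrivialFibrations : MorphismProperty (DGMod k) :=
  fun _ _ f => QuasiIso f ∧ ∀ n, Function.Surjective (f.f n).hom

/-- Cofibrant dg modules: `0 ⟶ C` has the left lifting property with respect to the degreewise
surjective quasi-isomorphisms. -/
def IsCofibrantDG (C : DGMod k) : Prop :=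
  (dgTrivialFibrations k).llp (0 : (0 : DGMod k) ⟶ C)

/-- Weak equivalences of right `P`-modules: quasi-isomorphisms in every arity. -/
def rmodWeakEquivalences (P : Operad k) : MorphismProperty (RMod P) :=
  fun _ _ f => ∀ E : Bij, QuasiIso (f.hom.app E)

/-- Fibrations of right `P`-modules: surjections in every arity and degree. -/
def rmodFibrations (P : Operad k) : MorphismProperty (RMod P) :=
  fun _ _ f => ∀ (E : Bij) (n : ℤ), Function.Surjective ((f.hom.app E).f n).hom

/-- The model category `C` is cofibrantly generated, with `I` as generating cofibrations and `J` as
generating acyclic cofibrations: both permit the small object argument, the trivial fibrations are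
the maps with the right lifting property with respect to `I`, and the fibrations are the maps with
the right lifting property with respect to `J`. -/
structure IsCofibrantlyGenerated (C : Type (u + 1)) [Category.{u} C] [ModelCategory C]
    (I J : MorphismProperty C) : Prop where
  smallObject_I : MorphismProperty.HasSmallObjectArgument.{u} I
  smallObject_J : MorphismProperty.HasSmallObjectArgument.{u} J
  trivialFibrations_eq : trivialFibrations C = I.rlp
  fibrations_eq : fibrations C = J.rlp

end

end DGOperad

namespace DGOperad

noncomputable section

variable {k : Type u} [CommRing k]

/-! ### Chain complexes of modules in terms of elements -/

/-! The model structure is transferred from dg modules along the evaluations M ↦ M({0, …, r-1}). The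
functor C ↦ U ⊗ (C ⊗ (F_r ∘ P)) is left adjoint to evaluation (`genHomEquiv`), because it composes
four free constructions: a morphism out of U ⊗ N is a morphism out of N, a morphism out of C ⊗ N is
a morphism from N to Hom(C, -), F_r ∘ P is free on F_r, and a morphism out of F_r is a cycle of
degree 0 in arity {0, …, r-1}. For Hom(C, M) such cycles are the chain maps from C to M({0, …,
r-1}). So lifting against a generator in U-modules is lifting against S^{d-1} → D^d or 0 → D^d in
each arity (`hasLiftingProperty_genMap_iff`). Spheres corepresent cycles and disks corepresent
elements, so these lifting problems are statements about elements, and they characterise the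
surjective quasi-isomorphisms and the surjections (`FI_rlp`, `FJ_rlp`).

Limits and colimits are computed in each arity and degree. With the element of P or U fixed, every
operation of a U-module is a natural transformation between evaluation functors, and every axiom is
an equation between such transformations. An additive k-linear functor Ψ on functors LMod U ⥤ Mod k
therefore produces a new U-module (`ofFunctor`); the functors G ↦ lim (F ⋙ G) and G ↦ colim (F ⋙ G)
give the limit and the colimit of F. As a consequence evaluations preserve filtered colimits, the
sources of the generators are finitely presentable, and the small object argument runs at ℵ₀.

What remains is that a map i : A → B with the left lifting property against all fibrations is a weak
equivalence (`fibL_llp_le_weqL`). No pushout or transfinite composition of generators is analysed.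
Take the contractible complex `contr k`, with its cycle 1 in degree 0. Then Hom(contr, B) is
acyclic, and evaluation at 1 is a surjection Hom(contr, B) → B. So i factors as A → A × Hom(contr,
B) → B, a weak equivalence followed by a fibration. Lifting i against the second map makes i a
retract of the first. The identification of the acyclic cofibrations (`weqL_inf_cof`) is then the
usual retract argument. -/

lemma shortComplex_quasiIso_iff {S T : ShortComplex (ModuleCat.{u} k)} (φ : S ⟶ T) :
    ShortComplex.QuasiIso φ ↔
      (∀ (x : S.X₂) (y : T.X₁), S.g x = 0 → T.f y = φ.τ₂ x → ∃ w, S.f w = x) ∧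
      (∀ y : T.X₂, T.g y = 0 → ∃ x w, S.g x = 0 ∧ y = φ.τ₂ x + T.f w) := by
  -- Homology is computed in its concrete form, kernel modulo image. `hK` and `hH` say that the
  -- induced map sends the class of a cycle z to the class of φ(z), so the two clauses are
  -- injectivity and surjectivity of that map.
  let γ : ShortComplex.LeftHomologyMapData φ S.moduleCatLeftHomologyData
    T.moduleCatLeftHomologyData := default
  have hK (z : S.moduleCatLeftHomologyData.K) :
      (show T.X₂ from (γ.φK.hom z).1) = φ.τ₂ z.1 :=
    congrArg (fun f => f.hom z) γ.commi
  have hH (z : S.moduleCatLeftHomologyData.K) :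
      γ.φH.hom (Submodule.Quotient.mk z) = Submodule.Quotient.mk (γ.φK.hom z) :=
    congrArg (fun f => f.hom z) γ.commπ
  rw [γ.quasiIso_iff, ConcreteCategory.isIso_iff_bijective]
  refine and_congr ?_ ?_
  · constructor
    · intro h x y hx hy
      let z : LinearMap.ker S.g.hom := ⟨x, hx⟩
      have h0 : γ.φH.hom (Submodule.Quotient.mk z) = 0 := by
        refine (hH z).trans ((Submodule.Quotient.mk_eq_zero _).2 ⟨y, ?_⟩)
        exact Subtype.ext (hy.trans (hK z).symm)
      have h1 := h (h0.trans (map_zero γ.φH.hom).symm)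
      obtain ⟨w, hw⟩ := (Submodule.Quotient.mk_eq_zero _).1 h1
      exact ⟨w, congrArg Subtype.val hw⟩
    · intro h
      refine (injective_iff_map_eq_zero γ.φH.hom).2 ?_
      intro a ha
      obtain ⟨z, rfl⟩ := Submodule.Quotient.mk_surjective _ a
      obtain ⟨y, hy⟩ := (Submodule.Quotient.mk_eq_zero _).1 ((hH z).symm.trans ha)
      obtain ⟨w, hw⟩ := h z.1 y z.2 ((congrArg Subtype.val hy).trans (hK z))
      exact (Submodule.Quotient.mk_eq_zero _).2 ⟨w, Subtype.ext hw⟩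
  · constructor
    · intro h y hy
      let z : LinearMap.ker T.g.hom := ⟨y, hy⟩
      obtain ⟨a, ha⟩ := h (Submodule.Quotient.mk z)
      obtain ⟨x, rfl⟩ := Submodule.Quotient.mk_surjective _ a
      obtain ⟨w, hw⟩ := (Submodule.Quotient.eq _).1 (ha.symm.trans (hH x))
      refine ⟨x.1, w, x.2, ?_⟩
      have hw' : T.f w = y - φ.τ₂ x.1 := (congrArg Subtype.val hw).trans (congrArg (y - ·) (hK x))
      rw [hw', add_sub_cancel]
    · intro h a
      obtain ⟨z, rfl⟩ := Submodule.Quotient.mk_surjective _ a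
      obtain ⟨x, w, hx, hw⟩ := h z.1 z.2
      refine ⟨Submodule.Quotient.mk ⟨x, hx⟩, ?_⟩
      refine (hH ⟨x, hx⟩).trans ?_
      have hmem : z - (show LinearMap.ker T.g.hom from γ.φK.hom ⟨x, hx⟩) ∈ LinearMap.range T.moduleCatToCycles := by
        refine ⟨w, Subtype.ext ?_⟩
        refine Eq.trans ?_ (congrArg (z.1 - ·) (hK ⟨x, hx⟩)).symm
        rw [hw]
        exact (add_sub_cancel_left _ _).symm
      exact ((Submodule.Quotient.eq _).2 hmem).symm

/-- The two clauses are injectivity and surjectivity on H_m. The three neighbouring degrees are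
variables linked by equations, so that no element has to be transported between degrees such as m
and m + 1 - 1. -/
lemma quasiIso_iff_elements {X Y : DGMod k} (f : X ⟶ Y) :
    QuasiIso f ↔
      (∀ (n m l : ℤ), m + 1 = n → l + 1 = m → ∀ (x : X.X m) (y : Y.X n), X.d m l x = 0 →
        Y.d n m y = f.f m x → ∃ w, X.d n m w = x) ∧
      (∀ (n m l : ℤ), m + 1 = n → l + 1 = m → ∀ y : Y.X m, Y.d m l y = 0 →
        ∃ x w, X.d m l x = 0 ∧ y = f.f m x + Y.d n m w) := by
  have key (n m l : ℤ) (hn : m + 1 = n) (hl : l + 1 = m) : QuasiIsoAt f m ↔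
      (∀ (x : X.X m) (y : Y.X n), X.d m l x = 0 → Y.d n m y = f.f m x → ∃ w, X.d n m w = x) ∧
      (∀ y : Y.X m, Y.d m l y = 0 → ∃ x w, X.d m l x = 0 ∧ y = f.f m x + Y.d n m w) := by
    rw [quasiIsoAt_iff' f n m l ((ComplexShape.down ℤ).prev_eq' (by simpa using hn))
      ((ComplexShape.down ℤ).next_eq' (by simpa using hl)), shortComplex_quasiIso_iff]
    rfl
  rw [quasiIso_iff]
  constructor
  · intro h
    exact ⟨fun n m l hn hl => ((key n m l hn hl).1 (h m)).1,
      fun n m l hn hl => ((key n m l hn hl).1 (h m)).2⟩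
  · intro h m
    exact (key (m + 1) m (m - 1) rfl (by omega)).2
      ⟨h.1 _ _ _ rfl (by omega), h.2 _ _ _ rfl (by omega)⟩

/-- Lifting against `S^{d-1} ⟶ D^d`, in terms of elements. -/
def LiftsBoundaries {X Y : DGMod k} (f : X ⟶ Y) : Prop :=
  ∀ (n m l : ℤ), m + 1 = n → l + 1 = m → ∀ (x : X.X m) (y : Y.X n), X.d m l x = 0 →
    Y.d n m y = f.f m x → ∃ w, X.d n m w = x ∧ f.f n w = y

/-- A diagram chase. Injectivity on homology produces a primitive of x, and surjectivity on homology
and in each degree corrects it so that it lies over y. -/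
lemma dgTrivialFibrations_iff {X Y : DGMod k} (f : X ⟶ Y) :
    dgTrivialFibrations k f ↔ LiftsBoundaries f := by
  have hd {Z : DGMod k} (a b c : ℤ) (x : Z.X a) : Z.d b c (Z.d a b x) = 0 :=
    congrArg (fun f => f.hom x) (Z.d_comp_d a b c)
  have hf (a b : ℤ) (x : X.X a) : Y.d a b (f.f a x) = f.f b (X.d a b x) :=
    congrArg (fun f => f.hom x) (f.comm a b)
  rw [dgTrivialFibrations, quasiIso_iff_elements]
  constructor
  · rintro ⟨⟨h1, h2⟩, h3⟩ n m l hn hl x y hx hy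
    obtain ⟨x₀, rfl⟩ := h1 n m l hn hl x y hx hy
    -- The error y - f(x₀) is a cycle, so it is f of a cycle z up to a boundary dw. Lifting w to v
    -- and adding z + dv to x₀ removes the error without changing the differential.
    obtain ⟨z, w, hz, hw⟩ := h2 (n + 1) n m rfl hn (y - f.f n x₀) (by
      rw [map_sub, hy, hf, sub_self])
    obtain ⟨v, rfl⟩ := h3 _ w
    refine ⟨x₀ + z + X.d (n + 1) n v, ?_, ?_⟩
    · rw [map_add, map_add, hz, hd, add_zero, add_zero]
    · have hw' : y - f.f n x₀ = f.f n z + Y.d (n + 1) n (f.f (n + 1) v) := hw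
      rw [map_add, map_add, ← hf, add_assoc, ← hw', add_sub_cancel]
  · intro h
    -- The case x = 0: every cycle of the target lifts to a cycle of the source.
    have h0 (n m : ℤ) (hm : m + 1 = n) (y : Y.X n) (hy : Y.d n m y = 0) :
        ∃ x, X.d n m x = 0 ∧ f.f n x = y :=
      h n m (m - 1) hm (by omega) 0 y (map_zero _) (by rw [hy, map_zero])
    refine ⟨⟨?_, ?_⟩, ?_⟩
    · intro n m l hn hl x y hx hy
      obtain ⟨w, hw, -⟩ := h n m l hn hl x y hx hy
      exact ⟨w, hw⟩
    · intro n m l hn hl y hy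
      obtain ⟨x, hx, rfl⟩ := h0 m l hl y hy
      exact ⟨x, 0, hx, by rw [map_zero, add_zero]⟩
    · intro n y
      -- For surjectivity on an arbitrary y, the boundary dy is lifted to a cycle x, and the
      -- hypothesis is then applied to the pair (x, y).
      obtain ⟨x, hx, hxy⟩ := h0 (n - 1) (n - 1 - 1) (by omega) (Y.d n (n - 1) y) (hd _ _ _ _)
      obtain ⟨w, -, hw⟩ := h n (n - 1) (n - 1 - 1) (by omega) (by omega) x y hx hxy.symm
      exact ⟨w, hw⟩

/-! ### Left `U`-modules in terms of bilinear operations -/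

section LeftActions

variable {P : Operad k} {U : RAlg P}

/-- Bilinear operations `U(A)_i × M(B)_j → M(A ⊔ B)_{i+j}`. -/
abbrev LeftOps (U : RAlg P) (M : SMod k) : Type u :=
  ∀ {A B E : Finset ℕ}, Split A B E → ∀ {i j n : ℤ}, i + j = n →
    (El U.U.S A i →ₗ[k] El M B j →ₗ[k] El M E n)

/-- The axioms of a left action of `U` on a right `P`-module. -/
structure IsLeftAction (U : RAlg P) (M : RMod P) (a : LeftOps U M.S) : Prop where
  dl : ∀ {A B E : Finset ℕ} (hs : Split A B E) {i i' j j' n n' : ℤ} (hn : i + j = n)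
    (_ : n' + 1 = n) (_ : i' + 1 = i) (_ : j' + 1 = j) (hl : i' + j = n') (hr : i + j' = n')
    (x : El U.U.S A i) (y : El M.S B j), dl M.S E n n' (a hs hn x y) =
      a hs hl (dl U.U.S A i i' x) y + sg i • a hs hr x (dl M.S B j j' y)
  rl : ∀ {A B A' B' E E' : Finset ℕ} (σ : E ≃ E') (hs : Split A B E) (hs' : Split A' B' E')
    (σA : A ≃ A') (σB : B ≃ B') (_ : Extends σA σ) (_ : Extends σB σ) {i j n : ℤ}
    (hn : i + j = n) (x : El U.U.S A i) (y : El M.S B j),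
    rl M.S σ n (a hs hn x y) = a hs' hn (rl U.U.S σA i x) (rl M.S σB j y)
  act_left : ∀ {A B A' E F G : Finset ℕ} {e : ℕ} (h : Subst E e F G) (hs : Split A B E)
    (hA : Subst A e F A') (hs' : Split A' B G) {i j l m i' n : ℤ} (hm : i + j = m)
    (hn : m + l = n) (hi : i + l = i') (hn' : i' + j = n) (x : El U.U.S A i) (y : El M.S B j)
    (p : El P.S F l),
    M.α.act h hn (a hs hm x y) p = sg (l * j) • a hs' hn' (U.U.α.act hA hi x p) y
  act_right : ∀ {A B B' E F G : Finset ℕ} {e : ℕ} (h : Subst E e F G) (hs : Split A B E)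
    (hB : Subst B e F B') (hs' : Split A B' G) {i j l m j' n : ℤ} (hm : i + j = m)
    (hn : m + l = n) (hj : j + l = j') (hn' : i + j' = n) (x : El U.U.S A i) (y : El M.S B j)
    (p : El P.S F l),
    M.α.act h hn (a hs hm x y) p = a hs' hn' x (M.α.act hB hj y p)
  one : ∀ {A : Finset ℕ} {i : ℤ} (x : El M.S A i),
    a (split_empty_left A) (zero_add i) U.one x = x
  mul : ∀ {A B C AB BC E : Finset ℕ} (h₁ : Split A B AB) (h₂ : Split AB C E)
    (h₃ : Split B C BC) (h₄ : Split A BC E) {i j l ij jl n : ℤ} (e₁ : i + j = ij)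
    (e₂ : ij + l = n) (e₃ : j + l = jl) (e₄ : i + jl = n)
    (x : El U.U.S A i) (y : El U.U.S B j) (z : El M.S C l),
    a h₂ e₂ (U.m h₁ e₁ x y) z = a h₄ e₄ x (a h₃ e₃ y z)

/-- The morphism `U ⊗ M ⟶ M` given by a left action. -/
def IsLeftAction.toHom {M : RMod P} {a : LeftOps U M.S} (ha : IsLeftAction U M a) :
    U.U.tensor M ⟶ M where
  hom := mkHom (M := (U.U.tensor M).S)
    (fun E n => U.U.tpLift M fun _ _ _ _ hs hn => a hs hn)
    (fun E n n' x h => by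
      induction x using tp_ind with
      | h0 => simp only [map_zero]
      | hadd x y hx hy => simp only [map_add, hx, hy]
      | @hpt A B hs i j hn x y =>
        rw [dl_tp hs hn h (i' := i - 1) (j' := j - 1) (by omega) (by omega), map_add, map_zsmul,
          tpLift_tp, tpLift_tp, tpLift_tp,
          ha.dl hs hn h (i' := i - 1) (j' := j - 1) (by omega) (by omega)])
    (fun {E E'} σ n x => by
      induction x using tp_ind with
      | h0 => simp only [map_zero]
      | hadd x y hx hy => simp only [map_add, hx, hy]
      | @hpt A B hs i j hn x y =>
        rw [rl_tp σ hs (split_im σ hs) (res σ hs.left) (res σ hs.right) (res_extends _ _)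
          (res_extends _ _), tpLift_tp, tpLift_tp,
          ha.rl σ hs (split_im σ hs) (res σ hs.left) (res σ hs.right) (res_extends _ _)
          (res_extends _ _)])
  map_act {E F G e} h {i j n} hn m p := by
    simp only [hl_mkHom]
    induction m using tp_ind with
    | h0 => simp only [map_zero, LinearMap.zero_apply]
    | hadd x y hx hy => simp only [map_add, LinearMap.add_apply, hx, hy]
    | @hpt A B hs a b hi x y =>
      rcases hs.mem h.1 with he | he
      · obtain ⟨hA, hs'⟩ := h.split_left hs he
        rw [act_tp_left h hs hA hs' hi hn rfl (by omega), map_zsmul, tpLift_tp, tpLift_tp,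
          ha.act_left h hs hA hs' hi hn rfl (by omega)]
      · obtain ⟨hB, hs'⟩ := h.split_right hs he
        rw [act_tp_right h hs hB hs' hi hn rfl (by omega), tpLift_tp, tpLift_tp,
          ha.act_right h hs hB hs' hi hn rfl (by omega)]

lemma IsLeftAction.toHom_tp {M : RMod P} {a : LeftOps U M.S} (ha : IsLeftAction U M a)
    {A B E : Finset ℕ} (hs : Split A B E) {i j n : ℤ} (hn : i + j = n) (x : El U.U.S A i)
    (y : El M.S B j) : hl ha.toHom.hom E n (U.U.tp M hs hn x y) = a hs hn x y :=
  tpLift_tp (M := U.U) (N := M) (fun _ _ _ _ hs hn => a hs hn) hs hn x y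

/-- The left `U`-module given by a left action. -/
def LMod.ofAction {M : RMod P} {a : LeftOps U M.S} (ha : IsLeftAction U M a) : LMod U where
  M := M
  act := ha.toHom
  one_act x := by rw [ha.toHom_tp, ha.one]
  mul_act h₁ h₂ h₃ h₄ _ _ _ _ _ _ e₁ e₂ e₃ e₄ x y z := by
    rw [ha.toHom_tp, ha.toHom_tp, ha.toHom_tp]
    exact ha.mul h₁ h₂ h₃ h₄ e₁ e₂ e₃ e₄ x y z

namespace LMod

variable (M N L : LMod U)

/-- The module of elements of arity `E` and degree `n` of a left `U`-module. -/
abbrev El (E : Finset ℕ) (n : ℤ) : Type u := DGOperad.El M.M.S E n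

/-- The left action `x · y` of homogeneous elements. -/
def u : LeftOps U M.M.S := fun hs _ _ _ hn => (U.U.tp M.M hs hn).compr₂ (hl M.act.hom _ _)

lemma u_ofAction {M : RMod P} {a : LeftOps U M.S} (ha : IsLeftAction U M a)
    {A B E : Finset ℕ} (hs : Split A B E) {i j n : ℤ} (hn : i + j = n) (x : DGOperad.El U.U.S A i)
    (y : DGOperad.El M.S B j) : (ofAction ha).u hs hn x y = a hs hn x y :=
  ha.toHom_tp hs hn x y

/-- The converse of `LMod.ofAction`. From here on, U-modules are handled through the bilinear
operations `u` and not through morphisms out of a tensor product. -/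
lemma isLeftAction : IsLeftAction U M.M M.u where
  dl hs _ _ _ _ _ _ hn hn' hi hj hl hr x y := by
    simp only [u, LinearMap.compr₂_apply]
    rw [← hl_dl, dl_tp hs hn hn' hi hj, map_add, map_zsmul]
  rl σ hs hs' σA σB hA hB _ _ _ hn x y := by
    simp only [u, LinearMap.compr₂_apply]
    rw [← hl_rl, rl_tp σ hs hs' σA σB hA hB]
  act_left h hs hA hs' _ _ _ _ _ _ hm hn hi hn' x y p := by
    simp only [u, LinearMap.compr₂_apply]
    rw [← M.act.map_act, act_tp_left h hs hA hs' hm hn hi hn', map_zsmul]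
  act_right h hs hA hs' _ _ _ _ _ _ hm hn hi hn' x y p := by
    simp only [u, LinearMap.compr₂_apply]
    rw [← M.act.map_act, act_tp_right h hs hA hs' hm hn hi hn']
  one x := M.one_act x
  mul h₁ h₂ h₃ h₄ _ _ _ _ _ _ e₁ e₂ e₃ e₄ x y z := M.mul_act h₁ h₂ h₃ h₄ e₁ e₂ e₃ e₄ x y z

variable {M N L}

/-- The components of a morphism of left `U`-modules. -/
def app (f : M ⟶ N) (E : Finset ℕ) (n : ℤ) : M.El E n →ₗ[k] N.El E n := hl f.hom.hom E n

lemma hom_ext_app {f g : M ⟶ N} (h : ∀ E n x, app f E n x = app g E n x) : f = g :=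
  LMod.hom_ext (RMod.hom_ext (DGOperad.hom_ext h))

lemma app_comp (f : M ⟶ N) (g : N ⟶ L) (E : Finset ℕ) (n : ℤ) (x : M.El E n) :
    app (f ≫ g) E n x = app g E n (app f E n x) := rfl

lemma app_dl (f : M ⟶ N) (E : Finset ℕ) (n n' : ℤ) (x : M.El E n) :
    app f E n' (dl M.M.S E n n' x) = dl N.M.S E n n' (app f E n x) := hl_dl _ _ _ _ _

lemma app_rl (f : M ⟶ N) {E E' : Finset ℕ} (σ : E ≃ E') (n : ℤ) (x : M.El E n) :
    app f E' n (rl M.M.S σ n x) = rl N.M.S σ n (app f E n x) := hl_rl _ _ _ _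

lemma app_act (f : M ⟶ N) {E F G : Finset ℕ} {e : ℕ} (h : Subst E e F G) {i j n : ℤ}
    (hn : i + j = n) (m : M.El E i) (p : DGOperad.El P.S F j) :
    app f G n (M.M.α.act h hn m p) = N.M.α.act h hn (app f E i m) p := f.hom.map_act _ _ _ _

lemma app_u (f : M ⟶ N) {A B E : Finset ℕ} (hs : Split A B E) {i j n : ℤ} (hn : i + j = n)
    (x : DGOperad.El U.U.S A i) (y : M.El B j) :
    app f E n (M.u hs hn x y) = N.u hs hn x (app f B j y) := by
  have h := congrArg (fun g => hl g.hom E n (U.U.tp M.M hs hn x y)) f.comm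
  simp only [RMod.hl_comp, RMod.tensorMap_tp] at h
  exact h

/-- A morphism of left `U`-modules from a morphism of right `P`-modules. -/
def homOfRMod (f : M.M ⟶ N.M) (hf : ∀ {A B E : Finset ℕ} (hs : Split A B E) {i j n : ℤ}
    (hn : i + j = n) (x : DGOperad.El U.U.S A i) (y : M.El B j),
    hl f.hom E n (M.u hs hn x y) = N.u hs hn x (hl f.hom B j y)) : M ⟶ N where
  hom := f
  comm := by
    apply RMod.tensor_hom_ext
    intro A B E hs i j n hn x y
    rw [RMod.hl_comp, RMod.hl_comp, RMod.tensorMap_tp]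
    exact hf hs hn x y

/-- A morphism of left `U`-modules from its components. -/
def homMk (f : ∀ E n, M.El E n →ₗ[k] N.El E n)
    (f_d : ∀ E n n' x, n' + 1 = n → f E n' (dl M.M.S E n n' x) = dl N.M.S E n n' (f E n x))
    (f_r : ∀ {E E' : Finset ℕ} (σ : E ≃ E') n x, f E' n (rl M.M.S σ n x) = rl N.M.S σ n (f E n x))
    (f_act : ∀ {E F G : Finset ℕ} {e : ℕ} (h : Subst E e F G) {i j n : ℤ}
      (hn : i + j = n) (m : M.El E i) (p : DGOperad.El P.S F j),
      f G n (M.M.α.act h hn m p) = N.M.α.act h hn (f E i m) p)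
    (f_u : ∀ {A B E : Finset ℕ} (hs : Split A B E) {i j n : ℤ}
      (hn : i + j = n) (x : DGOperad.El U.U.S A i) (y : M.El B j),
      f E n (M.u hs hn x y) = N.u hs hn x (f B j y)) : M ⟶ N :=
  homOfRMod ⟨mkHom f f_d f_r, f_act⟩ f_u

variable (U) in
/-- The functor of elements of arity `E` and degree `n`. -/
def ev (E : Finset ℕ) (n : ℤ) : LMod U ⥤ ModuleCat.{u} k where
  obj M := ModuleCat.of k (M.El E n)
  map f := ModuleCat.ofHom (app f E n)

end LMod

end LeftActions

/-! ### Limits and colimits of left `U`-modules -/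

namespace LMod

variable {P : Operad k} (U : RAlg P)

/-- The differential as a natural transformation. -/
def evD (E : Finset ℕ) (n n' : ℤ) : ev U E n ⟶ ev U E n' where
  app M := ModuleCat.ofHom (dl M.M.S E n n')
  naturality _ _ f := by ext x; exact (app_dl f E n n' x).symm

/-- The relabellings as natural transformations. -/
def evR {E E' : Finset ℕ} (σ : E ≃ E') (n : ℤ) : ev U E n ⟶ ev U E' n where
  app M := ModuleCat.ofHom (rl M.M.S σ n)
  naturality _ _ f := by ext x; exact (app_rl f σ n x).symm

/-- The right action of an element of `P` as a natural transformation. -/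
def evA {E F G : Finset ℕ} {e : ℕ} (h : Subst E e F G) {i j n : ℤ} (hn : i + j = n)
    (p : DGOperad.El P.S F j) : ev U E i ⟶ ev U G n where
  app M := ModuleCat.ofHom ((M.M.α.act h hn).flip p)
  naturality _ _ f := by ext x; exact (app_act f h hn x p).symm

/-- The left action of an element of `U` as a natural transformation. -/
def evU {A B E : Finset ℕ} (hs : Split A B E) {i j n : ℤ} (hn : i + j = n)
    (x : DGOperad.El U.U.S A i) : ev U B j ⟶ ev U E n where
  app M := ModuleCat.ofHom (M.u hs hn x)
  naturality _ _ f := by ext y; exact (app_u f hs hn x y).symm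

/-! ### Transport of the module structure along an additive k-linear functor Ψ -/

section ofFunctor

variable {U} (Ψ : (LMod U ⥤ ModuleCat.{u} k) ⥤ ModuleCat.{u} k)

/-- The map between the values of `Ψ` induced by a natural transformation. -/
def op {G H : LMod U ⥤ ModuleCat.{u} k} (t : G ⟶ H) : Ψ.obj G →ₗ[k] Ψ.obj H := (Ψ.map t).hom

lemma op_id (G : LMod U ⥤ ModuleCat.{u} k) (x : Ψ.obj G) : op Ψ (𝟙 G) x = x := by
  rw [op, Ψ.map_id]; rfl

lemma op_op {G H K : LMod U ⥤ ModuleCat.{u} k} (t : G ⟶ H) (s : H ⟶ K) (x : Ψ.obj G) :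
    op Ψ s (op Ψ t x) = op Ψ (t ≫ s) x := by
  rw [op, op, op, Ψ.map_comp]; rfl

lemma op_zero [Ψ.Additive] {G H : LMod U ⥤ ModuleCat.{u} k} : op Ψ (0 : G ⟶ H) = 0 := by
  rw [op, Ψ.map_zero]; rfl

lemma op_add [Ψ.Additive] {G H : LMod U ⥤ ModuleCat.{u} k} (t s : G ⟶ H) :
    op Ψ (t + s) = op Ψ t + op Ψ s := by
  rw [op, Ψ.map_add]; rfl

lemma op_smul [Ψ.Linear k] {G H : LMod U ⥤ ModuleCat.{u} k} (c : k) (t : G ⟶ H) :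
    op Ψ (c • t) = c • op Ψ t := by
  rw [op, Ψ.map_smul]; rfl

lemma op_zsmul [Ψ.Additive] {G H : LMod U ⥤ ModuleCat.{u} k} (c : ℤ) (t : G ⟶ H) :
    op Ψ (c • t) = c • op Ψ t := by
  rw [op, Ψ.map_zsmul]; rfl

variable [Ψ.Additive] [Ψ.Linear k]

/-- The symmetric sequence with elements `Ψ(ev E n)`. -/
def ofFunctorS : SMod k :=
  mkSMod (fun E n => Ψ.obj (ev U E n)) (fun E n n' => op Ψ (evD U E n n'))
    (fun σ n => op Ψ (evR U σ n))
    -- Here and in the structures below, an axiom is proved as an equation between natural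
    -- transformations. It is checked on the elements of each U-module M, where it is the axiom for
    -- M, and `op` carries it to the values of Ψ.
    (fun E n n' h => by
      rw [← op_zero]
      congr 1
      ext M x
      exact LinearMap.congr_fun (dl_shape M.M.S E h) x)
    (fun E n n' n'' x _ _ => by
      rw [op_op]
      refine (LinearMap.congr_fun (congrArg (op Ψ) ?_) x).trans (LinearMap.congr_fun (op_zero Ψ) x)
      ext M y
      exact dl_dl M.M.S E n n' n'' y)
    (fun E n x => by
      refine (LinearMap.congr_fun (congrArg (op Ψ) ?_) x).trans (op_id Ψ _ x)
      ext M y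
      exact rl_refl M.M.S E n y)
    (fun σ τ n x => by
      rw [op_op]
      refine LinearMap.congr_fun (congrArg (op Ψ) ?_) x
      ext M y
      exact rl_trans M.M.S σ τ n y)
    (fun σ n n' x _ => by
      rw [op_op, op_op]
      refine LinearMap.congr_fun (congrArg (op Ψ) ?_) x
      ext M y
      exact dl_rl M.M.S σ n n' y)

/-- The right `P`-module with elements `Ψ(ev E n)`. -/
def ofFunctorR : RMod P where
  S := ofFunctorS Ψ
  α :=
    { act := fun {E F G e} h {i j n} hn => LinearMap.flip
        { toFun := fun p => op Ψ (evA U h hn p)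
          -- Linearity in p is not an identity between operations with p fixed. It holds because p ↦
          -- `evA U h hn p` is linear and Ψ is additive and k-linear on morphisms.
          map_add' := fun p q => by
            refine Eq.trans (congrArg (op Ψ) ?_) (op_add Ψ (evA U h hn p) (evA U h hn q))
            ext M x
            exact map_add (M.M.α.act h hn x) p q
          map_smul' := fun c p => by
            refine Eq.trans (congrArg (op Ψ) ?_) (op_smul Ψ c (evA U h hn p))
            ext M x
            exact map_smul (M.M.α.act h hn x) c p } }
  isRightAction :=
    { leibniz := fun {E F G e} h {i i' j j' n n'} hi hj hn' hn m p => by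
        refine (op_op Ψ (evA U h hn p) (evD U G n n') m).trans ?_
        have hl : i' + j = n' := by omega
        have hr : i + j' = n' := by omega
        have key (m : Ψ.obj (ev U E i)) : op Ψ (evD U E i i' ≫ evA U h hl p +
            sg i • evA U h hr (dl P.S F j j' p)) m =
            op Ψ (evA U h hl p) (op Ψ (evD U E i i') m) +
              sg i • op Ψ (evA U h hr (dl P.S F j j' p)) m := by
          rw [op_add, op_zsmul, op_op]; rfl
        refine Eq.trans ?_ (key m)
        refine LinearMap.congr_fun (congrArg (op Ψ) ?_) m
        ext M x
        exact M.M.isRightAction.leibniz h hi hj hn' hn x p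
      equivariant := fun h h' σ τ ρ he hg _ _ _ hn m p => by
        refine (op_op Ψ (evA U h hn p) (evR U ρ _) m).trans ?_
        refine Eq.trans ?_ (op_op Ψ (evR U σ _) (evA U h' hn (rl P.S τ _ p)) m).symm
        refine LinearMap.congr_fun (congrArg (op Ψ) ?_) m
        ext M x
        exact M.M.isRightAction.equivariant h h' σ τ ρ he hg hn x p
      assoc_seq := fun h₁ hf h₂ h₃ h₄ _ _ _ _ _ _ hs hn ht hn' m p q => by
        refine (op_op Ψ (evA U h₁ hs p) (evA U h₂ hn q) m).trans ?_
        refine LinearMap.congr_fun (congrArg (op Ψ) (?_ : _ = evA U h₄ hn' _)) m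
        ext M x
        exact M.M.isRightAction.assoc_seq h₁ hf h₂ h₃ h₄ hs hn ht hn' x p q
      assoc_par := fun hef he hf h₁ h₂ h₃ h₄ _ j l _ _ _ hs hn ht hn' m p q => by
        refine (op_op Ψ (evA U h₁ hs p) (evA U h₂ hn q) m).trans ?_
        refine Eq.trans ?_ (congrArg (sg (j * l) • ·)
          (op_op Ψ (evA U h₃ ht q) (evA U h₄ hn' p) m)).symm
        refine Eq.trans ?_ (LinearMap.congr_fun (op_zsmul Ψ (sg (j * l)) _) m)
        refine LinearMap.congr_fun (congrArg (op Ψ) ?_) m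
        ext M x
        exact M.M.isRightAction.assoc_par hef he hf h₁ h₂ h₃ h₄ hs hn ht hn' x p q
      act_one := fun {E e} h _ hi m => by
        refine Eq.trans (?_ : _ = op Ψ (𝟙 _) m) (op_id Ψ _ m)
        refine LinearMap.congr_fun (congrArg (op Ψ) (?_ : evA U h hi (P.one e) = _)) m
        ext M x
        exact M.M.isRightAction.act_one h hi x }

/-- The left action of `U` on the modules `Ψ(ev E n)`. -/
def ofFunctorU : LeftOps U (ofFunctorS Ψ) := fun {A B E} hs {i j n} hn =>
  { toFun := fun x => op Ψ (evU U hs hn x)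
    map_add' := fun x y => by
      refine Eq.trans (congrArg (op Ψ) ?_) (op_add Ψ (evU U hs hn x) (evU U hs hn y))
      ext M z
      exact LinearMap.congr_fun (map_add (M.u hs hn) x y) z
    map_smul' := fun c x => by
      refine Eq.trans (congrArg (op Ψ) ?_) (op_smul Ψ c (evU U hs hn x))
      ext M z
      exact LinearMap.congr_fun (map_smul (M.u hs hn) c x) z }

/-- Fixing x in U turns x · - into a unary operation natural in M, so the axioms transport as for
the right action. The sums and signs on the right-hand sides are handled by additivity of Ψ. -/
lemma isLeftAction_ofFunctorU : IsLeftAction U (ofFunctorR Ψ) (ofFunctorU Ψ) where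
  dl {A B E} hs i i' j j' n n' hn hn' hi hj hl hr x y := by
    refine (op_op Ψ (evU U hs hn x) (evD U E n n') y).trans ?_
    refine Eq.trans ?_ (congrArg (_ + sg i • ·)
      (op_op Ψ (evD U B j j') (evU U hs hr x) y).symm)
    refine Eq.trans ?_ (congrArg (_ + ·) (LinearMap.congr_fun (op_zsmul Ψ (sg i) _) y))
    refine Eq.trans ?_ (LinearMap.congr_fun (op_add Ψ (evU U hs hl (dl U.U.S A i i' x)) _) y)
    refine LinearMap.congr_fun (congrArg (op Ψ) ?_) y
    ext M z
    exact M.isLeftAction.dl hs hn hn' hi hj hl hr x z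
  rl σ hs hs' σA σB hA hB _ _ _ hn x y := by
    refine (op_op Ψ (evU U hs hn x) (evR U σ _) y).trans ?_
    refine Eq.trans ?_ (op_op Ψ (evR U σB _) (evU U hs' hn (DGOperad.rl U.U.S σA _ x)) y).symm
    refine LinearMap.congr_fun (congrArg (op Ψ) ?_) y
    ext M z
    exact M.isLeftAction.rl σ hs hs' σA σB hA hB hn x z
  act_left h hs hA hs' _ j l _ _ _ hm hn hi hn' x y p := by
    refine (op_op Ψ (evU U hs hm x) (evA U h hn p) y).trans ?_
    refine Eq.trans ?_ (LinearMap.congr_fun (op_zsmul Ψ (sg (l * j))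
      (evU U hs' hn' (U.U.α.act hA hi x p))) y)
    refine LinearMap.congr_fun (congrArg (op Ψ) ?_) y
    ext M z
    exact M.isLeftAction.act_left h hs hA hs' hm hn hi hn' x z p
  act_right h hs hB hs' _ _ _ _ _ _ hm hn hj hn' x y p := by
    refine (op_op Ψ (evU U hs hm x) (evA U h hn p) y).trans ?_
    refine Eq.trans ?_ (op_op Ψ (evA U hB hj p) (evU U hs' hn' x) y).symm
    refine LinearMap.congr_fun (congrArg (op Ψ) ?_) y
    ext M z
    exact M.isLeftAction.act_right h hs hB hs' hm hn hj hn' x z p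
  one {A i} y := by
    refine Eq.trans (?_ : _ = op Ψ (𝟙 _) y) (op_id Ψ _ y)
    refine LinearMap.congr_fun (congrArg (op Ψ)
      (?_ : evU U (split_empty_left A) (zero_add i) U.one = _)) y
    ext M z
    exact M.isLeftAction.one z
  mul h₁ h₂ h₃ h₄ _ _ _ _ _ _ e₁ e₂ e₃ e₄ x y z := by
    refine Eq.trans ?_ (op_op Ψ (evU U h₃ e₃ y) (evU U h₄ e₄ x) z).symm
    refine LinearMap.congr_fun (congrArg (op Ψ) (?_ : evU U h₂ e₂ (U.m h₁ e₁ x y) = _)) z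
    ext M w
    exact M.isLeftAction.mul h₁ h₂ h₃ h₄ e₁ e₂ e₃ e₄ x y w

/-- The left `U`-module with elements `Ψ(ev E n)`. -/
def ofFunctor : LMod U := ofAction (isLeftAction_ofFunctorU Ψ)

variable {Ψ} {Ψ' : (LMod U ⥤ ModuleCat.{u} k) ⥤ ModuleCat.{u} k} [Ψ'.Additive] [Ψ'.Linear k]
  {M : LMod U}

lemma u_ofFunctor {A B E : Finset ℕ} (hs : Split A B E) {i j n : ℤ} (hn : i + j = n)
    (x : DGOperad.El U.U.S A i) (y : (ofFunctor Ψ).El B j) :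
    (ofFunctor Ψ).u hs hn x y = op Ψ (evU U hs hn x) y :=
  u_ofAction (isLeftAction_ofFunctorU Ψ) hs hn x y

/-- Morphisms out of `ofFunctor Ψ` from natural families of maps. -/
def fromOfFunctor (φ : Ψ ⟶ (evaluation _ _).obj M) : ofFunctor Ψ ⟶ M :=
  -- Naturality of φ at the transformation t is exactly compatibility with the operation t; applied
  -- to `evD`, `evR`, `evA` and `evU` it gives all the conditions on a morphism.
  have key {G H : LMod U ⥤ ModuleCat.{u} k} (t : G ⟶ H) (x : Ψ.obj G) :
      (φ.app H).hom (op Ψ t x) = (t.app M).hom ((φ.app G).hom x) :=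
    congrArg (fun f => f.hom x) (φ.naturality t)
  homMk (M := ofFunctor Ψ) (fun E n => (φ.app (ev U E n)).hom) (fun E n n' x _ => key _ x)
    (fun σ n x => key _ x) (fun h _ _ _ hn x p => key (evA U h hn p) x)
    (fun hs _ _ _ hn x y => by
      rw [u_ofFunctor]
      exact key (evU U hs hn x) y)

/-- Morphisms into `ofFunctor Ψ` from natural families of maps. -/
def toOfFunctor (φ : (evaluation _ _).obj M ⟶ Ψ) : M ⟶ ofFunctor Ψ :=
  have key {G H : LMod U ⥤ ModuleCat.{u} k} (t : G ⟶ H) (x : G.obj M) :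
      (φ.app H).hom ((t.app M).hom x) = op Ψ t ((φ.app G).hom x) :=
    congrArg (fun f => f.hom x) (φ.naturality t)
  homMk (N := ofFunctor Ψ) (fun E n => (φ.app (ev U E n)).hom)
    (fun E n n' x _ => key (evD U E n n') x)
    (fun σ n x => key (evR U σ n) x) (fun h _ _ _ hn x p => key (evA U h hn p) x)
    (fun hs _ _ _ hn x y => by
      rw [u_ofFunctor]
      exact key (evU U hs hn x) y)

end ofFunctor

/-! ### Limits and colimits in each arity and degree -/

section limits

variable {U} {J : Type u} [Category.{u} J] (F : J ⥤ LMod U)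

/-- `G ↦ lim (F ⋙ G)`. -/
def limΨ : (LMod U ⥤ ModuleCat.{u} k) ⥤ ModuleCat.{u} k := (Functor.whiskeringLeft _ _ _).obj F ⋙ lim

/-- `G ↦ colim (F ⋙ G)`. -/
def colimΨ : (LMod U ⥤ ModuleCat.{u} k) ⥤ ModuleCat.{u} k :=
  (Functor.whiskeringLeft _ _ _).obj F ⋙ colim

/-- The projections from `lim (F ⋙ G)`. -/
def limΨπ (j : J) : limΨ F ⟶ (evaluation _ _).obj (F.obj j) where
  app G := limit.π (F ⋙ G) j
  naturality _ _ t := limMap_π (Functor.whiskerLeft F t) j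

/-- The injections into `colim (F ⋙ G)`. -/
def colimΨι (j : J) : (evaluation _ _).obj (F.obj j) ⟶ colimΨ F where
  app G := colimit.ι (F ⋙ G) j
  naturality _ _ t := (ι_colimMap (Functor.whiskerLeft F t) j).symm

lemma limΨ_hom_ext {X : ModuleCat.{u} k} {G : LMod U ⥤ ModuleCat.{u} k} {f g : X ⟶ (limΨ F).obj G}
    (h : ∀ j, f ≫ (limΨπ F j).app G = g ≫ (limΨπ F j).app G) : f = g :=
  limit.hom_ext h

lemma colimΨ_hom_ext {X : ModuleCat.{u} k} {G : LMod U ⥤ ModuleCat.{u} k}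
    {f g : (colimΨ F).obj G ⟶ X}
    (h : ∀ j, (colimΨι F j).app G ≫ f = (colimΨι F j).app G ≫ g) : f = g :=
  colimit.hom_ext h

instance : (limΨ F).Additive where
  map_add {_ _ f g} := by
    refine limΨ_hom_ext F fun j => ?_
    rw [Preadditive.add_comp, NatTrans.naturality, NatTrans.naturality, NatTrans.naturality]
    exact Preadditive.comp_add _ _ _ _ _ _

instance : (limΨ F).Linear k where
  map_smul {G H} f c := by
    refine limΨ_hom_ext F fun j => ?_
    rw [Linear.smul_comp, NatTrans.naturality, NatTrans.naturality]
    exact Linear.comp_smul _ _ _ _ _ _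

instance : (colimΨ F).Additive where
  map_add {G H f g} := by
    refine colimΨ_hom_ext F fun j => ?_
    rw [Preadditive.comp_add, ← NatTrans.naturality, ← NatTrans.naturality, ← NatTrans.naturality]
    exact Preadditive.add_comp _ _ _ _ _ _

instance : (colimΨ F).Linear k where
  map_smul {G H} f c := by
    refine colimΨ_hom_ext F fun j => ?_
    rw [Linear.comp_smul, ← NatTrans.naturality, ← NatTrans.naturality]
    exact Linear.smul_comp _ _ _ _ _ _

/-- Makes the maps induced by a cone natural in the functor G, so that `toOfFunctor` assembles them
into one morphism of U-modules. The next lemma does the same for cocones and `fromOfFunctor`. -/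
lemma lift_mapCone_naturality (s : Cone F) {G H : LMod U ⥤ ModuleCat.{u} k} (t : G ⟶ H) :
    t.app s.pt ≫ limit.lift (F ⋙ H) (H.mapCone s) =
      limit.lift (F ⋙ G) (G.mapCone s) ≫ limMap (Functor.whiskerLeft F t) := by
  refine limit.hom_ext fun j => ?_
  simp

lemma desc_mapCocone_naturality (s : Cocone F) {G H : LMod U ⥤ ModuleCat.{u} k} (t : G ⟶ H) :
    colimMap (Functor.whiskerLeft F t) ≫ colimit.desc (F ⋙ H) (H.mapCocone s) =
      colimit.desc (F ⋙ G) (G.mapCocone s) ≫ t.app s.pt := by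
  refine colimit.hom_ext fun j => ?_
  simp

/-- The limit cone of a diagram of left `U`-modules. -/
def limCone : Cone F where
  pt := ofFunctor (limΨ F)
  π :=
    { app := fun j => fromOfFunctor (limΨπ F j)
      naturality := fun i j f => by
        refine hom_ext_app fun E n x => ?_
        exact congrArg (fun f => f.hom x) (limit.w (F ⋙ ev U E n) f).symm }

/-- The universal property of the limit cone. -/
def limConeIsLimit : IsLimit (limCone F) where
  lift s := toOfFunctor (Ψ := limΨ F)
    { app := fun G => limit.lift (F ⋙ G) (G.mapCone s)
      naturality := fun _ _ t => lift_mapCone_naturality F s t }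
  fac s j := by
    refine hom_ext_app fun E n x => ?_
    exact congrArg (fun f => f.hom x) (limit.lift_π ((ev U E n).mapCone s) j)
  uniq s m h := by
    refine hom_ext_app fun E n x => ?_
    -- Uniqueness is tested separately in each arity and degree, against the limit of modules there.
    refine LinearMap.congr_fun (congrArg ModuleCat.Hom.hom
      ((limit.isLimit (F ⋙ ev U E n)).uniq ((ev U E n).mapCone s) ((ev U E n).map m)
        fun j => congrArg (ev U E n).map (h j))) x

/-- The colimit cocone of a diagram of left `U`-modules. -/
def colimCocone : Cocone F where
  pt := ofFunctor (colimΨ F)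
  ι :=
    { app := fun j => toOfFunctor (colimΨι F j)
      naturality := fun i j f => by
        refine hom_ext_app fun E n x => ?_
        exact congrArg (fun f => f.hom x) (colimit.w (F ⋙ ev U E n) f) }

/-- The universal property of the colimit cocone. -/
def colimCoconeIsColimit : IsColimit (colimCocone F) where
  desc s := fromOfFunctor (Ψ := colimΨ F)
    { app := fun G => colimit.desc (F ⋙ G) (G.mapCocone s)
      naturality := fun _ _ t => desc_mapCocone_naturality F s t }
  fac s j := by
    refine hom_ext_app fun E n x => ?_
    exact congrArg (fun f => f.hom x) (colimit.ι_desc ((ev U E n).mapCocone s) j)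
  uniq s m h := by
    refine hom_ext_app fun E n x => ?_
    refine LinearMap.congr_fun (congrArg ModuleCat.Hom.hom
      ((colimit.isColimit (F ⋙ ev U E n)).uniq ((ev U E n).mapCocone s) ((ev U E n).map m)
        fun j => congrArg (ev U E n).map (h j))) x

instance : HasLimitsOfSize.{u, u} (LMod U) where
  has_limits_of_shape _ := ⟨fun F => ⟨⟨⟨limCone F, limConeIsLimit F⟩⟩⟩⟩

instance : HasColimitsOfSize.{u, u} (LMod U) where
  has_colimits_of_shape _ := ⟨fun F => ⟨⟨⟨colimCocone F, colimCoconeIsColimit F⟩⟩⟩⟩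

/-- The image of `colimCocone F` under evaluation is, by construction, the colimit cocone of
modules. The smallness of the generators rests on this. -/
instance (E : Finset ℕ) (n : ℤ) : PreservesColimitsOfSize.{u, u} (ev U E n) where
  preservesColimitsOfShape :=
    { preservesColimit := fun {F} =>
        preservesColimit_of_preserves_colimit_cocone (colimCoconeIsColimit F)
          (colimit.isColimit (F ⋙ ev U E n)) }

end limits

end LMod

/-! ### Modules of homomorphisms out of a dg module -/

/-- The pairs of degrees of the components of a map of degree `n`. -/
structure HomIdx (n : ℤ) where
  /-- the degree in the source -/
  i : ℤ
  /-- the degree in the target -/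
  m : ℤ
  deg : i + n = m

/-- `Hom(C, M)(E)_n`: the families of linear maps `C_i → M(E)_{i+n}`. -/
abbrev HX (C : DGMod k) (M : SMod k) (E : Finset ℕ) (n : ℤ) : Type u :=
  ∀ x : HomIdx n, C.X x.i →ₗ[k] El M E x.m

section HX

variable {C : DGMod k} {M : SMod k} {E : Finset ℕ} {n : ℤ}

/-- The components of an element of `Hom(C, M)`. -/
def hap {i m : ℤ} (h : i + n = m) : HX C M E n →ₗ[k] C.X i →ₗ[k] El M E m :=
  LinearMap.proj (φ := fun x : HomIdx n => C.X x.i →ₗ[k] El M E x.m) ⟨i, m, h⟩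

lemma HX.ext {φ ψ : HX C M E n}
    (h : ∀ {i m : ℤ} (h : i + n = m) (c : C.X i), hap h φ c = hap h ψ c) : φ = ψ :=
  funext fun x => LinearMap.ext fun c => h x.deg c

variable (C M)

/-- The differential `(dψ)(c) = (-1)^{|c|} (d(ψ(c)) - ψ(dc))`. -/
def HX.d (E : Finset ℕ) (n n' : ℤ) : HX C M E n →ₗ[k] HX C M E n' :=
  -- The sign is forced by the adjunction with C on the left. If ψ(y)(c) = f(c ⊗ y), then d(c ⊗ y) =
  -- dc ⊗ y + (-1)^{|c|} c ⊗ dy gives f(c ⊗ dy) = (-1)^{|c|} (d f(c ⊗ y) - f(dc ⊗ y)).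
  if h : n' + 1 = n then
    { toFun := fun ψ x => sg x.i •
        ((dl M E (x.m + 1) x.m).comp (hap (by have := x.deg; omega) ψ) -
          (hap (by have := x.deg; omega) ψ).comp (C.d x.i (x.i - 1)).hom)
      map_add' := fun φ ψ => by
        ext x c
        simp only [map_add, LinearMap.comp_add, LinearMap.add_comp, Pi.add_apply,
          LinearMap.smul_apply, LinearMap.add_apply, LinearMap.sub_apply, ← smul_add]
        congr 1
        abel
      map_smul' := fun a ψ => by
        ext x c
        simp only [map_smul, LinearMap.comp_smul, LinearMap.smul_comp, Pi.smul_apply,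
          LinearMap.smul_apply, LinearMap.sub_apply, RingHom.id_apply, ← smul_sub]
        rw [smul_comm] }
  else 0

/-- The relabellings of `Hom(C, M)`. -/
def HX.r {E E' : Finset ℕ} (σ : E ≃ E') (n : ℤ) : HX C M E n →ₗ[k] HX C M E' n where
  toFun ψ x := (rl M σ x.m).comp (ψ x)
  map_add' φ ψ := by ext x c; simp
  map_smul' a ψ := by ext x c; simp

variable {C M}

/-- All the degrees are free variables constrained by equations, so that later computations choose
them and discharge the constraints by arithmetic, not by casts. -/
lemma hap_d {i i' m m' n' : ℤ} (hn : n' + 1 = n) (hi : i' + 1 = i) (hm : m' + 1 = m)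
    (h : i + n' = m') (h₁ : i + n = m) (h₂ : i' + n = m') (ψ : HX C M E n) (c : C.X i) :
    hap h (HX.d C M E n n' ψ) c =
      sg i • (dl M E m m' (hap h₁ ψ c) - hap h₂ ψ ((C.d i i').hom c)) := by
  obtain rfl : i' = i - 1 := by omega
  subst hm
  rw [HX.d, dif_pos hn]
  rfl

lemma hap_r {E' : Finset ℕ} (σ : E ≃ E') {i m : ℤ} (h : i + n = m) (ψ : HX C M E n) (c : C.X i) :
    hap h (HX.r C M σ n ψ) c = rl M σ m (hap h ψ c) := rfl

variable (C M) in
/-- The `Σ_*`-module `Hom(C, M)`. -/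
def homS : SMod k :=
  mkSMod (HX C M) (HX.d C M) (fun σ n => HX.r C M σ n)
    (fun E n n' h => by rw [HX.d, dif_neg h])
    (fun E n n' n'' ψ h h' => by
      -- Only the two terms d(ψ(dc)) survive, one with the sign of degree i and one with that of
      -- degree i - 1, and these cancel.
      refine HX.ext fun {i m} hi c => ?_
      have hc : (C.d (i - 1) (i - 1 - 1)).hom ((C.d i (i - 1)).hom c) = 0 :=
        congrArg (fun f => f.hom c) (C.d_comp_d i (i - 1) (i - 1 - 1))
      rw [hap_d h' (i' := i - 1) (m := m + 1) (by omega) rfl hi (by omega) (by omega),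
        hap_d h (i' := i - 1) (m := m + 1 + 1) (by omega) rfl (by omega) (by omega) (by omega),
        hap_d h (i' := i - 1 - 1) (m := m + 1) (by omega) rfl (by omega) (by omega) (by omega),
        map_zsmul, map_sub, dl_dl, hc, map_zero, sg_pred (i' := i - 1) (i := i) (by omega)]
      simp)
    (fun E n ψ => HX.ext fun {i m} hi c => rl_refl M E m (hap hi ψ c))
    (fun σ τ n ψ => HX.ext fun {i m} hi c => rl_trans M σ τ m (hap hi ψ c))
    (fun {E E'} σ n n' ψ h => by
      refine HX.ext fun {i m} hi c => ?_
      rw [hap_r, hap_d h (i' := i - 1) (m := m + 1) (by omega) rfl hi (by omega) (by omega),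
        hap_d h (i' := i - 1) (m := m + 1) (by omega) rfl hi (by omega) (by omega),
        hap_r, hap_r, dl_rl, map_zsmul, map_sub])

/-- The components of an element of the `Σ_*`-module `Hom(C, M)`. -/
def hp {i m : ℤ} (h : i + n = m) : El (homS C M) E n →ₗ[k] C.X i →ₗ[k] El M E m :=
  hap h

lemma homS_ext {φ ψ : El (homS C M) E n}
    (h : ∀ {i m : ℤ} (h : i + n = m) (c : C.X i), hp h φ c = hp h ψ c) : φ = ψ :=
  HX.ext h

lemma hp_dl {i i' m m' n' : ℤ} (hn : n' + 1 = n) (hi : i' + 1 = i) (hm : m' + 1 = m)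
    (h : i + n' = m') (h₁ : i + n = m) (h₂ : i' + n = m') (ψ : El (homS C M) E n) (c : C.X i) :
    hp h (dl (homS C M) E n n' ψ) c =
      sg i • (dl M E m m' (hp h₁ ψ c) - hp h₂ ψ ((C.d i i').hom c)) :=
  hap_d hn hi hm h h₁ h₂ ψ c

lemma hp_rl {E' : Finset ℕ} (σ : E ≃ E') {i m : ℤ} (h : i + n = m) (ψ : El (homS C M) E n)
    (c : C.X i) : hp h (rl (homS C M) σ n ψ) c = rl M σ m (hp h ψ c) := rfl

/-- An element of `Hom(C, M)` from its components. -/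
def hmk (f : ∀ {i m : ℤ}, i + n = m → (C.X i →ₗ[k] El M E m)) : El (homS C M) E n :=
  fun x : HomIdx n => f x.deg

lemma hp_hmk (f : ∀ {i m : ℤ}, i + n = m → (C.X i →ₗ[k] El M E m)) {i m : ℤ} (h : i + n = m) :
    hp h (hmk (C := C) f) = f h := rfl

end HX

/-! ### The right P-action on Hom(C, M) -/

section homR

variable {P : Operad k} (C : DGMod k) (M : RMod P)

/-- The right action `(ψ ∘_e p)(c) = ψ(c) ∘_e p`. -/
def homA : PartialComp (homS C M.S) P.S where
  act {E F G e} h {i j n} hn :=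
    LinearMap.mk₂ k (fun ψ p => hmk fun {a m} ha =>
        ((M.α.act h (i := m - j) (by omega)).flip p).comp (hp (by omega) ψ))
      (fun φ ψ p => homS_ext fun _ c => by
        simp only [hp_hmk, map_add, LinearMap.comp_apply, LinearMap.add_apply])
      (fun a ψ p => homS_ext fun _ c => by
        simp only [hp_hmk, map_smul, LinearMap.comp_apply, LinearMap.smul_apply])
      (fun ψ p q => homS_ext fun _ c => by
        simp only [hp_hmk, map_add, LinearMap.comp_apply, LinearMap.add_apply])
      (fun a ψ p => homS_ext fun _ c => by
        simp only [hp_hmk, map_smul, LinearMap.comp_apply, LinearMap.smul_apply])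

variable {C M}

lemma hp_act {E F G : Finset ℕ} {e : ℕ} (h : Subst E e F G) {i j n : ℤ} (hn : i + j = n)
    {a m m' : ℤ} (ha : a + n = m) (ha' : a + i = m') (hm : m' + j = m)
    (ψ : El (homS C M.S) E i) (p : El P.S F j) (c : C.X a) :
    hp ha ((homA C M).act h hn ψ p) c = M.α.act h hm (hp ha' ψ c) p := by
  obtain rfl : m' = m - j := by omega
  rfl

variable (C M) in
/-- The right `P`-module `Hom(C, M)`. -/
abbrev homR : RMod P where
  S := homS C M.S
  α := homA C M
  isRightAction :=
    { leibniz := fun {E F G e} h {i i' j j' n n'} hi hj hn' hn ψ p => by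
        refine homS_ext fun {a m} ha c => ?_
        rw [hp_dl hn' (i' := a - 1) (m := m + 1) (by omega) rfl ha (by omega) (by omega),
          hp_act h hn _ (m' := a + i) rfl (by omega),
          hp_act h hn _ (m' := a - 1 + i) rfl (by omega),
          M.isRightAction.leibniz h (i' := a + i') (by omega) hj rfl (by omega),
          map_add, LinearMap.add_apply, map_zsmul, LinearMap.smul_apply,
          hp_act h _ ha (m' := a + i') rfl (by omega),
          hp_act h _ ha (m' := a + i) rfl (by omega),
          hp_dl hi (i' := a - 1) (m := a + i) (by omega) (by omega) rfl rfl (by omega),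
          map_zsmul, map_sub, sg_add]
        -- The same intermediate degree occurs as a - 1 + i on one side and as a + i' on the other;
        -- `e` replaces one expression by the other.
        have e : ∀ {s t : ℤ} (hs : s = t) (h₁ : s + j = m) (h₂ : t + j = m)
            (hs' : a - 1 + i = s) (ht' : a - 1 + i = t) (x : C.X (a - 1)),
            M.α.act h h₁ (hp hs' ψ x) p = M.α.act h h₂ (hp ht' ψ x) p := by
          rintro s _ rfl _ _ _ _ _; rfl
        rw [e (show a - 1 + i = a + i' by omega) (by omega) (by omega) rfl (by omega)]
        simp only [LinearMap.sub_apply, LinearMap.smul_apply, smul_sub, smul_add, smul_smul]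
        rw [← mul_assoc, sg_mul_self, one_mul]
        abel
      equivariant := fun h h' σ τ ρ he hg i _ _ hn ψ p => by
        refine homS_ext fun {a m} ha c => ?_
        rw [hp_rl, hp_act h hn ha (m' := a + i) rfl (by omega),
          hp_act h' hn ha (m' := a + i) rfl (by omega), hp_rl,
          M.isRightAction.equivariant h h' σ τ ρ he hg]
      assoc_seq := fun h₁ hf h₂ h₃ h₄ i _ _ s _ _ hs hn ht hn' ψ p q => by
        refine homS_ext fun {a m} ha c => ?_
        rw [hp_act h₂ hn ha (m' := a + s) rfl (by omega),
          hp_act h₁ hs _ (m' := a + i) rfl (by omega),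
          hp_act h₄ hn' ha (m' := a + i) rfl (by omega),
          M.isRightAction.assoc_seq h₁ hf h₂ h₃ h₄ _ _ ht]
      assoc_par := fun hef he hf h₁ h₂ h₃ h₄ i _ _ s t _ hs hn ht hn' ψ p q => by
        refine homS_ext fun {a m} ha c => ?_
        rw [hp_act h₂ hn ha (m' := a + s) rfl (by omega),
          hp_act h₁ hs _ (m' := a + i) rfl (by omega), map_zsmul, LinearMap.smul_apply,
          hp_act h₄ hn' ha (m' := a + t) rfl (by omega),
          hp_act h₃ ht _ (m' := a + i) rfl (by omega),
          M.isRightAction.assoc_par hef he hf h₁ h₂ h₃ h₄]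
      act_one := fun {E e} h i hi ψ => by
        refine homS_ext fun {a m} ha c => ?_
        rw [hp_act h hi ha (m' := m) (by omega) (by omega), M.isRightAction.act_one] }

end homR

/-! ### The left U-action on Hom(C, M) -/

section homL

variable {P : Operad k} {U : RAlg P} (C : DGMod k) (M : LMod U)

/-- The left action `(x · ψ)(c) = (-1)^{|x||c|} x · ψ(c)`. -/
def homU : LeftOps U (homS C M.M.S) := fun {A B E} hs {i j n} hn =>
  LinearMap.mk₂ k (fun x ψ => hmk fun {a m} ha => sg (i * a) •
      (M.u hs (j := m - i) (by omega) x).comp (hp (by omega) ψ))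
    (fun φ ψ p => homS_ext fun _ c => by
      simp only [hp_hmk, map_add, LinearMap.comp_apply, LinearMap.smul_apply, LinearMap.add_apply,
        smul_add])
    (fun a ψ p => homS_ext fun _ c => by
      simp only [hp_hmk, map_smul, LinearMap.comp_apply, LinearMap.smul_apply]
      rw [smul_comm])
    (fun ψ p q => homS_ext fun _ c => by
      simp only [hp_hmk, map_add, LinearMap.comp_apply, LinearMap.smul_apply, LinearMap.add_apply,
        smul_add])
    (fun a ψ p => homS_ext fun _ c => by
      simp only [hp_hmk, map_smul, LinearMap.comp_apply, LinearMap.smul_apply]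
      rw [smul_comm])

variable {C M}

lemma hp_homU {A B E : Finset ℕ} (hs : Split A B E) {i j n : ℤ} (hn : i + j = n)
    {a m m' : ℤ} (ha : a + n = m) (ha' : a + j = m') (hm : i + m' = m)
    (x : El U.U.S A i) (ψ : El (homS C M.M.S) B j) (c : C.X a) :
    hp ha (homU C M hs hn x ψ) c = sg (i * a) • M.u hs hm x (hp ha' ψ c) := by
  obtain rfl : m' = m - i := by omega
  rfl

/-- Each axiom is that of M evaluated at c. The Koszul sign for moving x past c, together with the
sign in the differential of Hom(C, M), makes the remaining signs agree. -/
lemma isLeftAction_homU : IsLeftAction U (homR C M.M) (homU C M) where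
  dl {A B E} hs i i' j j' n n' hn hn' hi hj hl hr x ψ := by
    refine homS_ext fun {a m} ha c => ?_
    refine (hp_dl hn' (i' := a - 1) (m := m + 1) (by omega) rfl ha (by omega) (by omega)
      (homU C M hs hn x ψ) c).trans ?_
    rw [hp_homU hs hn _ (m' := a + j) rfl (by omega),
      hp_homU hs hn _ (m' := a + j') (by omega) (by omega), map_zsmul,
      M.isLeftAction.dl hs _ rfl hi (j' := a + j') (by omega) (by omega) (by omega)]
    have e1 := hp_homU hs hl ha (m' := a + j) rfl (by omega) (dl U.U.S A i i' x) ψ c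
    have e2 := hp_homU hs hr ha (m' := a + j') rfl (by omega) x (dl (homS C M.M.S) B j j' ψ) c
    rw [hp_dl hj (i' := a - 1) (m := a + j) (by omega) (by omega) rfl rfl (by omega)] at e2
    refine Eq.trans ?_ (congrArg₂ (· + sg i • ·) e1 e2).symm
    simp only [map_zsmul, map_sub, smul_sub, smul_add, smul_smul, ← sg_add]
    -- The exponents on the two sides agree modulo 2; in `s3` they are equal outright.
    have s1 : sg (i' * a) = sg (a + i * a) := sg_congr ⟨-a, by rw [← hi]; ring⟩
    have s2 : sg (a + i * (a - 1)) = sg (i + (i * a + a)) :=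
      sg_congr ⟨-i, by ring⟩
    have s3 : sg (a + (i * a + i)) = sg (i + (i * a + a)) := by congr 1; ring
    rw [s1, s2, s3]
    abel
  rl σ hs hs' σA σB hA hB i j n hn x ψ := by
    refine homS_ext fun {a m} ha c => ?_
    refine (congrArg (rl M.M.S σ m)
      (hp_homU hs hn ha (m' := a + j) rfl (by omega) x ψ c)).trans ?_
    refine Eq.trans ?_ (hp_homU hs' hn ha (m' := a + j) rfl (by omega) (DGOperad.rl U.U.S σA _ x)
      (DGOperad.rl (homS C M.M.S) σB _ ψ) c).symm
    rw [map_zsmul, M.isLeftAction.rl σ hs hs' σA σB hA hB, hp_rl]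
  act_left h hs hA hs' i j l m i' n hm hn hi hn' x ψ p := by
    refine homS_ext fun {a t} ha c => ?_
    refine (hp_act h hn ha (m' := a + m) rfl (by omega) (homU C M hs hm x ψ) p c).trans ?_
    rw [hp_homU hs hm _ (m' := a + j) rfl (by omega), map_zsmul, LinearMap.smul_apply,
      M.isLeftAction.act_left h hs hA hs' _ _ hi (by omega)]
    refine Eq.trans ?_ (congrArg (sg (l * j) • ·) (hp_homU hs' hn' ha (m' := a + j) rfl (by omega)
      (U.U.α.act hA hi x p) ψ c)).symm
    simp only [smul_smul, ← sg_add]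
    congr 2
    rw [← hi]
    ring
  act_right h hs hB hs' i j l m j' n hm hn hj hn' x ψ p := by
    refine homS_ext fun {a t} ha c => ?_
    refine (hp_act h hn ha (m' := a + m) rfl (by omega) (homU C M hs hm x ψ) p c).trans ?_
    rw [hp_homU hs hm _ (m' := a + j) rfl (by omega), map_zsmul, LinearMap.smul_apply,
      M.isLeftAction.act_right h hs hB hs' (j' := a + j') _ _ (by omega) (by omega)]
    refine Eq.trans ?_ (hp_homU hs' hn' ha (m' := a + j') rfl (by omega) x
      ((homA C M.M).act hB hj ψ p) c).symm
    rw [hp_act hB hj _ (m' := a + j) rfl (by omega)]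
  one {A i} ψ := by
    refine homS_ext fun {a m} ha c => ?_
    refine (hp_homU (split_empty_left A) (zero_add i) ha (m' := m) (by omega) (by omega)
      U.one ψ c).trans ?_
    rw [M.isLeftAction.one, zero_mul]
    simp [sg]
  mul h₁ h₂ h₃ h₄ i j l ij jl n e₁ e₂ e₃ e₄ x y ψ := by
    refine homS_ext fun {a m} ha c => ?_
    refine (hp_homU h₂ e₂ ha (m' := a + l) rfl (by omega) (U.m h₁ e₁ x y) ψ c).trans ?_
    refine Eq.trans ?_ (hp_homU h₄ e₄ ha (m' := a + jl) rfl (by omega) x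
      (homU C M h₃ e₃ y ψ) c).symm
    rw [hp_homU h₃ e₃ _ (m' := a + l) rfl (by omega), map_zsmul, smul_smul, ← sg_add,
      M.isLeftAction.mul h₁ h₂ h₃ h₄ e₁ _ (jl := a + jl) (by omega) (by omega)]
    congr 2
    rw [← e₁]
    ring

variable (C M) in
/-- The left `U`-module `Hom(C, M)`. -/
def homL : LMod U := LMod.ofAction (isLeftAction_homU (C := C) (M := M))

lemma hp_u {A B E : Finset ℕ} (hs : Split A B E) {i j n : ℤ} (hn : i + j = n)
    {a m m' : ℤ} (ha : a + n = m) (ha' : a + j = m') (hm : i + m' = m)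
    (x : El U.U.S A i) (ψ : El (homS C M.M.S) B j) (c : C.X a) :
    hp ha (show El (homS C M.M.S) E n from (homL C M).u hs hn x ψ) c =
      sg (i * a) • M.u hs hm x (hp ha' ψ c) := by
  rw [← hp_homU hs hn ha ha' hm x ψ c]
  exact congrArg (fun ψ => hp ha ψ c) (LMod.u_ofAction isLeftAction_homU hs hn x ψ)

end homL

/-! ### Tensor products with dg modules -/

section const

variable {C : DGMod k} {P : Operad k}

/-- The elements of arity `∅` of `C`. -/
def cst (i : ℤ) : C.X i →ₗ[k] El (constR P C).S ∅ i where
  toFun c := (fun _ => c : PLift (∅ = ∅) → C.X i)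
  map_add' _ _ := rfl
  map_smul' _ _ := rfl

variable {N : RMod P}

/-- The element `c ⊗ y` of `C ⊗ N`. -/
def ctp {E : Finset ℕ} {i j n : ℤ} (hn : i + j = n) :
    C.X i →ₗ[k] El N.S E j →ₗ[k] El ((constR P C).tensor N).S E n :=
  ((constR P C).tp N (split_empty_left E) hn).comp (cst i)

/-- Since C vanishes in nonempty arities, only the summand of the decomposition E = ∅ ⊔ E
contributes, and C ⊗ N is generated by the elements c ⊗ y with y in N(E). -/
lemma ctp_ind {E : Finset ℕ} {n : ℤ} {p : El ((constR P C).tensor N).S E n → Prop} (h0 : p 0)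
    (hadd : ∀ x y, p x → p y → p (x + y))
    (hpt : ∀ {i j : ℤ} (hn : i + j = n) (c : C.X i) (y : El N.S E j), p (ctp hn c y))
    (x : El ((constR P C).tensor N).S E n) : p x := by
  refine tp_ind h0 hadd (fun {A B} h {i j} hn a y => ?_) x
  rcases A.eq_empty_or_nonempty with rfl | hA
  · obtain rfl : B = E := by simpa using h.2
    exact hpt hn ((show PLift ((∅ : Finset ℕ) = ∅) → C.X i from a) ⟨rfl⟩) y
  · have : a = 0 := (subsingleton_constS C hA i).elim _ _
    rw [this, map_zero, LinearMap.zero_apply]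
    exact h0

lemma dl_ctp {E : Finset ℕ} {i i' j j' n n' : ℤ} (hn : i + j = n)
    (h : n' + 1 = n) (hi : i' + 1 = i) (hj : j' + 1 = j) (hl : i' + j = n') (hr : i + j' = n')
    (c : C.X i) (y : El N.S E j) :
    dl ((constR P C).tensor N).S E n n' (ctp hn c y) =
      ctp hl ((C.d i i').hom c) y + sg i • ctp hr c (dl N.S E j j' y) :=
  dl_tp (split_empty_left E) hn h hi hj (cst i c) y

lemma rl_ctp {E E' : Finset ℕ} (σ : E ≃ E') {i j n : ℤ} (hn : i + j = n) (c : C.X i)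
    (y : El N.S E j) :
    rl ((constR P C).tensor N).S σ n (ctp hn c y) = ctp hn c (rl N.S σ j y) :=
  rl_tp σ (split_empty_left E) (split_empty_left E') (Equiv.refl (∅ : Finset ℕ)) σ
    (fun x hx => absurd hx (Finset.notMem_empty x)) (fun _ _ _ => rfl) hn (cst i c) y

lemma act_ctp {E F G : Finset ℕ} {e : ℕ} (h : Subst E e F G) {i j l m t n : ℤ} (hi : i + j = m)
    (hn : m + l = n) (ht : j + l = t) (hn' : i + t = n) (c : C.X i) (y : El N.S E j)
    (p : El P.S F l) :
    ((constR P C).tensor N).α.act h hn (ctp hi c y) p = ctp hn' c (N.α.act h ht y p) :=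
  act_tp_right h (split_empty_left E) h (split_empty_left G) hi hn ht hn' (cst i c) y p

variable {L : RMod P}

/-- Equal arities have equal modules of elements. -/
def castEl (M : SMod k) {B E : Finset ℕ} (h : B = E) (n : ℤ) : El M B n →ₗ[k] El M E n :=
  h ▸ LinearMap.id

/-- The linear maps `c ⊗ y ↦ ψ(y)(c)`. -/
def uncurryL (ψ : N ⟶ homR C L) (E : Finset ℕ) (n : ℤ) :
    El ((constR P C).tensor N).S E n →ₗ[k] El L.S E n :=
  (constR P C).tpLift N fun A B i j hs hn =>
    open scoped Classical in
    if h : A = ∅ then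
      -- The second part equals E only propositionally, so the value has to be moved from arity B to
      -- arity E by `castEl`; for B = E definitionally this disappears, as in `uncurryL_ctp`.
      have hB : B = E := by simpa [h] using hs.2
      LinearMap.mk₂ k (fun x y => castEl L.S hB n (hp hn (hl ψ.hom B j y)
          ((show PLift (A = ∅) → C.X i from x) ⟨h⟩)))
        (fun x x' y => by
          rw [← map_add, ← map_add]; rfl)
        (fun a x y => by
          rw [← map_smul, ← map_smul]; rfl)
        (fun x y y' => by simp only [map_add, LinearMap.add_apply])
        (fun a x y => by simp only [map_smul, LinearMap.smul_apply])
    else 0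

lemma uncurryL_ctp (ψ : N ⟶ homR C L) {E : Finset ℕ} {i j n : ℤ} (hn : i + j = n) (c : C.X i)
    (y : El N.S E j) : uncurryL ψ E n (ctp hn c y) = hp hn (hl ψ.hom E j y) c := by
  rw [uncurryL, ctp, LinearMap.comp_apply, tpLift_tp, dif_pos rfl]
  rfl

/-- The morphism `C ⊗ N ⟶ L` which corresponds to `N ⟶ Hom(C, L)`. -/
def uncurry (ψ : N ⟶ homR C L) : (constR P C).tensor N ⟶ L where
  hom := mkHom (M := ((constR P C).tensor N).S) (uncurryL ψ)
    (fun E n n' x h => by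
      induction x using ctp_ind with
      | h0 => simp only [map_zero]
      | hadd x y hx hy => simp only [map_add, hx, hy]
      | @hpt i j hn c y =>
        rw [dl_ctp hn h (i' := i - 1) (j' := j - 1) (by omega) (by omega) (by omega) (by omega),
          map_add, map_zsmul, uncurryL_ctp, uncurryL_ctp, uncurryL_ctp, hl_dl,
          hp_dl (i' := i - 1) (m := n) (by omega) (by omega) h _ hn (by omega), smul_smul,
          sg_mul_self, one_smul, add_sub_cancel])
    (fun σ n x => by
      induction x using ctp_ind with
      | h0 => simp only [map_zero]
      | hadd x y hx hy => simp only [map_add, hx, hy]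
      | @hpt i j hn c y =>
        rw [rl_ctp, uncurryL_ctp, uncurryL_ctp, hl_rl, hp_rl])
  map_act {E F G e} h {i j n} hn m p := by
    rw [hl_mkHom, hl_mkHom]
    induction m using ctp_ind with
    | h0 => simp only [map_zero, LinearMap.zero_apply]
    | hadd x y hx hy => simp only [map_add, LinearMap.add_apply, hx, hy]
    | @hpt a b hi c y =>
      rw [act_ctp h hi hn rfl (by omega), uncurryL_ctp, uncurryL_ctp, ψ.map_act,
        hp_act h _ _ hi hn]

lemma hl_uncurry (ψ : N ⟶ homR C L) {E : Finset ℕ} {i j n : ℤ} (hn : i + j = n) (c : C.X i)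
    (y : El N.S E j) : hl (uncurry ψ).hom E n (ctp hn c y) = hp hn (hl ψ.hom E j y) c :=
  uncurryL_ctp ψ hn c y

/-- The linear maps `y ↦ (c ↦ f(c ⊗ y))`. -/
def curryL (f : (constR P C).tensor N ⟶ L) (E : Finset ℕ) (n : ℤ) :
    El N.S E n →ₗ[k] El (homS C L.S) E n where
  toFun y := hmk fun {_ m} h => (hl f.hom E m).comp ((ctp h).flip y)
  map_add' x y := homS_ext fun h c => by
    simp only [hp_hmk, map_add, LinearMap.comp_apply, LinearMap.add_apply]
  map_smul' a x := homS_ext fun h c => by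
    simp only [hp_hmk, map_smul, LinearMap.comp_apply, LinearMap.smul_apply, RingHom.id_apply]

lemma hp_curryL (f : (constR P C).tensor N ⟶ L) {E : Finset ℕ} {i j n : ℤ} (hn : i + j = n)
    (c : C.X i) (y : El N.S E j) : hp hn (curryL f E j y) c = hl f.hom E n (ctp hn c y) := rfl

/-- The morphism `N ⟶ Hom(C, L)` which corresponds to `C ⊗ N ⟶ L`. -/
def curry (f : (constR P C).tensor N ⟶ L) : N ⟶ homR C L where
  hom := mkHom (N := homS C L.S) (curryL f)
    (fun E n n' y h => homS_ext fun {i m} hi c => by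
      rw [hp_dl h (i' := i - 1) (m := m + 1) (by omega) rfl hi (by omega) (by omega), hp_curryL,
        hp_curryL, hp_curryL, ← hl_dl,
        dl_ctp _ rfl (i' := i - 1) (j' := n') (by omega) h (by omega) hi, map_add,
        map_zsmul, add_sub_cancel_left, smul_smul, sg_mul_self, one_smul])
    (fun σ n y => homS_ext fun {i m} hi c => by
      rw [hp_rl, hp_curryL, hp_curryL, ← hl_rl, rl_ctp])
  map_act {E F G e} h {i j n} hn y p := by
    have key : curryL f G n (N.α.act h hn y p) = (homA C L).act h hn (curryL f E i y) p :=
      homS_ext fun {a m} ha c => by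
        rw [hp_act h hn ha (m' := a + i) rfl (by omega), hp_curryL, hp_curryL, ← f.map_act,
          act_ctp h rfl _ hn ha]
    exact key

lemma hp_curry (f : (constR P C).tensor N ⟶ L) {E : Finset ℕ} {i j n : ℤ} (hn : i + j = n)
    (c : C.X i) (y : El N.S E j) :
    hp hn (hl (curry f).hom E j y) c = hl f.hom E n (ctp hn c y) := rfl

/-- The components of `curry f` are the values of f on the elements c ⊗ y, which generate C ⊗ N. -/
lemma curry_injective {f g : (constR P C).tensor N ⟶ L} (h : curry f = curry g) : f = g := by
  apply RMod.hom_ext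
  apply DGOperad.hom_ext
  intro E n x
  induction x using ctp_ind with
  | h0 => simp only [map_zero]
  | hadd x y hx hy => simp only [map_add, hx, hy]
  | hpt hn c y => rw [← hp_curry, ← hp_curry, h]

end const

/-! ### The universal property of free left modules -/

section freeLeft

variable {P : Operad k} {U : RAlg P} {N : RMod P} {M : LMod U}

variable (U N) in
/-- The morphism `y ↦ 1 ⊗ y`. -/
def freeLι : N ⟶ (freeL U N).M where
  hom := mkHom (N := (U.U.tensor N).S)
    (fun E n => U.U.tp N (split_empty_left E) (zero_add n) U.one)
    (fun E n n' y h => by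
      rw [dl_tp (split_empty_left E) (zero_add n) h (i' := -1) (by omega) h, U.d_one, map_zero,
        LinearMap.zero_apply, zero_add]
      simp [sg])
    (fun {E E'} σ n y => by
      rw [rl_tp σ (split_empty_left E) (split_empty_left E') (Equiv.refl (∅ : Finset ℕ)) σ
        (fun x hx => absurd hx (Finset.notMem_empty x)) (fun _ _ _ => rfl), rl_refl])
  map_act {E F G e} h {i j n} hn y p :=
    (act_tp_right h (split_empty_left E) h (split_empty_left G) (zero_add i) hn hn (zero_add n)
      U.one y p).symm

/-- This is x · (1 ⊗ y) = (x · 1) ⊗ y with the right unit law of U. It shows that the copy of N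
inside U ⊗ N generates it over U, which gives `freeL_ind` and `freeL_hom_ext`. -/
lemma freeL_u_ι {A B E : Finset ℕ} (hs : Split A B E) {i j n : ℤ} (hn : i + j = n)
    (x : El U.U.S A i) (y : El N.S B j) :
    (freeL U N).u hs hn x (hl (freeLι U N).hom B j y) = U.U.tp N hs hn x y := by
  refine (freeAct_tmul U N (split_empty_right A) hs (split_empty_left B) hs (add_zero i) hn
    (zero_add j) hn x U.one y).trans ?_
  rw [RAlg.m_apply, U.mul_one]

lemma freeL_ind {E : Finset ℕ} {n : ℤ} {p : (freeL U N).El E n → Prop} (h0 : p 0)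
    (hadd : ∀ x y, p x → p y → p (x + y))
    (h : ∀ {A B : Finset ℕ} (hs : Split A B E) {i j : ℤ} (hn : i + j = n) (x : El U.U.S A i)
      (y : El N.S B j), p ((freeL U N).u hs hn x (hl (freeLι U N).hom B j y)))
    (z : (freeL U N).El E n) : p z :=
  tp_ind (M := U.U) (N := N) (p := p) h0 hadd (fun hs _ _ hn x y => freeL_u_ι hs hn x y ▸ h hs hn x y) z

/-- The morphism of right `P`-modules `x ⊗ y ↦ x · g(y)`. -/
def freeLDescR (g : N ⟶ M.M) : (freeL U N).M ⟶ M.M := RMod.tensorMap (𝟙 U.U) g ≫ M.act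

lemma hl_freeLDescR (g : N ⟶ M.M) {A B E : Finset ℕ} (hs : Split A B E) {i j n : ℤ}
    (hn : i + j = n) (x : El U.U.S A i) (y : El N.S B j) :
    hl (freeLDescR g).hom E n ((freeL U N).u hs hn x (hl (freeLι U N).hom B j y)) =
      M.u hs hn x (hl g.hom B j y) := by
  rw [freeL_u_ι]
  exact congrArg (hl M.act.hom E n) (RMod.tensorMap_tp (𝟙 U.U) g hs hn x y)

/-- The morphism `U ⊗ N ⟶ M` which corresponds to `N ⟶ M`. -/
def freeLDesc (g : N ⟶ M.M) : freeL U N ⟶ M :=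
  LMod.homOfRMod (freeLDescR g) (by
    intro A BC E h₄ i bc n e₄ x w
    induction w using freeL_ind with
    | h0 => simp only [map_zero]
    | hadd x y hx hy => simp only [map_add, hx, hy]
    | @h B C h₃ b c e₃ y z =>
      obtain ⟨h₁, h₂⟩ := Split.assoc h₃ h₄
      -- On generators, U-linearity is associativity: both sides become (x · y) acting on g(z).
      rw [← (freeL U N).isLeftAction.mul h₁ h₂ h₃ h₄ rfl (by omega), hl_freeLDescR, hl_freeLDescR,
        M.isLeftAction.mul h₁ h₂ h₃ h₄ rfl (by omega) e₃ e₄])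

lemma freeLι_desc (g : N ⟶ M.M) : freeLι U N ≫ (freeLDesc g).hom = g := by
  apply RMod.hom_ext
  apply DGOperad.hom_ext
  intro E n y
  have h : hl (freeLDescR g).hom E n (U.U.tp N (split_empty_left E) (zero_add n) U.one y) =
      hl M.act.hom E n (U.U.tp M.M (split_empty_left E) (zero_add n) U.one (hl g.hom E n y)) :=
    congrArg (hl M.act.hom E n)
      (RMod.tensorMap_tp (𝟙 U.U) g (split_empty_left E) (zero_add n) U.one y)
  exact h.trans (M.one_act _)

lemma freeL_hom_ext {f g : freeL U N ⟶ M} (h : freeLι U N ≫ f.hom = freeLι U N ≫ g.hom) :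
    f = g := by
  refine LMod.hom_ext_app fun E n x => ?_
  induction x using freeL_ind with
  | h0 => simp only [map_zero]
  | hadd x y hx hy => simp only [map_add, hx, hy]
  | @h A B hs i j hn x y =>
    have h' : LMod.app f B j (hl (freeLι U N).hom B j y) =
        LMod.app g B j (hl (freeLι U N).hom B j y) := congrArg (fun φ : N ⟶ M.M => hl φ.hom B j y) h
    rw [LMod.app_u, LMod.app_u]
    exact congrArg (M.u hs hn x) h'

end freeLeft

/-! ### The free `Σ_*`-modules `F_r` -/

section freeSigma

variable (k) in
/-- The generator of `F_r`. -/
def sigmaGen (r : ℕ) : El (freeSigma k r) (Finset.range r) 0 :=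
  (HomologicalComplex.singleObjXSelf (ComplexShape.down ℤ) (0 : ℤ)
    (ModuleCat.of k ((Finset.range r ≃ Finset.range r) →₀ k))).inv.hom
      (Finsupp.single (Equiv.refl _) 1)

/-- The basis element of F_r(E) given by a bijection τ is the generator relabelled along τ, so a
morphism out of F_r is determined by the image of the generator. -/
lemma rl_sigmaGen {r : ℕ} {E : Finset ℕ} (τ : Finset.range r ≃ E) :
    rl (freeSigma k r) τ 0 (sigmaGen k r) =
      (HomologicalComplex.singleObjXSelf (ComplexShape.down ℤ) (0 : ℤ)
        (ModuleCat.of k ((Finset.range r ≃ E) →₀ k))).inv.hom (Finsupp.single τ 1) := by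
  have h := HomologicalComplex.single_map_f_self (c := ComplexShape.down ℤ) (0 : ℤ)
    (ModuleCat.ofHom (Finsupp.lmapDomain k k
      (fun ρ : Finset.range r ≃ Finset.range r => ρ.trans τ)))
  refine (LinearMap.congr_fun (congrArg ModuleCat.Hom.hom h) (sigmaGen k r)).trans ?_
  simp [sigmaGen]

lemma freeSigma_hom_ext {r : ℕ} {S : SMod k} {f g : freeSigma k r ⟶ S}
    (h : hl f (Finset.range r) 0 (sigmaGen k r) = hl g (Finset.range r) 0 (sigmaGen k r)) :
    f = g := by
  refine NatTrans.ext (funext fun E => ?_)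
  refine HomologicalComplex.from_single_hom_ext ?_
  rw [← cancel_epi (HomologicalComplex.singleObjXSelf (ComplexShape.down ℤ) (0 : ℤ)
        (ModuleCat.of k ((Finset.range r ≃ E.set) →₀ k))).inv]
  refine ModuleCat.hom_ext (Finsupp.lhom_ext' fun τ => LinearMap.ext_ring ?_)
  have e (f : freeSigma k r ⟶ S) := (congrArg (hl f E.set 0) (rl_sigmaGen τ)).symm.trans
    (hl_rl f τ 0 (sigmaGen k r))
  exact (e f).trans ((congrArg (rl S τ 0) h).trans (e g).symm)

lemma freeSigmaDesc_d {r : ℕ} {S : SMod k} {z : El S (Finset.range r) 0}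
    (hz : ∀ n, dl S (Finset.range r) 0 n z = 0) (E : Finset ℕ) (n : ℤ) :
    ModuleCat.ofHom (Finsupp.lift (El S E 0) k (Finset.range r ≃ E) (fun τ => rl S τ 0 z)) ≫
      (S.obj (Bij.of E)).d 0 n = 0 := by
  refine ModuleCat.hom_ext (Finsupp.lhom_ext' fun τ => LinearMap.ext_ring ?_)
  change dl S E 0 n (Finsupp.lift (El S E 0) k (Finset.range r ≃ E)
    (fun τ => rl S τ 0 z) (Finsupp.single τ 1)) = 0
  simp [dl_rl, hz]

/-- The morphism `F_r ⟶ S` given by a cycle of arity `{0, …, r - 1}` and degree `0`. -/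
def freeSigmaDesc {r : ℕ} {S : SMod k} (z : El S (Finset.range r) 0)
    (hz : ∀ n, dl S (Finset.range r) 0 n z = 0) : freeSigma k r ⟶ S where
  app E := HomologicalComplex.mkHomFromSingle
    (ModuleCat.ofHom (Finsupp.lift (El S E.set 0) k (Finset.range r ≃ E.set)
      (fun τ => rl S τ 0 z)))
    (fun n _ => freeSigmaDesc_d hz E.set n)
  naturality E E' σ := by
    refine HomologicalComplex.from_single_hom_ext ?_
    rw [← cancel_epi (HomologicalComplex.singleObjXSelf (ComplexShape.down ℤ) (0 : ℤ)
        (ModuleCat.of k ((Finset.range r ≃ E.set) →₀ k))).inv]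
    dsimp [freeSigma]
    rw [HomologicalComplex.single_map_f_self, HomologicalComplex.mkHomFromSingle_f,
      HomologicalComplex.mkHomFromSingle_f]
    simp only [Category.assoc, Iso.inv_hom_id_assoc]
    refine ModuleCat.hom_ext (Finsupp.lhom_ext' fun τ => LinearMap.ext_ring ?_)
    have e : Finsupp.lift (El S E.set 0) k (Finset.range r ≃ E.set) (fun τ => rl S τ 0 z)
        (Finsupp.single τ 1) = rl S τ 0 z := by simp
    refine Eq.trans ?_ (congrArg (rl S (show E.set ≃ E'.set from σ) 0) e).symm
    simp
    exact rl_trans S τ σ 0 z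

lemma freeSigmaDesc_gen {r : ℕ} {S : SMod k} (z : El S (Finset.range r) 0)
    (hz : ∀ n, dl S (Finset.range r) 0 n z = 0) :
    hl (freeSigmaDesc z hz) (Finset.range r) 0 (sigmaGen k r) = z := by
  have h : ((freeSigmaDesc z hz).app (Bij.of (Finset.range r))).f 0 = _ :=
    HomologicalComplex.mkHomFromSingle_f _ (fun n _ => freeSigmaDesc_d hz (Finset.range r) n)
  refine (LinearMap.congr_fun (congrArg ModuleCat.Hom.hom h) (sigmaGen k r)).trans ?_
  have h' := LinearMap.congr_fun (congrArg ModuleCat.Hom.hom (Iso.inv_hom_id_assoc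
    (HomologicalComplex.singleObjXSelf (ComplexShape.down ℤ) (0 : ℤ)
      (ModuleCat.of k ((Finset.range r ≃ Finset.range r) →₀ k)))
    (ModuleCat.ofHom (Finsupp.lift (El S (Finset.range r) 0) k (Finset.range r ≃ Finset.range r)
      (fun τ => rl S τ 0 z))))) (Finsupp.single (Equiv.refl _) (1 : k))
  refine h'.trans ?_
  simp [rl_refl]

end freeSigma

/-! ### The universal property of `U ⊗ (C ⊗ (F_r ∘ P))` -/

section generators

lemma dl_sigmaGen (r : ℕ) (n : ℤ) :
    dl (freeSigma k r) (Finset.range r) 0 n (sigmaGen k r) = 0 := by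
  have h : ((freeSigma k r).obj (Bij.of (Finset.range r))).d 0 n = 0 :=
    HomologicalComplex.single_obj_d ..
  exact LinearMap.congr_fun (congrArg ModuleCat.Hom.hom h) _

variable {P : Operad k} (U : RAlg P)

/-- The evaluation of left `U`-modules in the arity `E`. -/
def evS (E : Finset ℕ) : LMod U ⥤ DGMod k where
  obj M := M.M.S.obj (Bij.of E)
  map f := f.hom.hom.app (Bij.of E)

variable (C D : DGMod k) (r : ℕ)

variable (P) in
/-- The generator of `F_r ∘ P`. -/
def freeGen : El (freeR P (freeSigma k r)).S (Finset.range r) 0 :=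
  hl (freeRι P (freeSigma k r)) (Finset.range r) 0 (sigmaGen k r)

lemma dl_freeGen (n : ℤ) :
    dl (freeR P (freeSigma k r)).S (Finset.range r) 0 n (freeGen P r) = 0 := by
  refine (hl_dl (freeRι P (freeSigma k r)) _ 0 n (sigmaGen k r)).symm.trans ?_
  rw [dl_sigmaGen, map_zero]

/-- The elements `1 ⊗ (c ⊗ e)`, where `e` is the generator of `F_r ∘ P`. -/
def genEl (i : ℤ) : C.X i →ₗ[k] (genObj U C r).El (Finset.range r) i :=
  (hl (freeLι U ((constR P C).tensor (freeR P (freeSigma k r)))).hom (Finset.range r) i).comp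
    ((ctp (add_zero i)).flip (freeGen P r))

/-- The elements `1 ⊗ (c ⊗ e)` form a morphism of dg modules. -/
def genEta : C ⟶ (evS U (Finset.range r)).obj (genObj U C r) where
  f i := ModuleCat.ofHom (genEl U C r i)
  comm' i i' h := by
    have h : i' + 1 = i := h
    refine ModuleCat.hom_ext (LinearMap.ext fun c => ?_)
    have h1 := hl_dl (freeLι U ((constR P C).tensor (freeR P (freeSigma k r)))).hom
      (Finset.range r) i i' (ctp (add_zero i) c (freeGen P r))
    rw [dl_ctp (add_zero i) h h (j' := -1) (by omega) (add_zero i') (by omega), dl_freeGen,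
      map_zero, smul_zero, add_zero] at h1
    exact h1.symm

variable {C D} in
-- On c both sides are 1 ⊗ (f(c) ⊗ e), with e the generator of F_r ∘ P. This is naturality of the
-- unit of the adjunction.
lemma genEta_naturality (f : C ⟶ D) :
    genEta U C r ≫ (evS U (Finset.range r)).map (genMap U f r) = f ≫ genEta U D r := by
  ext i c
  have h1 := RMod.tensorMap_tp (𝟙 U.U)
    (RMod.tensorMap (constRMap P f) (𝟙 (freeR P (freeSigma k r))))
    (split_empty_left (Finset.range r)) (zero_add i) U.one (ctp (add_zero i) c (freeGen P r))
  have h2 := RMod.tensorMap_tp (constRMap P f) (𝟙 (freeR P (freeSigma k r)))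
    (split_empty_left (Finset.range r)) (add_zero i) (cst i c) (freeGen P r)
  exact h1.trans (congrArg
    (U.U.tp ((constR P D).tensor (freeR P (freeSigma k r))) (split_empty_left (Finset.range r))
      (zero_add i) U.one) h2)

variable {U C D r} {M : LMod U}

/-- Peels off one free construction at a time: U ⊗ -, then C ⊗ - by currying, then - ∘ P, then F_r.
What is left of a morphism is its values on the elements 1 ⊗ (c ⊗ e), recorded by `genEta`. -/
lemma gen_hom_ext {f g : genObj U C r ⟶ M}
    (h : genEta U C r ≫ (evS U (Finset.range r)).map f =
      genEta U C r ≫ (evS U (Finset.range r)).map g) : f = g := by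
  refine freeL_hom_ext (curry_injective ?_)
  refine (freeR_universal (freeRι P (freeSigma k r) ≫
    (curry (freeLι U _ ≫ g.hom)).hom)).unique ?_ rfl
  refine freeSigma_hom_ext (homS_ext fun {i m} hi c => ?_)
  obtain rfl : i = m := by omega
  exact LinearMap.congr_fun (congrArg (fun φ => (φ.f i).hom) h) c

/-- The elements of `Hom(C, M)` of degree `0` from degreewise linear maps. -/
def homOfMaps {S : SMod k} {E : Finset ℕ} (g : ∀ i, C.X i →ₗ[k] El S E i) : El (homS C S) E 0 :=
  hmk fun {i m} h => (show i = m by omega) ▸ g i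

lemma hp_homOfMaps {S : SMod k} {E : Finset ℕ} (g : ∀ i, C.X i →ₗ[k] El S E i) (i : ℤ) :
    hp (add_zero i) (homOfMaps g) = g i := rfl

/-- For an element of degree 0, the differential of Hom(C, S) measures the failure to commute with
the differentials; a chain map is thus a cycle, the datum which a morphism out of F_r requires. -/
lemma dl_homOfMaps {S : SMod k} {E : Finset ℕ} (g : C ⟶ S.obj (Bij.of E)) (n : ℤ) :
    dl (homS C S) E 0 n (homOfMaps fun i => (g.f i).hom) = 0 := by
  by_cases hn : n + 1 = 0
  · refine homS_ext fun {i m} hi c => ?_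
    rw [hp_dl hn (i' := i - 1) (m := i) (by omega) (by omega) hi (add_zero i) (by omega)]
    obtain rfl : m = i - 1 := by omega
    have h1 : dl S E i (i - 1) ((g.f i).hom c) = (g.f (i - 1)).hom ((C.d i (i - 1)).hom c) :=
      LinearMap.congr_fun (congrArg ModuleCat.Hom.hom (g.comm i (i - 1))) c
    rw [hp_homOfMaps]
    erw [hp_homOfMaps]
    rw [h1, sub_self, smul_zero, map_zero, LinearMap.zero_apply]
  · rw [dl_shape _ _ hn, LinearMap.zero_apply]

/-- The morphism `U ⊗ (C ⊗ (F_r ∘ P)) ⟶ M` which corresponds to `C ⟶ M({0, …, r - 1})`. -/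
def genDesc (g : C ⟶ (evS U (Finset.range r)).obj M) : genObj U C r ⟶ M :=
  freeLDesc (uncurry (freeRDesc (M := homR C M.M)
    (freeSigmaDesc (homOfMaps fun i => (g.f i).hom) (dl_homOfMaps g))))

lemma genEta_desc (g : C ⟶ (evS U (Finset.range r)).obj M) :
    genEta U C r ≫ (evS U (Finset.range r)).map (genDesc g) = g := by
  ext i c
  have h1 := LinearMap.congr_fun (congrArg (fun φ => hl φ.hom (Finset.range r) i) (freeLι_desc
    (uncurry (freeRDesc (M := homR C M.M)
      (freeSigmaDesc (homOfMaps fun i => (g.f i).hom) (dl_homOfMaps g))))))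
    (ctp (add_zero i) c (freeGen P r))
  refine h1.trans ((hl_uncurry _ (add_zero i) c (freeGen P r)).trans ?_)
  have h2 : hl (freeRDesc (M := homR C M.M) (freeSigmaDesc (homOfMaps fun i => (g.f i).hom)
      (dl_homOfMaps g))).hom (Finset.range r) 0 (freeGen P r) = homOfMaps fun i => (g.f i).hom :=
    freeSigmaDesc_gen (S := homS C M.M.S) (homOfMaps fun i => (g.f i).hom) (dl_homOfMaps g)
  exact (congrArg (fun z => hp (add_zero i) z c) h2).trans rfl

/-- The functor `C ↦ U ⊗ (C ⊗ (F_r ∘ P))` is left adjoint to the evaluation in the arity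
`{0, …, r - 1}`: the bijection on morphisms. -/
def genHomEquiv : (genObj U C r ⟶ M) ≃ (C ⟶ (evS U (Finset.range r)).obj M) where
  toFun f := genEta U C r ≫ (evS U (Finset.range r)).map f
  invFun g := genDesc g
  left_inv _ := gen_hom_ext (genEta_desc _)
  right_inv g := genEta_desc g

/-- Naturality of the bijection `genHomEquiv` in C; `genDesc_comp` is naturality in M. Together they
transpose commutative squares. -/
lemma genMap_desc {f : C ⟶ D} (g : D ⟶ (evS U (Finset.range r)).obj M) :
    genMap U f r ≫ genDesc g = genDesc (f ≫ g) := by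
  refine gen_hom_ext ?_
  rw [genEta_desc, Functor.map_comp, ← Category.assoc, genEta_naturality, Category.assoc,
    genEta_desc]

lemma genDesc_comp {N : LMod U} (g : C ⟶ (evS U (Finset.range r)).obj M) (p : M ⟶ N) :
    genDesc g ≫ p = genDesc (g ≫ (evS U (Finset.range r)).map p) := by
  refine gen_hom_ext ?_
  rw [genEta_desc, Functor.map_comp, ← Category.assoc, genEta_desc]

/-- Squares and their diagonal fillers correspond under the adjunction. The argument transposes
through `genDesc` and `genEta` directly. -/
lemma hasLiftingProperty_genMap_iff (i : C ⟶ D) {M N : LMod U} (p : M ⟶ N) :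
    HasLiftingProperty (genMap U i r) p ↔
      HasLiftingProperty i ((evS U (Finset.range r)).map p) := by
  constructor
  · intro h
    refine ⟨fun {f g} sq => ?_⟩
    have sq' : CommSq (genDesc f) (genMap U i r) p (genDesc g) :=
      ⟨by rw [genMap_desc, genDesc_comp, sq.w]⟩
    refine ⟨⟨⟨genEta U D r ≫ (evS U (Finset.range r)).map sq'.lift, ?_, ?_⟩⟩⟩
    · rw [← Category.assoc, ← genEta_naturality, Category.assoc, ← Functor.map_comp,
        sq'.fac_left, genEta_desc]
    · rw [Category.assoc, ← Functor.map_comp, sq'.fac_right, genEta_desc]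
  · intro h
    refine ⟨fun {f g} sq => ?_⟩
    obtain ⟨f, rfl⟩ := genHomEquiv.symm.surjective f
    obtain ⟨g, rfl⟩ := genHomEquiv.symm.surjective g
    have w : genDesc f ≫ p = genMap U i r ≫ genDesc g := sq.w
    rw [genMap_desc, genDesc_comp] at w
    have sq' : CommSq f i ((evS U (Finset.range r)).map p) g := ⟨genHomEquiv.symm.injective w⟩
    refine ⟨⟨⟨genDesc sq'.lift, ?_, ?_⟩⟩⟩
    · rw [genMap_desc, sq'.fac_left]; rfl
    · rw [genDesc_comp, sq'.fac_right]; rfl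

end generators

/-! ### Morphisms out of spheres and disks, and lifting properties -/

section disks

open scoped ZeroObject

lemma dg_f_d {X Y : DGMod k} (f : X ⟶ Y) (a b : ℤ) (x : X.X a) :
    f.f b (X.d a b x) = Y.d a b (f.f a x) :=
  congrArg (fun f => f.hom x) (f.comm a b).symm

lemma dg_d_d {X : DGMod k} (a b c : ℤ) (x : X.X a) : X.d b c (X.d a b x) = 0 :=
  congrArg (fun f => f.hom x) (X.d_comp_d a b c)

variable (k) in
/-- The generator of `S^d`. -/
def sphereGen (d : ℤ) : (sphere k d).X d :=
  (HomologicalComplex.singleObjXSelf (ComplexShape.down ℤ) d (ModuleCat.of k k)).inv.hom (1 : k)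

variable (k) in
/-- The generator of `D^d` in degree `d`. -/
def diskGen (d : ℤ) : (disk k d).X d :=
  (HomologicalComplex.doubleXIso₀ (𝟙 (ModuleCat.of k k))
    (show (ComplexShape.down ℤ).Rel d (d - 1) by simp)).inv.hom (1 : k)

lemma d_sphereGen (d n : ℤ) : (sphere k d).d d n (sphereGen k d) = 0 := by
  have h : (sphere k d).d d n = 0 := HomologicalComplex.single_obj_d ..
  exact LinearMap.congr_fun (congrArg ModuleCat.Hom.hom h) _

variable {X Y : DGMod k} {d : ℤ}

lemma sphere_hom_ext {f g : sphere k d ⟶ X}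
    (h : f.f d (sphereGen k d) = g.f d (sphereGen k d)) : f = g := by
  refine HomologicalComplex.from_single_hom_ext ?_
  rw [← cancel_epi (HomologicalComplex.singleObjXSelf (ComplexShape.down ℤ) d
    (ModuleCat.of k k)).inv]
  exact ModuleCat.hom_ext (LinearMap.ext_ring h)

/-- With `sphere_hom_ext`: the sphere S^d corepresents the cycles of degree d. -/
lemma exists_sphere_hom (x : X.X d) (hx : ∀ n, X.d d n x = 0) :
    ∃ f : sphere k d ⟶ X, f.f d (sphereGen k d) = x := by
  have hφ (n : ℤ) (_ : (ComplexShape.down ℤ).Rel d n) :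
      ModuleCat.ofHom (LinearMap.toSpanSingleton k (X.X d) x) ≫ X.d d n = 0 := by
    refine ModuleCat.hom_ext (LinearMap.ext_ring ?_)
    refine (congrArg (X.d d n) (one_smul k x)).trans (hx n)
  refine ⟨HomologicalComplex.mkHomFromSingle _ hφ, ?_⟩
  refine (LinearMap.congr_fun (congrArg ModuleCat.Hom.hom
    (HomologicalComplex.mkHomFromSingle_f _ hφ)) (sphereGen k d)).trans ?_
  refine (LinearMap.congr_fun (congrArg ModuleCat.Hom.hom (Iso.inv_hom_id_assoc
    (HomologicalComplex.singleObjXSelf (ComplexShape.down ℤ) d (ModuleCat.of k k))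
    (ModuleCat.ofHom (LinearMap.toSpanSingleton k (X.X d) x)))) (1 : k)).trans ?_
  exact one_smul k x

lemma d_diskGen (d : ℤ) : (disk k d).d d (d - 1) (diskGen k d) =
    (HomologicalComplex.doubleXIso₁ (𝟙 (ModuleCat.of k k))
      (show (ComplexShape.down ℤ).Rel d (d - 1) by simp) (by omega)).inv.hom (1 : k) := by
  have hr : (ComplexShape.down ℤ).Rel d (d - 1) := by simp
  have h1 : (disk k d).d d (d - 1) = _ :=
    HomologicalComplex.double_d (𝟙 (ModuleCat.of k k)) hr (by omega)
  rw [h1]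
  refine (LinearMap.congr_fun (congrArg ModuleCat.Hom.hom (Iso.inv_hom_id_assoc
    (HomologicalComplex.doubleXIso₀ (𝟙 (ModuleCat.of k k)) hr)
    (𝟙 _ ≫ (HomologicalComplex.doubleXIso₁ (𝟙 (ModuleCat.of k k)) hr (by omega)).inv)))
      (1 : k)).trans ?_
  rw [Category.id_comp]

/-- Hence, if a map out of D^d corresponds to w, its restriction to S^{d-1} corresponds to dw. -/
lemma sphereToDisk_gen (d : ℤ) :
    (sphereToDisk k d).f (d - 1) (sphereGen k (d - 1)) =
      (disk k d).d d (d - 1) (diskGen k d) := by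
  have hr : (ComplexShape.down ℤ).Rel d (d - 1) := by simp
  have h2 : (sphereToDisk k d).f (d - 1) = _ := HomologicalComplex.mkHomFromSingle_f _ _
  rw [d_diskGen, h2]
  exact LinearMap.congr_fun (congrArg ModuleCat.Hom.hom (Iso.inv_hom_id_assoc
    (HomologicalComplex.singleObjXSelf (ComplexShape.down ℤ) (d - 1) (ModuleCat.of k k))
    (HomologicalComplex.doubleXIso₁ (𝟙 (ModuleCat.of k k)) hr (by omega)).inv)) (1 : k)

lemma disk_hom_ext {f g : disk k d ⟶ X}
    (h : f.f d (diskGen k d) = g.f d (diskGen k d)) : f = g := by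
  have hr : (ComplexShape.down ℤ).Rel d (d - 1) := by simp
  refine HomologicalComplex.from_double_hom_ext ?_ ?_
  · refine (cancel_epi (HomologicalComplex.doubleXIso₀ (𝟙 (ModuleCat.of k k)) hr).inv).1 ?_
    exact ModuleCat.hom_ext (LinearMap.ext_ring h)
  · refine (cancel_epi
      (HomologicalComplex.doubleXIso₁ (𝟙 (ModuleCat.of k k)) hr (by omega)).inv).1 ?_
    refine ModuleCat.hom_ext (LinearMap.ext_ring ?_)
    have h' : f.f (d - 1) ((disk k d).d d (d - 1) (diskGen k d)) =
        g.f (d - 1) ((disk k d).d d (d - 1) (diskGen k d)) := by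
      rw [dg_f_d, dg_f_d, h]
    rw [d_diskGen] at h'
    exact h'

/-- With `disk_hom_ext`: the disk D^d corepresents all elements of degree d. The component in degree
d - 1 is forced to be dx. -/
lemma exists_disk_hom (x : X.X d) :
    ∃ f : disk k d ⟶ X, f.f d (diskGen k d) = x := by
  have hr : (ComplexShape.down ℤ).Rel d (d - 1) := by simp
  have hc : ModuleCat.ofHom (LinearMap.toSpanSingleton k (X.X d) x) ≫ X.d d (d - 1) =
      𝟙 (ModuleCat.of k k) ≫
        ModuleCat.ofHom (LinearMap.toSpanSingleton k (X.X (d - 1)) (X.d d (d - 1) x)) := by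
    refine ModuleCat.hom_ext (LinearMap.ext_ring ?_)
    exact (congrArg (X.d d (d - 1)) (one_smul k x)).trans (one_smul k _).symm
  have hφ (n : ℤ) (_ : (ComplexShape.down ℤ).Rel (d - 1) n) :
      ModuleCat.ofHom (LinearMap.toSpanSingleton k (X.X (d - 1)) (X.d d (d - 1) x)) ≫
        X.d (d - 1) n = 0 := by
    refine ModuleCat.hom_ext (LinearMap.ext_ring ?_)
    exact (congrArg (X.d (d - 1) n) (one_smul k _)).trans (dg_d_d _ _ _ x)
  refine ⟨HomologicalComplex.mkHomFromDouble hr (by omega) _ _ hc hφ, ?_⟩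
  refine (LinearMap.congr_fun (congrArg ModuleCat.Hom.hom
    (HomologicalComplex.mkHomFromDouble_f₀ hr (by omega) _ _ hc hφ)) (diskGen k d)).trans ?_
  refine (LinearMap.congr_fun (congrArg ModuleCat.Hom.hom (Iso.inv_hom_id_assoc
    (HomologicalComplex.doubleXIso₀ (𝟙 (ModuleCat.of k k)) hr)
    (ModuleCat.ofHom (LinearMap.toSpanSingleton k (X.X d) x)))) (1 : k)).trans ?_
  exact one_smul k x

/-- By corepresentability, a square is a cycle x of X together with an element y of Y such that dy =
p(x), and a filler is an element w with dw = x and p(w) = y. -/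
lemma hasLiftingProperty_sphereToDisk_iff (p : X ⟶ Y) :
    (∀ d, HasLiftingProperty (sphereToDisk k d) p) ↔ LiftsBoundaries p := by
  constructor
  · intro h n m l hn hl x y hx hy
    obtain rfl : m = n - 1 := by omega
    have := h n
    -- The hypothesis concerns only the component of the differential into degree l; the other
    -- components vanish by the shape of the complex.
    obtain ⟨f, hf⟩ := exists_sphere_hom x (fun l' => by
      by_cases hl' : l' = l
      · rw [hl', hx]
      · have : X.d (n - 1) l' = 0 := X.shape _ _ fun h => hl' (by
          have : l' + 1 = n - 1 := h
          omega)
        rw [this]; rfl)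
    obtain ⟨g, hg⟩ := exists_disk_hom y
    have sq : CommSq f (sphereToDisk k n) p g := ⟨sphere_hom_ext (by
      change p.f _ (f.f _ _) = g.f _ ((sphereToDisk k n).f _ _)
      rw [hf, sphereToDisk_gen, dg_f_d, hg, hy])⟩
    refine ⟨sq.lift.f n (diskGen k n), ?_, ?_⟩
    · rw [← dg_f_d, ← sphereToDisk_gen, ← hf]
      exact congrArg (fun φ => φ.f (n - 1) (sphereGen k (n - 1))) sq.fac_left
    · rw [← hg]
      exact congrArg (fun φ => φ.f n (diskGen k n)) sq.fac_right
  · intro h d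
    refine ⟨fun {f g} sq => ?_⟩
    obtain ⟨w, hw, hw'⟩ := h d (d - 1) (d - 1 - 1) (by omega) (by omega)
      (f.f (d - 1) (sphereGen k (d - 1))) (g.f d (diskGen k d))
      (by rw [← dg_f_d, d_sphereGen, map_zero]) (by
        rw [← dg_f_d, ← sphereToDisk_gen]
        exact (congrArg (fun φ => φ.f (d - 1) (sphereGen k (d - 1))) sq.w).symm)
    obtain ⟨φ, hφ⟩ := exists_disk_hom w
    refine ⟨⟨⟨φ, sphere_hom_ext ?_, disk_hom_ext ?_⟩⟩⟩
    · change φ.f _ ((sphereToDisk k d).f _ _) = _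
      rw [sphereToDisk_gen, dg_f_d, hφ, hw]
    · change p.f _ (φ.f _ _) = _
      rw [hφ, hw']

/-- Since 0 is initial, a square is just an element of Y, and a filler is a preimage of it. -/
lemma hasLiftingProperty_zeroToDisk_iff (p : X ⟶ Y) :
    (∀ d, HasLiftingProperty (zeroToDisk k d) p) ↔
      ∀ n, Function.Surjective (p.f n).hom := by
  constructor
  · intro h n y
    have := h n
    obtain ⟨g, hg⟩ := exists_disk_hom y
    have sq : CommSq (0 : (0 : DGMod k) ⟶ X) (zeroToDisk k n) p g :=
      ⟨(isZero_zero (DGMod k)).eq_of_src _ _⟩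
    refine ⟨sq.lift.f n (diskGen k n), ?_⟩
    rw [← hg]
    exact congrArg (fun φ => φ.f n (diskGen k n)) sq.fac_right
  · intro h d
    refine ⟨fun {f g} sq => ?_⟩
    obtain ⟨w, hw⟩ := h d (g.f d (diskGen k d))
    obtain ⟨φ, hφ⟩ := exists_disk_hom w
    refine ⟨⟨⟨φ, (isZero_zero (DGMod k)).eq_of_src _ _, disk_hom_ext ?_⟩⟩⟩
    change p.f _ (φ.f _ _) = _
    rw [hφ]
    exact hw

end disks

/-! ### The right lifting properties with respect to the generating (acyclic) cofibrations -/

section rlp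

variable {P : Operad k} {U : RAlg P}

/-- The generators only see the arities {0, …, r-1}. Relabelling along a bijection carries any arity
to one of these, and lifting properties are invariant under isomorphism of arrows. -/
lemma evS_map_iso {M N : LMod U} (f : M ⟶ N) (E : Finset ℕ) :
    Nonempty (Arrow.mk ((evS U E).map f) ≅ Arrow.mk ((evS U (Finset.range E.card)).map f)) := by
  have e : E ≃ Finset.range E.card :=
    Fintype.equivOfCardEq (by simp)
  let σ : Bij.of E ≅ Bij.of (Finset.range E.card) :=
    { hom := e
      inv := e.symm
      hom_inv_id := Equiv.self_trans_symm e
      inv_hom_id := Equiv.symm_trans_self e }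
  exact ⟨Arrow.isoMk (M.M.S.mapIso σ) (N.M.S.mapIso σ) (f.hom.hom.naturality σ.hom)⟩

/-- Stated for an arbitrary family of maps of dg modules so as to serve both FI and FJ. -/
lemma ofHoms_genMap_rlp_iff (C D : ℤ → DGMod k) (i : ∀ d, C d ⟶ D d) {M N : LMod U} (f : M ⟶ N) :
    (MorphismProperty.ofHoms fun x : ℤ × ℕ => genMap U (i x.1) x.2).rlp f ↔
      ∀ (E : Finset ℕ) (d : ℤ), HasLiftingProperty (i d) ((evS U E).map f) := by
  constructor
  · intro h E d
    obtain ⟨e⟩ := evS_map_iso f E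
    rw [HasLiftingProperty.iff_of_arrow_iso_right (i d) e, ← hasLiftingProperty_genMap_iff]
    exact h _ (.mk (d, E.card))
  · rintro h _ _ _ ⟨d, r⟩
    exact (hasLiftingProperty_genMap_iff (i d) f).2 (h _ d)

variable (U) in
lemma FJ_rlp : (FJ U).rlp = (rmodFibrations P).inverseImage (forgetL U) := by
  ext M N f
  refine (ofHoms_genMap_rlp_iff _ _ _ f).trans ?_
  simp only [hasLiftingProperty_zeroToDisk_iff]
  exact Iff.rfl

variable (U) in
lemma FI_rlp : (FI U).rlp =
    (rmodFibrations P ⊓ rmodWeakEquivalences P).inverseImage (forgetL U) := by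
  ext M N f
  refine (ofHoms_genMap_rlp_iff _ _ _ f).trans ?_
  simp only [hasLiftingProperty_sphereToDisk_iff, ← dgTrivialFibrations_iff]
  exact ⟨fun h => ⟨fun E => (h E.set).2, fun E => (h E.set).1⟩, fun h E => ⟨h.2 E, h.1 E⟩⟩

end rlp

/-! ### Smallness -/

section small

open scoped ZeroObject

variable {P : Operad k} {U : RAlg P}

section colimits

variable {J : Type u} [SmallCategory J] [IsFiltered J] {F : J ⥤ LMod U} {c : Cocone F}

lemma exists_rep_of_isColimit (hc : IsColimit c) {E : Finset ℕ} {n : ℤ} (x : c.pt.El E n) :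
    ∃ (j : J) (y : (F.obj j).El E n), LMod.app (c.ι.app j) E n y = x :=
  Concrete.isColimit_exists_rep (F ⋙ LMod.ev U E n)
    (isColimitOfPreserves (LMod.ev U E n) hc) x

lemma exists_eq_of_isColimit (hc : IsColimit c) {E : Finset ℕ} {n : ℤ} {i j : J}
    (x : (F.obj i).El E n) (y : (F.obj j).El E n)
    (h : LMod.app (c.ι.app i) E n x = LMod.app (c.ι.app j) E n y) :
    ∃ (l : J) (f : i ⟶ l) (g : j ⟶ l), LMod.app (F.map f) E n x = LMod.app (F.map g) E n y :=
  Concrete.isColimit_exists_of_rep_eq (F ⋙ LMod.ev U E n)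
    (isColimitOfPreserves (LMod.ev U E n) hc) x y h

end colimits

/-- The criterion for a filtered colimit of sets: a morphism into the colimit factors through some
stage, and two factorisations of the same morphism agree at a later stage. -/
lemma preservesColimit_coyoneda {J : Type u} [SmallCategory J] [IsFiltered J] (F : J ⥤ LMod U)
    (A : LMod U)
    (h₁ : ∀ (c : Cocone F) (_ : IsColimit c) (f : A ⟶ c.pt), ∃ j, ∃ g : A ⟶ F.obj j,
      g ≫ c.ι.app j = f)
    (h₂ : ∀ (c : Cocone F) (_ : IsColimit c) (i j : J) (f : A ⟶ F.obj i) (g : A ⟶ F.obj j),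
      f ≫ c.ι.app i = g ≫ c.ι.app j → ∃ (l : J) (a : i ⟶ l) (b : j ⟶ l),
        f ≫ F.map a = g ≫ F.map b) :
    PreservesColimit F (coyoneda.obj (Opposite.op A)) where
  preserves {c} hc := ⟨Types.FilteredColimit.isColimitOf _ _
    (fun f => by
      obtain ⟨j, g, hg⟩ := h₁ c hc f
      exact ⟨j, g, hg.symm⟩)
    (fun i j f g h => h₂ c hc i j f g h)⟩

/-- The source is initial, being the image of 0 under a left adjoint, so both conditions of the
criterion only need J to be nonempty and directed. -/
lemma preservesColimit_coyoneda_genObj_zero {J : Type u} [SmallCategory J] [IsFiltered J]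
    (F : J ⥤ LMod U) (r : ℕ) :
    PreservesColimit F (coyoneda.obj (Opposite.op (genObj U (0 : DGMod k) r))) := by
  have ext {M : LMod U} (f g : genObj U (0 : DGMod k) r ⟶ M) : f = g :=
    gen_hom_ext ((isZero_zero (DGMod k)).eq_of_src _ _)
  refine preservesColimit_coyoneda F _ (fun c hc f => ?_) (fun c hc i j f g h => ?_)
  · exact ⟨IsFiltered.nonempty.some, genDesc 0, ext _ _⟩
  · exact ⟨IsFiltered.max i j, IsFiltered.leftToMax i j, IsFiltered.rightToMax i j, ext _ _⟩

variable (U) in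
/-- The generator of `U ⊗ (S^d ⊗ (F_r ∘ P))`. -/
def genSphere (d : ℤ) (r : ℕ) : (genObj U (sphere k d) r).El (Finset.range r) d :=
  genEl U (sphere k d) r d (sphereGen k d)

lemma genSphere_hom_ext {d : ℤ} {r : ℕ} {M : LMod U} {f g : genObj U (sphere k d) r ⟶ M}
    (h : LMod.app f _ d (genSphere U d r) = LMod.app g _ d (genSphere U d r)) : f = g :=
  gen_hom_ext (sphere_hom_ext h)

lemma exists_genSphere_hom {d : ℤ} {r : ℕ} {M : LMod U} (x : M.El (Finset.range r) d)
    (hx : dl M.M.S (Finset.range r) d (d - 1) x = 0) :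
    ∃ f : genObj U (sphere k d) r ⟶ M, LMod.app f _ d (genSphere U d r) = x := by
  obtain ⟨f, hf⟩ := exists_sphere_hom (X := (evS U (Finset.range r)).obj M) x (fun n => by
    by_cases hn : n + 1 = d
    · obtain rfl : n = d - 1 := by omega
      exact hx
    · exact LinearMap.congr_fun (dl_shape M.M.S (Finset.range r) hn) x)
  refine ⟨genDesc f, Eq.trans ?_ hf⟩
  exact congrArg (fun φ => φ.f d (sphereGen k d)) (genEta_desc f)

/-- Morphisms out of this object are cycles of degree d in arity {0, …, r-1}, and taking cycles
commutes with filtered colimits of modules. -/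
lemma preservesColimit_coyoneda_genObj_sphere {J : Type u} [SmallCategory J] [IsFiltered J]
    (F : J ⥤ LMod U) (d : ℤ) (r : ℕ) :
    PreservesColimit F (coyoneda.obj (Opposite.op (genObj U (sphere k d) r))) := by
  refine preservesColimit_coyoneda F _ (fun c hc f => ?_) (fun c hc i j f g h => ?_)
  · obtain ⟨i, y, hy⟩ := exists_rep_of_isColimit hc (LMod.app f _ d (genSphere U d r))
    have h0 : dl (genObj U (sphere k d) r).M.S (Finset.range r) d (d - 1) (genSphere U d r) = 0 := by
      refine (dg_f_d (genEta U (sphere k d) r) d (d - 1) (sphereGen k d)).symm.trans ?_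
      rw [d_sphereGen, map_zero]
      rfl
    -- The representative y need not be a cycle, but dy dies in the colimit, hence already at some
    -- stage j; the image of y there is a cycle.
    obtain ⟨j, a, b, hab⟩ := exists_eq_of_isColimit hc
      (dl (F.obj i).M.S (Finset.range r) d (d - 1) y) (0 : (F.obj i).El (Finset.range r) (d - 1)) (by
        rw [LMod.app_dl, hy, ← LMod.app_dl, h0, map_zero, map_zero])
    rw [map_zero, LMod.app_dl] at hab
    obtain ⟨g, hg⟩ := exists_genSphere_hom _ hab
    refine ⟨j, g, genSphere_hom_ext ?_⟩
    rw [LMod.app_comp, hg, ← LMod.app_comp, c.w, hy]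
  · obtain ⟨l, a, b, hab⟩ := exists_eq_of_isColimit hc (LMod.app f _ d (genSphere U d r))
      (LMod.app g _ d (genSphere U d r)) (by rw [← LMod.app_comp, ← LMod.app_comp, h])
    exact ⟨l, a, b, genSphere_hom_ext (by rw [LMod.app_comp, LMod.app_comp, hab])⟩

lemma hasSmallObjectArgument_of_preserves {ι : Type} {A B : ι → LMod U} (i : ∀ x, A x ⟶ B x)
    (h : ∀ (x : ι) {J : Type u} [SmallCategory J] [IsFiltered J] (F : J ⥤ LMod U),
      PreservesColimit F (coyoneda.obj (Opposite.op (A x)))) :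
    MorphismProperty.HasSmallObjectArgument.{u} (MorphismProperty.ofHoms i) := by
  -- Since the sources are finitely presentable, the cardinal ℵ₀ suffices, and the small object
  -- argument uses only sequential colimits.
  have : Fact Cardinal.aleph0.{u}.IsRegular := ⟨Cardinal.isRegular_aleph0⟩
  let _ : OrderBot Cardinal.aleph0.{u}.ord.ToType := Cardinal.orderBotAleph0OrdToType
  have : HasCoproducts.{u} (LMod U) := fun _ => inferInstance
  have : HasPushouts (LMod U) :=
    have := hasColimitsOfSizeShrink.{0, 0, u, u} (LMod U)
    inferInstance
  have : MorphismProperty.IsSmall.{u} (MorphismProperty.ofHoms i) :=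
    MorphismProperty.isSmall_ofHoms.{u} i
  refine ⟨Cardinal.aleph0, inferInstance, inferInstance, ?_⟩
  refine { preservesColimit := ?_ }
  rintro _ _ _ _ _ ⟨x⟩ _ hf
  exact h x hf.F

variable (U) in
lemma hasSmallObjectArgument_FI : MorphismProperty.HasSmallObjectArgument.{u} (FI U) :=
  hasSmallObjectArgument_of_preserves _ fun x _ _ _ F =>
    preservesColimit_coyoneda_genObj_sphere F (x.1 - 1) x.2

variable (U) in
lemma hasSmallObjectArgument_FJ : MorphismProperty.HasSmallObjectArgument.{u} (FJ U) :=
  hasSmallObjectArgument_of_preserves _ fun x _ _ _ F =>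
    preservesColimit_coyoneda_genObj_zero F x.2

end small

/-! ### Modules `Hom(C, M)` for contractible `C` -/

section contractible

variable {P : Operad k} {U : RAlg P}

/-- Precomposition with a contraction of C contracts Hom(C, S), up to sign. -/
lemma exists_dl_eq_of_contraction {C : DGMod k} {S : SMod k}
    (h : ∀ a b, C.X a →ₗ[k] C.X b)
    (hh : ∀ a (c : C.X a), C.d (a + 1) a (h a (a + 1) c) + h (a - 1) a (C.d a (a - 1) c) = c)
    {E : Finset ℕ} {n m l : ℤ} (hn : m + 1 = n) (hl : l + 1 = m) (x : El (homS C S) E m)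
    (hx : dl (homS C S) E m l x = 0) : ∃ w : El (homS C S) E n, dl (homS C S) E n m w = x := by
  -- The primitive is w(c) = (-1)^{|c|} x(hc). With this sign (dw)(c) = d(x(hc)) + x(hdc), and as x
  -- is a cycle d(x(hc)) = x(dhc), so the sum is x(dhc + hdc) = x(c).
  let w : El (homS C S) E n := hmk fun {a t} ha =>
    sg a • (hp (i := a + 1) (m := t) (by omega) x).comp (h a (a + 1))
  have hw {a t : ℤ} (ha : a + n = t) (ha' : a + 1 + m = t) (c : C.X a) :
      hp ha w c = sg a • hp ha' x (h a (a + 1) c) := rfl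
  refine ⟨w, homS_ext fun {a t} ha c => ?_⟩
  rw [hp_dl hn (i' := a - 1) (m := t + 1) (by omega) rfl ha (by omega) (by omega),
    hw _ (by omega)]
  have hw' (c' : C.X (a - 1)) : hp (show a - 1 + n = t by omega) w c' =
      sg (a - 1) • hp ha x (h (a - 1) a c') := by
    have e : ∀ {b : ℤ} (hb : a - 1 + 1 = b) (hb' : b + m = t),
        hp (show a - 1 + n = t by omega) w c' = sg (a - 1) • hp hb' x (h (a - 1) b c') := by
      rintro _ rfl _; rfl
    exact e (by omega) ha
  have hd : dl S E (t + 1) t (hp (show a + 1 + m = t + 1 by omega) x (h a (a + 1) c)) =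
      hp ha x (C.d (a + 1) a (h a (a + 1) c)) := by
    have := hp_dl hl (i := a + 1) (i' := a) rfl rfl (by omega) (by omega) ha x (h a (a + 1) c)
    rw [hx, map_zero, LinearMap.zero_apply] at this
    have h2 := congrArg (sg (a + 1) • ·) this
    simp only [smul_zero, smul_smul, sg_mul_self, one_smul] at h2
    exact (sub_eq_zero.1 h2.symm)
  rw [hw', map_zsmul, hd, smul_sub, smul_smul, smul_smul, sg_mul_self, one_smul,
    sg_pred (show a - 1 + 1 = a by omega), neg_mul, sg_mul_self, neg_smul, one_smul, sub_neg_eq_add,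
    ← map_add]
  exact congrArg (hp ha x) (hh a c)

/-- The morphism f is a cycle of M, and a primitive of that cycle is the wanted morphism out of the
disk. So maps to an acyclic M extend along FI. -/
lemma exists_genMap_sphereToDisk_comp {M : LMod U}
    (hM : ∀ (E : Finset ℕ) (n m l : ℤ), m + 1 = n → l + 1 = m → ∀ x : M.El E m,
      dl M.M.S E m l x = 0 → ∃ w : M.El E n, dl M.M.S E n m w = x)
    {d : ℤ} {r : ℕ} (f : genObj U (sphere k (d - 1)) r ⟶ M) :
    ∃ g : genObj U (disk k d) r ⟶ M, genMap U (sphereToDisk k d) r ≫ g = f := by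
  obtain ⟨f, rfl⟩ := genHomEquiv.symm.surjective f
  obtain ⟨w, hw⟩ := hM (Finset.range r) d (d - 1) (d - 1 - 1) (by omega) (by omega)
    (f.f (d - 1) (sphereGen k (d - 1))) ((dg_f_d f _ _ _).symm.trans (by
      rw [d_sphereGen, map_zero]
      rfl))
  obtain ⟨g, hg⟩ := exists_disk_hom (X := (evS U (Finset.range r)).obj M) w
  refine ⟨genDesc g, (genMap_desc g).trans (congrArg genDesc (sphere_hom_ext ?_))⟩
  change g.f _ ((sphereToDisk k d).f _ _) = _
  rw [sphereToDisk_gen, dg_f_d, hg]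
  exact hw

open scoped Classical in
variable (k) in
/-- The contractible dg module which is `k` in every degree, with differential the identity in odd
degrees and zero in even degrees. -/
def contr : DGMod k where
  X _ := ModuleCat.of k k
  d n n' := if n' + 1 = n ∧ Odd n then 𝟙 _ else 0
  shape n n' h := if_neg fun h' => h h'.1
  d_comp_d' n n' n'' h h' := by
    by_cases hn : Odd n
    · have h : n' + 1 = n := h
      have : ¬ Odd n' := by
        subst h; rw [Int.not_odd_iff_even]; simpa [parity_simps] using hn
      rw [if_neg (fun h => this h.2 : ¬ (n'' + 1 = n' ∧ Odd n')), comp_zero]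
    · rw [if_neg (fun h => hn h.2 : ¬ (n' + 1 = n ∧ Odd n)), zero_comp]

lemma contr_d_odd {n n' : ℤ} (h : n' + 1 = n) (hn : Odd n) (c : (contr k).X n) :
    (contr k).d n n' c = (show (contr k).X n' from c) := by
  have : (contr k).d n n' = 𝟙 (ModuleCat.of k k) := if_pos ⟨h, hn⟩
  rw [this]; rfl

lemma contr_d_even {n n' : ℤ} (hn : Even n) (c : (contr k).X n) : (contr k).d n n' c = 0 := by
  have : (contr k).d n n' = 0 := if_neg fun h => Int.not_odd_iff_even.2 hn h.2
  rw [this]; rfl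

open scoped Classical in
variable (k) in
/-- The contraction of `contr k`: the identity in even degrees and zero in odd degrees. -/
def contrH (a b : ℤ) : (contr k).X a →ₗ[k] (contr k).X b :=
  show k →ₗ[k] k from if Even a then LinearMap.id else 0

lemma contrH_even {a : ℤ} (ha : Even a) (b : ℤ) (c : (contr k).X a) :
    contrH k a b c = (show (contr k).X b from c) :=
  LinearMap.congr_fun (if_pos ha : contrH k a b = (LinearMap.id : k →ₗ[k] k)) c

lemma contrH_odd {a : ℤ} (ha : ¬ Even a) (b : ℤ) (c : (contr k).X a) : contrH k a b c = 0 :=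
  LinearMap.congr_fun (if_neg ha : contrH k a b = (0 : k →ₗ[k] k)) c

/-- In `contr` exactly one of dh and hd is the identity, the former in even and the latter in odd
degrees, and the other one is zero. -/
lemma exists_dl_eq_homL_contr (M : LMod U) (E : Finset ℕ) (n m l : ℤ) (hn : m + 1 = n)
    (hl : l + 1 = m) (x : (homL (contr k) M).El E m)
    (hx : dl (homL (contr k) M).M.S E m l x = 0) :
    ∃ w : (homL (contr k) M).El E n, dl (homL (contr k) M).M.S E n m w = x := by
  refine exists_dl_eq_of_contraction (C := contr k) (S := M.M.S) (contrH k) (fun a c => ?_)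
    hn hl x hx
  by_cases ha : Even a
  · have ha' : Odd (a + 1) := by simpa [parity_simps] using ha
    rw [contrH_even ha, contr_d_odd rfl ha', contr_d_even ha, map_zero, add_zero]
  · have ha' : Even (a - 1) := by simpa [parity_simps] using ha
    rw [contrH_odd ha, contrH_even ha', map_zero, zero_add,
      contr_d_odd (by omega) (Int.not_even_iff_odd.1 ha)]

variable (k) in
/-- The element `1` of degree `0`. -/
def contrOne : (contr k).X 0 := (1 : k)

/-- The evaluation `Hom(C, M) ⟶ M` at the cycle `1 ∈ C_0`. -/
def homLEval (M : LMod U) : homL (contr k) M ⟶ M :=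
  LMod.homMk (M := homL (contr k) M) (N := M)
    (fun E n => (hp (C := contr k) (M := M.M.S) (zero_add n)).flip (contrOne k))
    -- The element 1 is a cycle because the differential out of even degrees is zero, and its degree
    -- 0 makes the sign of the differential trivial. The degree also trivialises the sign in the
    -- U-action below.
    (fun E n n' x h => by
      refine (hp_dl h (i' := -1) (m := n) (by omega) (by omega) _ (zero_add n) (by omega) _
        _).trans ?_
      rw [contr_d_even (by decide), map_zero, sub_zero]
      simp [sg]
      rfl)
    (fun σ n x => hp_rl σ _ x _)
    (fun {E F G e} h {i j n} hn x p => hp_act h hn _ (zero_add i) (by omega) x p _)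
    (fun {A B E} hs {i j n} hn x y => by
      refine (hp_u hs hn _ (zero_add j) (by omega) x y _).trans ?_
      simp [sg]
      rfl)

lemma homLEval_surjective (M : LMod U) (E : Finset ℕ) (n : ℤ) :
    Function.Surjective (LMod.app (homLEval M) E n) := by
  intro y
  -- The preimage is supported on degree 0 of `contr` and sends 1 to y. It need not commute with
  -- differentials, as elements of Hom(C, M) are arbitrary families of linear maps.
  let w : El (homS (contr k) M.M.S) E n := hmk fun {a m} ha =>
    if h : a = 0 then LinearMap.toSpanSingleton k _ ((show n = m by omega) ▸ y) else 0
  refine ⟨w, (?_ : hp (zero_add n) w (contrOne k) = y)⟩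
  exact one_smul k y

end contractible

/-! ### Sums of morphisms -/

section add

variable {P : Operad k} {U : RAlg P} {M N L : LMod U}

/-- Just enough additive structure to form the map (a, φ) ↦ i(a) + φ(1) out of a product. -/
instance : Zero (M ⟶ N) where
  zero := LMod.homMk 0 (fun _ _ _ _ _ => (map_zero _).symm) (fun _ _ _ => (map_zero _).symm)
    (fun _ _ _ _ _ _ _ => by simp) (fun _ _ _ _ _ _ _ => by simp)

instance : Add (M ⟶ N) where
  add f g := LMod.homMk (fun E n => LMod.app f E n + LMod.app g E n)
    (fun E n n' x _ => by simp only [LinearMap.add_apply, LMod.app_dl, map_add])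
    (fun σ n x => by simp only [LinearMap.add_apply, LMod.app_rl, map_add])
    (fun h _ _ _ hn x p => by simp only [LinearMap.add_apply, LMod.app_act, map_add])
    (fun hs _ _ _ hn x y => by simp only [LinearMap.add_apply, LMod.app_u, map_add])

lemma LMod.app_zero (E : Finset ℕ) (n : ℤ) (x : M.El E n) : app (0 : M ⟶ N) E n x = 0 := rfl

lemma LMod.app_add (f g : M ⟶ N) (E : Finset ℕ) (n : ℤ) (x : M.El E n) :
    app (f + g) E n x = app f E n x + app g E n x := rfl

lemma LMod.comp_add (f : M ⟶ N) (g h : N ⟶ L) : f ≫ (g + h) = f ≫ g + f ≫ h :=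
  LMod.hom_ext_app fun _ _ _ => rfl

lemma LMod.add_zero_comp (f : M ⟶ L) (g : N ⟶ L) : f + (0 : M ⟶ N) ≫ g = f :=
  LMod.hom_ext_app fun _ _ _ => by
    rw [LMod.app_add, LMod.app_comp, LMod.app_zero, map_zero, add_zero]

lemma LMod.zero_comp_add (f : M ⟶ L) (g : N ⟶ L) : (0 : M ⟶ N) ≫ g + f = f :=
  LMod.hom_ext_app fun _ _ _ => by
    rw [LMod.app_add, LMod.app_comp, LMod.app_zero, map_zero, zero_add]

end add

/-! ### The model structure -/

section model

variable {P : Operad k} (U : RAlg P)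

/-- Weak equivalences of left `U`-modules. -/
abbrev weqL : MorphismProperty (LMod U) := (rmodWeakEquivalences P).inverseImage (forgetL U)

/-- Fibrations of left `U`-modules. -/
abbrev fibL : MorphismProperty (LMod U) := (rmodFibrations P).inverseImage (forgetL U)

instance : (weqL U).HasTwoOutOfThreeProperty where
  comp_mem f g hf hg E := by
    have : QuasiIso (f.hom.hom.app E) := hf E
    have : QuasiIso (g.hom.hom.app E) := hg E
    exact quasiIso_comp (f.hom.hom.app E) (g.hom.hom.app E)
  of_postcomp f g hg hfg E := by
    have : QuasiIso (g.hom.hom.app E) := hg E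
    have : QuasiIso (f.hom.hom.app E ≫ g.hom.hom.app E) := hfg E
    exact quasiIso_of_comp_right (f.hom.hom.app E) (g.hom.hom.app E)
  of_precomp f g hf hfg E := by
    have : QuasiIso (f.hom.hom.app E) := hf E
    have : QuasiIso (f.hom.hom.app E ≫ g.hom.hom.app E) := hfg E
    exact quasiIso_of_comp_left (f.hom.hom.app E) (g.hom.hom.app E)

instance : (weqL U).IsStableUnderRetracts where
  of_retract h hg E :=
    (HomologicalComplex.quasiIso (ModuleCat.{u} k) (ComplexShape.down ℤ)).of_retract
      (h.map (evS U E)) (hg E)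

lemma weqL_id (M : LMod U) : weqL U (𝟙 M) := fun E =>
  inferInstanceAs (QuasiIso (𝟙 (M.M.S.obj E)))

lemma FI_rlp_eq : (FI U).rlp = fibL U ⊓ weqL U := FI_rlp U

lemma FJ_rlp_eq : (FJ U).rlp = fibL U := FJ_rlp U

instance : HasFiniteLimits (LMod U) :=
  have := hasLimitsOfSizeShrink.{0, 0, u, u} (LMod U)
  inferInstance

instance : HasFiniteColimits (LMod U) :=
  have := hasColimitsOfSizeShrink.{0, 0, u, u} (LMod U)
  inferInstance

variable {U} in
-- The second factor is acyclic, so its component of the upper map extends over the disk, while the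
-- first component of the filler is given by the square.
lemma FI_rlp_prod_fst (A M : LMod U) : (FI U).rlp (prod.fst : A ⨯ homL (contr k) M ⟶ A) := by
  rintro _ _ _ ⟨d, r⟩
  refine ⟨fun {f g} sq => ?_⟩
  obtain ⟨h, hh⟩ := exists_genMap_sphereToDisk_comp (exists_dl_eq_homL_contr M) (f ≫ prod.snd)
  refine ⟨⟨⟨prod.lift g h, ?_, prod.lift_fst _ _⟩⟩⟩
  ext
  · rw [Category.assoc, prod.lift_fst, sq.w]
  · rw [Category.assoc, prod.lift_snd, hh]

/-- Factors i as a weak equivalence w = (id, 0) followed by a fibration p. Lifting i against p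
exhibits i as a retract of w. -/
lemma fibL_llp_le_weqL : (fibL U).llp ≤ weqL U := by
  intro A B i hi
  let w : A ⟶ A ⨯ homL (contr k) B := prod.lift (𝟙 A) 0
  let p : A ⨯ homL (contr k) B ⟶ B := prod.fst ≫ i + prod.snd ≫ homLEval B
  -- The map w is a section of the first projection, which is an acyclic fibration; two-out-of-three
  -- applies.
  have hw : weqL U w := by
    have h1 : weqL U (prod.fst : A ⨯ homL (contr k) B ⟶ A) :=
      ((FI_rlp_eq U).le _ (FI_rlp_prod_fst A B)).2
    refine (weqL U).of_postcomp w prod.fst h1 ?_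
    rw [prod.lift_fst]
    exact weqL_id U A
  -- The restriction of p to the second factor is evaluation at 1, which is already surjective.
  have hp : fibL U p := by
    intro E n y
    obtain ⟨x, rfl⟩ := homLEval_surjective B E.set n y
    refine ⟨LMod.app (prod.lift 0 (𝟙 _) : homL (contr k) B ⟶ A ⨯ homL (contr k) B) E.set n x, ?_⟩
    have h2 : (prod.lift 0 (𝟙 _) : homL (contr k) B ⟶ A ⨯ homL (contr k) B) ≫ p =
        homLEval B := by
      rw [LMod.comp_add, ← Category.assoc, ← Category.assoc, prod.lift_fst, prod.lift_snd,
        Category.id_comp, LMod.zero_comp_add]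
    exact congrArg (fun φ => LMod.app φ E.set n x) h2
  have hwp : w ≫ p = i := by
    rw [LMod.comp_add, ← Category.assoc, ← Category.assoc, prod.lift_fst, prod.lift_snd,
      Category.id_comp, LMod.add_zero_comp]
  have := hi p hp
  exact (weqL U).of_retract (RetractArrow.ofLeftLiftingProperty hwp) hw

/-- The retract argument: in a factorisation i = p ∘ j by the small object argument for FJ, the map
j is a weak equivalence. If i is one, then p is an acyclic fibration, so a cofibration i lifts
against p and is a retract of j. -/
lemma weqL_inf_cof : (FI U).rlp.llp ⊓ weqL U = (FJ U).rlp.llp := by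
  have := hasSmallObjectArgument_FJ U
  apply le_antisymm
  · rintro A B i ⟨hi, hw⟩
    let h := MorphismProperty.factorizationData (FJ U).rlp.llp (FJ U).rlp i
    have h1 : weqL U h.i := fibL_llp_le_weqL U _ (FJ_rlp_eq U ▸ h.hi)
    have h2 : weqL U h.p := (weqL U).of_precomp h.i h.p h1 (by rw [h.fac]; exact hw)
    have : HasLiftingProperty i h.p := hi _ (by
      rw [FI_rlp_eq]
      exact ⟨FJ_rlp_eq U ▸ h.hp, h2⟩)
    exact (FJ U).rlp.llp.of_retract (RetractArrow.ofLeftLiftingProperty h.fac) h.hi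
  · refine le_inf (MorphismProperty.antitone_llp ?_) ?_
    · rw [FI_rlp_eq, FJ_rlp_eq]
      exact inf_le_left
    · rw [FJ_rlp_eq]
      exact fibL_llp_le_weqL U

/-- The model structure on left `U`-modules. -/
abbrev modelCategoryLMod : ModelCategory (LMod U) :=
  letI : CategoryWithFibrations (LMod U) := ⟨fibL U⟩
  letI : CategoryWithWeakEquivalences (LMod U) := ⟨weqL U⟩
  letI : CategoryWithCofibrations (LMod U) := ⟨(FI U).rlp.llp⟩
  haveI : (weakEquivalences (LMod U)).HasTwoOutOfThreeProperty :=
    inferInstanceAs (weqL U).HasTwoOutOfThreeProperty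
  haveI := hasSmallObjectArgument_FI U
  haveI := hasSmallObjectArgument_FJ U
  -- Both weak factorisation systems take the form (K.rlp.llp, K.rlp) with K = FI or FJ. The small
  -- object argument gives the factorisations, and the lifting property holds by definition of
  -- `llp`.
  haveI : (cofibrations (LMod U)).IsWeakFactorizationSystem (trivialFibrations (LMod U)) := by
    change (FI U).rlp.llp.IsWeakFactorizationSystem (fibL U ⊓ weqL U)
    rw [← FI_rlp_eq]
    exact .mk' _ _ fun _ _ hi hp => hi _ hp
  haveI : (trivialCofibrations (LMod U)).IsWeakFactorizationSystem (fibrations (LMod U)) := by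
    change ((FI U).rlp.llp ⊓ weqL U).IsWeakFactorizationSystem (fibL U)
    rw [weqL_inf_cof, ← FJ_rlp_eq]
    exact .mk' _ _ fun _ _ hi hp => hi _ hp
  ModelCategory.mk' (LMod U)

end model

end

end DGOperad

theorem mainTheorem3 {k : Type u} [CommRing k] (P : DGOperad.Operad k)
    (hP : ∀ E : DGOperad.Bij, DGOperad.IsCofibrantDG (P.S.obj E)) (U : DGOperad.RAlg P) :
    HasLimitsOfSize.{u, u} (DGOperad.LMod U) ∧ HasColimitsOfSize.{u, u} (DGOperad.LMod U) ∧
    ∃ _ : ModelCategory (DGOperad.LMod U),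
      weakEquivalences (DGOperad.LMod U) =
        (DGOperad.rmodWeakEquivalences P).inverseImage (DGOperad.forgetL U) ∧
      fibrations (DGOperad.LMod U) =
        (DGOperad.rmodFibrations P).inverseImage (DGOperad.forgetL U) ∧
      DGOperad.IsCofibrantlyGenerated (DGOperad.LMod U) (DGOperad.FI U) (DGOperad.FJ U) := by
  refine ⟨inferInstance, inferInstance, DGOperad.modelCategoryLMod U, rfl, rfl, ?_⟩
  exact
    letI := DGOperad.modelCategoryLMod U
    { smallObject_I := DGOperad.hasSmallObjectArgument_FI U
      smallObject_J := DGOperad.hasSmallObjectArgument_FJ U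
      trivialFibrations_eq := (DGOperad.FI_rlp_eq U).symm
      fibrations_eq := (DGOperad.FJ_rlp_eq U).symm }
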